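/- **Setting.** Let $\xi=(\xi^1,\dots,\xi^m)$ have independent components, where $\xi^k$ has a distribution with finite support $\Xi_k\subset\mathbb R$ and distribution function $F_k$. Consider the two-stage stochastic linear program with fixed recourse $$\min_{x\in X}\ g(x)=\mathbb E[G(x,\xi)],\qquad G(x,\xi)=c^Tx+Q(x,\xi),\qquad Q(x,\xi)=\inf\{q^Ty:\ Wy\le h-Tx,\ y\ge 0\},$$ where $X\subset\mathbb R^p$ is a compact polyhedron, $W$ is fixed and $h,q,T$ are determined by $\xi$ (for instance their entries are coordinates of $\xi$ or constants). For $z\in(0,1]^m$ put $\Psi(z)=(F_1^{-1}(z_1),\dots,F_m^{-1}(z_m))$ with $F_k^{-1}(z)=\inf\{y\in\Xi_k: F_k(y)\ge z\}$, and $\tilde G(x,z)=G(x,\Psi(z))$; let $\tilde\xi$ be uniform on $(0,1]^m$. Assume that $\mathbb E[\tilde G(x,\tilde\xi)^2]<\infty$ for every $x\in X$ and that the program has a unique solution $x^*$. For $u\subseteq\mathcal D=\{1,\dots,m\}$ let $\tilde G_u(x^*,\cdot)$ be the functional ANOVA components of $f=\tilde G(x^*,\cdot)$, defined recursively by $f_u(\tilde\xi^u)=\int\big(f-\sum_{v\subsetneq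 u}f_v\big)\prod_{k\notin u}d\tilde\xi^k$. For a batch $D$ of scenarios $\tilde\xi_1,\dots,\tilde\xi_n\in(0,1]^m$ let $v_n(D)=\min_{x\in X}\frac1n\sum_{i=1}^n\tilde G(x,\tilde\xi_i)$. **Design.** Let $n=\lambda t$, $N=nt$, and let $O$ be an orthogonal array OA$(N,m+1,t,2)$: an $N\times(m+1)$ array over $t$ symbols $1,\dots,t$ ($m\ge1$) such that in any two columns each ordered pair of symbols occurs in exactly $\lambda\ge1$ rows. The SOLH batches $D_1,\dots,D_t$ are constructed as follows, all random permutations below being uniform and mutually independent. 1. Permute the rows, the columns, and, within each column separately, the symbols of $O$ at random; call the result $C$. 2. Sort the rows of $C$ by the symbol in column $m+1$; the first $m$ columns of the $n$ rows with symbol $r$ in column $m+1$ form the $n\times m$ array $A_r$, $r=1,\dots,t$. 3. For all $r\le t$, $k\le m$ and $\ell\le t$, replace the $\lambda$ entries equal to $\ell$ in column $k$ of $A_r$ by a random permutation of $\{(\ell-1)\lambda+1,\dots,\ell\lambda\}$. 4. Then, for all $k\le m$ and $\ell\le n$, replace the $t$ entries equal to $\ell$ in the $k$th columns of $A_1,\dots,A_t$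 (one in each) by a random permutation of $\{(\ell-1)t+1,\dots,\ell t\}$. 5. With $a_{r,ik}$ the resulting entries, $D_r$ has the entries $(a_{r,ik}-\gamma_{r,ik})/N$, where the $\gamma_{r,ik}$ are independent $U[0,1)$ variables, independent of all the permutations. Put $L^{SOLH}_{n,t}=\frac1t\sum_{r=1}^t v_n(D_r)$, and let $M(u,r)$ be the number of pairs $(i,j)\in\{1,\dots,N\}^2$ ($i=j$ allowed) such that rows $i$ and $j$ of $C$ agree in exactly $r$ of the columns in $u\subseteq\mathcal D$. $M(u,r)$ depends only on $O$ and on the order of the columns chosen in step 1. **Theorem.** As $t\to\infty$ with $\lambda/t\to0$ (in particular for fixed index $\lambda$), uniformly over all arrays OA$(N,m+1,t,2)$, $L^{SOLH}_{n,t}$ is square integrable and: (a) uniformly over the orders of the columns, conditionally on the order of the columns chosen in step 1, $$\operatorname{var}(L^{SOLH}_{n,t}\mid\text{column order})=N^{-2}\sum_{u\subseteq\mathcal D,\ |u|\ge3}M(u,|u|)\,\operatorname{var}[\tilde G_u(x^*,\tilde\xi^u)]+o(N^{-1});$$ (b) unconditionally, the same formula holds with the expectation of $M(u,|u|)$ over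 the random column order: $$\operatorname{var}(L^{SOLH}_{n,t})=N^{-2}\sum_{u\subseteq\mathcal D,\ |u|\ge3}\mathbb E[M(u,|u|)]\,\operatorname{var}[\tilde G_u(x^*,\tilde\xi^u)]+o(N^{-1}).$$ Thus the main effects and the bivariate interactions are filtered out of the variance up to $o(N^{-1})$. -/

import Mathlib

open MeasureTheory ProbabilityTheory

/-- The uniform distribution on the cube `(0,1]^m`. -/
noncomputable def uniformCube (m : ℕ) : Measure (Fin m → ℝ) :=
  Measure.pi fun _ => volume.restrict (Set.Ioc (0 : ℝ) 1)

/-- The functional ANOVA component `f_u`, written as a function of the whole vector `z` although it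
depends only on `z^u`: `f_u(z^u) = ∫ (f - ∑_{v ⊂ u} f_v) dF_{D - u}`, the sum being over the proper
subsets `v` of `u` and the integral over the coordinates outside `u`. -/
noncomputable def anova {m : ℕ} (f : (Fin m → ℝ) → ℝ) (u : Finset (Fin m)) (z : Fin m → ℝ) : ℝ :=
  ∫ w, (f (u.piecewise z w) - ∑ v ∈ u.ssubsets.attach, anova f v.1 (u.piecewise z w))
    ∂(uniformCube m)
termination_by u.card
decreasing_by exact Finset.card_lt_card (Finset.mem_ssubsets.mp v.2)

/-- The coordinatewise quantile transform
`Ψ(z)_k = F_k⁻¹(z_k) = inf {y ∈ supp ν_k : F_k(y) ≥ z_k}`. -/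
noncomputable def quantileMap {m : ℕ} (ν : Fin m → Measure ℝ) (z : Fin m → ℝ) : Fin m → ℝ :=
  fun k => sInf {y : ℝ | y ∈ (ν k).support ∧ z k ≤ cdf (ν k) y}

/-- The data of a two-stage stochastic linear program with fixed recourse matrix `W`, first-stage
variables in `ℝ^p`, first-stage polyhedron `{x | A x ≤ β}`, second-stage variables in `ℝ^b`, and
right-hand side, second-stage cost and technology matrix determined by the random vector
`ξ ∈ ℝ^m` (for instance, each of their entries is a coordinate of `ξ` or a constant). -/
structure TwoStageLP (m p e a b : ℕ) where
  /-- first-stage cost -/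
  c : Fin p → ℝ
  /-- matrix of the first-stage constraints -/
  A : Matrix (Fin e) (Fin p) ℝ
  /-- right-hand side of the first-stage constraints -/
  β : Fin e → ℝ
  /-- recourse matrix -/
  W : Matrix (Fin a) (Fin b) ℝ
  /-- random right-hand side -/
  h : (Fin m → ℝ) → Fin a → ℝ
  /-- random second-stage cost -/
  q : (Fin m → ℝ) → Fin b → ℝ
  /-- random technology matrix -/
  T : (Fin m → ℝ) → Matrix (Fin a) (Fin p) ℝ

namespace TwoStageLP

variable {m p e a b : ℕ} (S : TwoStageLP m p e a b)

/-- The first-stage feasible set. -/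
def X : Set (Fin p → ℝ) := {x | S.A.mulVec x ≤ S.β}

/-- The second-stage value `Q(x,ξ) = inf {qᵀy : W y ≤ h - T x, y ≥ 0}`; it is `⊤` if the
second-stage problem is infeasible and `⊥` if it is unbounded. -/
noncomputable def Q (x : Fin p → ℝ) (ξ : Fin m → ℝ) : EReal :=
  ⨅ y ∈ {y : Fin b → ℝ | S.W.mulVec y ≤ S.h ξ - (S.T ξ).mulVec x ∧ 0 ≤ y},
    ((dotProduct (S.q ξ) y : ℝ) : EReal)

/-- `G(x,ξ) = cᵀx + Q(x,ξ)` with values in the extended reals. -/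
noncomputable def costE (x : Fin p → ℝ) (ξ : Fin m → ℝ) : EReal :=
  ((dotProduct S.c x : ℝ) : EReal) + S.Q x ξ

/-- `G(x,ξ)` as a real number (its value where it is finite). -/
noncomputable def G (x : Fin p → ℝ) (ξ : Fin m → ℝ) : ℝ := (S.costE x ξ).toReal

/-- The objective `g(x) = E[G(x,ξ)]`, where the coordinates of `ξ` are independent with laws
`ν_k`. -/
noncomputable def g (ν : Fin m → Measure ℝ) (x : Fin p → ℝ) : ℝ := ∫ ξ, S.G x ξ ∂(Measure.pi ν)

/-- The set `S*` of optimal solutions of the true problem `min_{x ∈ X} g(x)`. -/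
def optimalSet (ν : Fin m → Measure ℝ) : Set (Fin p → ℝ) :=
  {x | x ∈ S.X ∧ ∀ y ∈ S.X, S.g ν x ≤ S.g ν y}

/-- The optimal value `v_n(D)` of the sample-average problem
`min_{x ∈ X} n⁻¹ ∑_i G̃(x, D_i)`, where `G̃(x,z) = G(x,Ψ(z))` and the rows `D_i` of `D` are points
of `(0,1]^m`. -/
noncomputable def saaValue (ν : Fin m → Measure ℝ) {n : ℕ} (D : Fin n → Fin m → ℝ) : ℝ :=
  ⨅ x : S.X, (n : ℝ)⁻¹ * ∑ i, S.G x (quantileMap ν (D i))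

/-- The lower bound estimator `L = t⁻¹ ∑_r v_n(D_r)` computed from the batches `D_1, …, D_t`. -/
noncomputable def lowerBound (ν : Fin m → Measure ℝ) {t n : ℕ}
    (D : Fin t → Fin n → Fin m → ℝ) : ℝ :=
  (t : ℝ)⁻¹ * ∑ r, S.saaValue ν (D r)

end TwoStageLP

/-- `C` is an orthogonal array with `N` rows, `k` columns, `s` symbols, strength `τ` and index
`lam`: `τ ≤ k`, and in any `τ` distinct columns each `τ`-tuple of symbols occurs in exactly `lam`
rows. -/
def IsOrthogonalArray {N k s : ℕ} (τ lam : ℕ) (C : Fin N → Fin k → Fin s) : Prop :=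
  τ ≤ k ∧ ∀ (cols : Fin τ ↪ Fin k) (w : Fin τ → Fin s),
    (Finset.univ.filter fun i : Fin N => ∀ j, C i (cols j) = w j).card = lam

/-- `M(u,r)`: the number of ordered pairs `(i,j)` of rows of `C` (`i = j` allowed) which agree in
exactly `r` of the columns in `u`. -/
def coincidences {N k s : ℕ} (C : Fin N → Fin k → Fin s) (u : Finset (Fin k)) (r : ℕ) : ℕ :=
  (Finset.univ.filter fun ij : Fin N × Fin N =>
    (u.filter fun k => C ij.1 k = C ij.2 k).card = r).card

/-- The permutations drawn in the construction of a sliced orthogonal array based Latin hypercube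
design from an array with `N = t * (t * lam)` rows and `m + 1` columns over `t` symbols. -/
@[ext] structure SolhPerms (t lam m : ℕ) where
  /-- randomization of the rows -/
  row : Equiv.Perm (Fin (t * (t * lam)))
  /-- randomization of the columns -/
  col : Equiv.Perm (Fin (m + 1))
  /-- randomization of the symbols, one permutation for each column -/
  sym : Fin (m + 1) → Equiv.Perm (Fin t)
  /-- for every batch, column and symbol, the permutation that spreads the `lam` occurrences of the
  symbol -/
  sub : Fin t → Fin m → Fin t → Equiv.Perm (Fin lam)
  /-- for every column and each of the `n = t * lam` levels, the permutation that spreads the `t`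
  occurrences of the level, one in each batch -/
  lev : Fin m → Fin (t * lam) → Equiv.Perm (Fin t)

instance (t lam m : ℕ) : MeasurableSpace (SolhPerms t lam m) := ⊤

instance (t lam m : ℕ) : Finite (SolhPerms t lam m) :=
  Finite.of_injective
    (fun ω : SolhPerms t lam m => (ω.row, ω.col, ω.sym, ω.sub, ω.lev))
    (by
      intro x y h
      simp only [Prod.mk.injEq] at h
      exact SolhPerms.ext h.1 h.2.1 h.2.2.1 h.2.2.2.1 h.2.2.2.2)

instance (t lam m : ℕ) : Nonempty (SolhPerms t lam m) :=
  ⟨⟨1, 1, fun _ => 1, fun _ _ _ => 1, fun _ _ => 1⟩⟩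

/-- The sample space: the permutations together with the jitters `γ_{r,ik}`. -/
abbrev SolhSpace (t lam m : ℕ) : Type :=
  SolhPerms t lam m × (Fin t → Fin (t * lam) → Fin m → ℝ)

/-- All permutations are uniform and mutually independent (uniform distribution on the product), and
independent of the jitters, which are independent with distribution `U[0,1)`. -/
noncomputable def solhLaw (t lam m : ℕ) : Measure (SolhSpace t lam m) :=
  (uniformOn (Set.univ : Set (SolhPerms t lam m))).prod
    (Measure.pi fun _ => Measure.pi fun _ => Measure.pi fun _ =>
      volume.restrict (Set.Ico (0 : ℝ) 1))

section Construction

variable {t lam m : ℕ}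

/-- The array `C` obtained from `O` by randomizing its rows, columns and symbols. -/
def randomizedArray (O : Fin (t * (t * lam)) → Fin (m + 1) → Fin t) (ω : SolhPerms t lam m) :
    Fin (t * (t * lam)) → Fin (m + 1) → Fin t :=
  fun i k => ω.sym k (O (ω.row i) (ω.col k))

/-- The slices `A_r` of `C`: the rows are (stably) sorted by the symbol in the last column, then
`a_{r,ik}` is the entry of column `k ≤ m` in row number `r n + i` (indices starting at `0`). -/
def sliceSymbol (O : Fin (t * (t * lam)) → Fin (m + 1) → Fin t) (ω : SolhPerms t lam m)
    (r : Fin t) (i : Fin (t * lam)) (k : Fin m) : Fin t :=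
  randomizedArray O ω
    (Tuple.sort (fun j => randomizedArray O ω j (Fin.last m)) (finProdFinEquiv (r, i))) k.castSucc

/-- The number of earlier rows of `A_r` with the same symbol in column `k` as row `i`. -/
def sliceRank (O : Fin (t * (t * lam)) → Fin (m + 1) → Fin t) (ω : SolhPerms t lam m)
    (r : Fin t) (i : Fin (t * lam)) (k : Fin m) : ℕ :=
  (Finset.univ.filter fun i' : Fin (t * lam) =>
    i' < i ∧ sliceSymbol O ω r i' k = sliceSymbol O ω r i k).card

/-- The `lam` occurrences of the symbol `ℓ` in `A_r(:,k)` are replaced by a random permutation of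
the `lam` levels `lam * ℓ + j`, `0 ≤ j < lam`. -/
def sliceLevel [NeZero lam] (O : Fin (t * (t * lam)) → Fin (m + 1) → Fin t)
    (ω : SolhPerms t lam m) (r : Fin t) (i : Fin (t * lam)) (k : Fin m) : Fin (t * lam) :=
  finProdFinEquiv (sliceSymbol O ω r i k,
    ω.sub r k (sliceSymbol O ω r i k) (Fin.ofNat lam (sliceRank O ω r i k)))

/-- The `t` occurrences of the level `ℓ` in the `k`th columns of all batches are replaced by a random
permutation of the `t` levels `t * ℓ + j`, `0 ≤ j < t`. -/
def fineLevel [NeZero lam] (O : Fin (t * (t * lam)) → Fin (m + 1) → Fin t)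
    (ω : SolhPerms t lam m) (r : Fin t) (i : Fin (t * lam)) (k : Fin m) : Fin (t * lam * t) :=
  finProdFinEquiv (sliceLevel O ω r i k, ω.lev k (sliceLevel O ω r i k) r)

/-- The batches `D_1, …, D_t`: `ξ_{r,ik} = (a_{r,ik} - γ_{r,ik}) / N` with `N = n t`, where
`a_{r,ik}` is the final level, counted from `1`. -/
noncomputable def solhDesign [NeZero lam] (O : Fin (t * (t * lam)) → Fin (m + 1) → Fin t)
    (ω : SolhSpace t lam m) : Fin t → Fin (t * lam) → Fin m → ℝ :=
  fun r i k => (((fineLevel O ω.1 r i k : ℕ) : ℝ) + 1 - ω.2 r i k) / ((t * lam * t : ℕ) : ℝ)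

end Construction

open scoped BigOperators

/-! The quantile transform takes finitely many values, each on a box whose sides are intervals.
Hence the optimal value of a batch is `Φ(w)`, where `w` lists the fractions of the batch's points in
these boxes and `Φ(w) = min_x ∑ w_s G(x,s)`.

Linearization. The feasible set of the deterministic equivalent, with variables `x` and one recourse
vector per scenario, has finitely many vertices. They do not depend on `w`, so `Φ` is a minimum of
finitely many linear functions (`exists_finite_minimizers`). Uniqueness of the solution makes the
linear function of `x*` minimal near the true probabilities (`exists_stable_minimizer`). Inside a
batch every column is balanced and its symbols are permuted independently of the other columns, so
box frequencies leave a fixed neighbourhood of their means with probability exponentially small in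
`t` (`expect_exp_perm_le`, `expect_tail_prod_le`). Since `N ≤ t³` once `lam ≤ t`, replacing `Φ` by
its linear part changes the variance by `o(1/N)`.

Variance of the linear part. What remains is the average of one step function over all `N` points.
Given the permutations that decide which row goes where, the columns are independent, so second
moments are products over columns. For two entries of one column, the covariance of interval
indicators is nearly a constant times `agreeFactor`: `1` if the symbols agree and `-1/(t-1)`
otherwise. The errors come from the at most two cells that an interval cuts, and for a fixed row
they sum to `O(1/t)` (`sum_errBound_le`).

Expanding the product over subsets `u` of columns, strength two makes the sums of the products of
`agreeFactor` vanish for `|u| = 1, 2` (`sum_prod_agreeFactor_eq_zero`). For `|u| ≥ 3` they equal the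
number of full coincidences up to `O(lam/t)` per row (`abs_sum_prod_agreeFactor_sub_le`). The
coefficients are the ANOVA variances (`variance_anova`). The conditional mean does not depend on the
permutations held fixed, so averaging the conditional second moments suffices; averaging over any
set of column orders treats (a) and (b) together. -/

/-! ### Vertices of polyhedra. -/

/-- A linear functional that is nonnegative on the recession cone of a polyhedron without lines
is minimized at a point whose tight constraints have trivial kernel. -/
theorem exists_vertex_le {E I : Type*} [AddCommGroup E] [Module ℝ E] [Fintype I]
    (a : I → E →ₗ[ℝ] ℝ) (b : I → ℝ) (hline : ∀ d, (∀ i, a i d = 0) → d = 0)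
    (l : E →ₗ[ℝ] ℝ) (hl : ∀ d, (∀ i, a i d ≤ 0) → 0 ≤ l d) :
    ∀ (n : ℕ) (w : E), (∀ i, a i w ≤ b i) →
      (Finset.univ.filter fun i => a i w < b i).card ≤ n →
      ∃ v, (∀ i, a i v ≤ b i) ∧ (∀ d, (∀ i, a i v = b i → a i d = 0) → d = 0) ∧ l v ≤ l w := by
  classical
  intro n
  induction n with
  | zero =>
    intro w hw hc
    refine ⟨w, hw, fun d hd => hline d fun i => hd i ?_, le_rfl⟩
    by_contra hne
    have : i ∈ Finset.univ.filter fun i => a i w < b i := by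
      simpa using lt_of_le_of_ne (hw i) hne
    rw [Finset.card_eq_zero.mp (Nat.le_zero.mp hc)] at this
    simp at this
  | succ n ih =>
    intro w hw hc
    by_cases hv : ∀ d, (∀ i, a i w = b i → a i d = 0) → d = 0
    · exact ⟨w, hw, hv, le_rfl⟩
    push Not at hv
    obtain ⟨d₀, hd₀, hne⟩ := hv
    -- One of `±d₀` does not increase `l`. If `l` strictly decreases, the recession hypothesis
    -- supplies a constraint that blocks the ray; if `l` is constant, the absence of lines supplies
    -- one for one of the two signs.
    obtain ⟨d, hd, hld, i₀, hi₀⟩ : ∃ d, (∀ i, a i w = b i → a i d = 0) ∧ l d ≤ 0 ∧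
        ∃ i, 0 < a i d := by
      have hneg : ∀ i, a i w = b i → a i (-d₀) = 0 := fun i hi => by simp [hd₀ i hi]
      rcases lt_trichotomy (l d₀) 0 with h | h | h
      · refine ⟨d₀, hd₀, h.le, ?_⟩
        by_contra hcon
        push Not at hcon
        exact absurd (hl d₀ hcon) (not_le.mpr h)
      · by_cases hp : ∃ i, 0 < a i d₀
        · exact ⟨d₀, hd₀, h.le, hp⟩
        · push Not at hp
          refine ⟨-d₀, hneg, by simp [h], ?_⟩
          by_contra hcon
          push Not at hcon
          refine hne (hline d₀ fun i => le_antisymm (hp i) ?_)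
          have := hcon i
          rw [map_neg] at this
          linarith
      · refine ⟨-d₀, hneg, by simp [h.le], ?_⟩
        by_contra hcon
        push Not at hcon
        have := hl _ hcon
        rw [map_neg] at this
        linarith
    -- Ratio test: move along `d` until the first constraint `j` becomes tight. Tight constraints
    -- stay tight, so the number of slack ones drops.
    obtain ⟨j, hj, hmin⟩ := (Finset.univ.filter fun i => 0 < a i d).exists_min_image
      (fun i => (b i - a i w) / a i d) ⟨i₀, by simpa using hi₀⟩
    simp only [Finset.mem_filter, Finset.mem_univ, true_and] at hj hmin
    set τ := (b j - a j w) / a j d with hτ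
    have hτ0 : 0 ≤ τ := div_nonneg (sub_nonneg.mpr (hw j)) hj.le
    have hfeas : ∀ i, a i (w + τ • d) ≤ b i := by
      intro i
      rw [map_add, map_smul, smul_eq_mul]
      by_cases hi : 0 < a i d
      · have := (le_div_iff₀ hi).mp (hmin i hi)
        linarith
      · have := mul_nonneg hτ0 (neg_nonneg.mpr (not_lt.mp hi))
        have := hw i
        linarith
    have htight : a j (w + τ • d) = b j := by
      rw [map_add, map_smul, smul_eq_mul, hτ, div_mul_cancel₀ _ hj.ne']
      ring
    have hjw : a j w < b j := by
      refine lt_of_le_of_ne (hw j) fun h => ?_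
      rw [hd j h] at hj
      exact lt_irrefl _ hj
    obtain ⟨v, hv1, hv2, hv3⟩ := ih (w + τ • d) hfeas (by
      have hss : (Finset.univ.filter fun i => a i (w + τ • d) < b i) ⊂
          Finset.univ.filter fun i => a i w < b i := by
        rw [Finset.ssubset_iff_of_subset]
        · exact ⟨j, by simpa using hjw, by simp [-map_add, htight]⟩
        · intro i hi
          simp only [Finset.mem_filter, Finset.mem_univ, true_and] at hi ⊢
          refine lt_of_le_of_ne (hw i) fun h => ?_
          rw [map_add, map_smul, hd i h, h] at hi
          simp at hi
      have := Finset.card_lt_card hss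
      omega)
    refine ⟨v, hv1, hv2, hv3.trans ?_⟩
    rw [map_add, map_smul, smul_eq_mul]
    have := mul_nonneg hτ0 (neg_nonneg.mpr hld)
    linarith

/-- A vertex is determined by its set of tight constraints: the difference of two vertices with the
same set lies in the trivial kernel. -/
theorem finite_vertices {E I : Type*} [AddCommGroup E] [Module ℝ E] [Fintype I]
    (a : I → E →ₗ[ℝ] ℝ) (b : I → ℝ) :
    {v : E | (∀ i, a i v ≤ b i) ∧
      ∀ d, (∀ i, a i v = b i → a i d = 0) → d = 0}.Finite := by
  classical
  refine Set.Finite.of_finite_image (f := fun v => Finset.univ.filter fun i => a i v = b i)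
    (Set.toFinite _) ?_
  intro v hv v' hv' h
  refine sub_eq_zero.mp (hv.2 _ fun i hi => ?_)
  have : i ∈ Finset.univ.filter fun i => a i v' = b i := by
    rw [← show _ = Finset.univ.filter fun i => a i v' = b i from h]
    simpa using hi
  simp only [Finset.mem_filter, Finset.mem_univ, true_and] at this
  rw [map_sub, hi, this, sub_self]

/-! ### Minimizers of the scenario program for varying weights. -/

namespace TwoStageLP

variable {m p e a b : ℕ} (S : TwoStageLP m p e a b)

theorem Q_ne_top_of_costE {x : Fin p → ℝ} {ξ : Fin m → ℝ} (h : S.costE x ξ ≠ ⊤) :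
    S.Q x ξ ≠ ⊤ := by
  intro hQ
  exact h (by simp [costE, hQ])

theorem Q_ne_bot_of_costE {x : Fin p → ℝ} {ξ : Fin m → ℝ} (h : S.costE x ξ ≠ ⊥) :
    S.Q x ξ ≠ ⊥ := by
  intro hQ
  exact h (by simp [costE, hQ])

theorem G_eq {x : Fin p → ℝ} {ξ : Fin m → ℝ} (h : S.costE x ξ ≠ ⊤) (h' : S.costE x ξ ≠ ⊥) :
    S.G x ξ = dotProduct S.c x + (S.Q x ξ).toReal := by
  rw [G, costE, EReal.toReal_add (EReal.coe_ne_top _) (EReal.coe_ne_bot _)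
    (S.Q_ne_top_of_costE h) (S.Q_ne_bot_of_costE h'), EReal.toReal_coe]

theorem G_le_of_feasible {x : Fin p → ℝ} {ξ : Fin m → ℝ} (h : S.costE x ξ ≠ ⊤)
    (h' : S.costE x ξ ≠ ⊥) {y : Fin b → ℝ}
    (hy : S.W.mulVec y ≤ S.h ξ - (S.T ξ).mulVec x ∧ 0 ≤ y) :
    S.G x ξ ≤ dotProduct S.c x + dotProduct (S.q ξ) y := by
  rw [S.G_eq h h']
  gcongr
  rw [← EReal.coe_le_coe_iff, EReal.coe_toReal (S.Q_ne_top_of_costE h) (S.Q_ne_bot_of_costE h')]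
  exact iInf₂_le y hy

theorem exists_feasible_lt {x : Fin p → ℝ} {ξ : Fin m → ℝ} (h : S.costE x ξ ≠ ⊤)
    (h' : S.costE x ξ ≠ ⊥) {ε : ℝ} (hε : 0 < ε) :
    ∃ y : Fin b → ℝ, (S.W.mulVec y ≤ S.h ξ - (S.T ξ).mulVec x ∧ 0 ≤ y) ∧
      dotProduct S.c x + dotProduct (S.q ξ) y < S.G x ξ + ε := by
  have hlt : S.Q x ξ < (((S.Q x ξ).toReal + ε : ℝ) : EReal) := by
    conv_lhs => rw [← EReal.coe_toReal (S.Q_ne_top_of_costE h) (S.Q_ne_bot_of_costE h')]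
    exact EReal.coe_lt_coe_iff.mpr (by linarith)
  rw [S.G_eq h h']
  generalize (S.Q x ξ).toReal = r at hlt
  simp only [Q, iInf_lt_iff] at hlt
  obtain ⟨y, hy, hlt⟩ := hlt
  refine ⟨y, hy, ?_⟩
  have := EReal.coe_lt_coe_iff.mp hlt
  linarith

/-- Otherwise a long step along `d` from a feasible point would leave the norm bound given by
compactness. -/
theorem zero_of_recession (hX : IsCompact S.X) (hne : S.X.Nonempty) {d : Fin p → ℝ}
    (hd : S.A.mulVec d ≤ 0) : d = 0 := by
  obtain ⟨x, hx⟩ := hne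
  by_contra hd0
  obtain ⟨C, hC⟩ := hX.isBounded.exists_norm_le
  have hdn : 0 < ‖d‖ := norm_pos_iff.mpr hd0
  have hCx := hC x hx
  have hmem : x + ((2 * C + 1) / ‖d‖) • d ∈ S.X := by
    intro i
    have h1 := hx i
    have h2 := hd i
    rw [Matrix.mulVec_add, Matrix.mulVec_smul]
    simp only [Pi.add_apply, Pi.smul_apply, smul_eq_mul, Pi.zero_apply] at *
    have hC0 : 0 ≤ C := (norm_nonneg _).trans hCx
    have : 0 ≤ (2 * C + 1) / ‖d‖ := by positivity
    nlinarith [mul_nonneg this (neg_nonneg.mpr h2)]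
  have h1 := hC _ hmem
  have h2 : ‖((2 * C + 1) / ‖d‖) • d‖ = 2 * C + 1 := by
    have hC0 : 0 ≤ C := (norm_nonneg _).trans hCx
    rw [norm_smul, Real.norm_of_nonneg (by positivity), div_mul_cancel₀ _ hdn.ne']
  have h3 : ‖((2 * C + 1) / ‖d‖) • d‖ ≤ ‖x + ((2 * C + 1) / ‖d‖) • d‖ + ‖x‖ := by
    have := norm_sub_le (x + ((2 * C + 1) / ‖d‖) • d) x
    rwa [add_sub_cancel_left] at this
  linarith

/-- A recourse direction of negative cost could be added until the cost falls below the finite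
second-stage value. -/
theorem zero_le_of_recession {x : Fin p → ℝ} {ξ : Fin m → ℝ} (h : S.costE x ξ ≠ ⊤)
    (h' : S.costE x ξ ≠ ⊥) {d : Fin b → ℝ} (hd : S.W.mulVec d ≤ 0) (hd0 : 0 ≤ d) :
    0 ≤ dotProduct (S.q ξ) d := by
  by_contra hneg
  push Not at hneg
  obtain ⟨y, hy, hlt⟩ := S.exists_feasible_lt h h' one_pos
  have hτ : 0 ≤ -1 / dotProduct (S.q ξ) d := div_nonneg_of_nonpos (by norm_num) hneg.le
  have hfe : S.W.mulVec (y + (-1 / dotProduct (S.q ξ) d) • d) ≤ S.h ξ - (S.T ξ).mulVec x ∧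
      0 ≤ y + (-1 / dotProduct (S.q ξ) d) • d := by
    refine ⟨?_, add_nonneg hy.2 (smul_nonneg hτ hd0)⟩
    rw [Matrix.mulVec_add, Matrix.mulVec_smul]
    exact (add_le_of_nonpos_right (smul_nonpos_of_nonneg_of_nonpos hτ hd)).trans hy.1
  have := S.G_le_of_feasible h h' hfe
  rw [dotProduct_add, dotProduct_smul, smul_eq_mul, div_mul_cancel₀ _ hneg.ne] at this
  linarith

/-- Finitely many first-stage decisions suffice to minimize every nonnegative combination of the
scenario costs. -/
theorem exists_finite_minimizers (hX : IsCompact S.X) (hne : S.X.Nonempty) {ι : Type*} [Fintype ι]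
    (ξ : ι → Fin m → ℝ) (hfin : ∀ x ∈ S.X, ∀ i, S.costE x (ξ i) ≠ ⊤ ∧ S.costE x (ξ i) ≠ ⊥) :
    ∃ V : Finset (Fin p → ℝ), (∀ v ∈ V, v ∈ S.X) ∧ ∀ w : ι → ℝ, (∀ i, 0 ≤ w i) → ∀ x ∈ S.X,
      ∃ v ∈ V, ∑ i, w i * S.G v (ξ i) ≤ ∑ i, w i * S.G x (ξ i) := by
  classical
  -- Constraints of the deterministic equivalent in `(x, (y_i)_i)`: first stage, recourse, and sign
  -- constraints. The weights enter only the objective, so the vertices are common to all of them.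
  let con : Fin e ⊕ (ι × Fin a) ⊕ (ι × Fin b) → (Fin p → ℝ) × (ι → Fin b → ℝ) →ₗ[ℝ] ℝ := Sum.elim
    (fun j => ((LinearMap.proj j : (Fin e → ℝ) →ₗ[ℝ] ℝ) ∘ₗ S.A.mulVecLin) ∘ₗ LinearMap.fst ℝ _ _)
    (Sum.elim
      (fun ij => ((LinearMap.proj ij.2 : (Fin a → ℝ) →ₗ[ℝ] ℝ) ∘ₗ S.W.mulVecLin) ∘ₗ LinearMap.proj ij.1 ∘ₗ
          LinearMap.snd ℝ _ _ +
        ((LinearMap.proj ij.2 : (Fin a → ℝ) →ₗ[ℝ] ℝ) ∘ₗ (S.T (ξ ij.1)).mulVecLin) ∘ₗ LinearMap.fst ℝ _ _)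
      (fun ij => -((LinearMap.proj ij.2 : (Fin b → ℝ) →ₗ[ℝ] ℝ) ∘ₗ LinearMap.proj ij.1 ∘ₗ
        LinearMap.snd ℝ _ _)))
  let rhs : Fin e ⊕ (ι × Fin a) ⊕ (ι × Fin b) → ℝ := Sum.elim S.β
    (Sum.elim (fun ij => S.h (ξ ij.1) ij.2) fun _ => 0)
  have hcon : ∀ (w : (Fin p → ℝ) × (ι → Fin b → ℝ)) (r : Fin e ⊕ (ι × Fin a) ⊕ (ι × Fin b) → ℝ), (∀ i, con i w ≤ r i) ↔
      (∀ j, S.A.mulVec w.1 j ≤ r (.inl j)) ∧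
      (∀ i j, S.W.mulVec (w.2 i) j + (S.T (ξ i)).mulVec w.1 j ≤ r (.inr (.inl (i, j)))) ∧
      (∀ i j, -w.2 i j ≤ r (.inr (.inr (i, j)))) := by
    intro w r
    simp [con]
  have hfeas : ∀ w : (Fin p → ℝ) × (ι → Fin b → ℝ), (∀ i, con i w ≤ rhs i) ↔ w.1 ∈ S.X ∧
      ∀ i, S.W.mulVec (w.2 i) ≤ S.h (ξ i) - (S.T (ξ i)).mulVec w.1 ∧ 0 ≤ w.2 i := by
    intro w
    rw [hcon]
    simp only [rhs, Sum.elim_inl, Sum.elim_inr, X, Set.mem_ofPred_eq, Pi.le_def, Pi.add_apply,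
      Pi.zero_apply, le_sub_iff_add_le, neg_nonpos, forall_and]
  have hrec : ∀ d : (Fin p → ℝ) × (ι → Fin b → ℝ), (∀ i, con i d ≤ 0) → d.1 = 0 ∧ ∀ i, S.W.mulVec (d.2 i) ≤ 0 ∧ 0 ≤ d.2 i := by
    intro d hd
    have := (hcon d fun _ => 0).mp hd
    have h1 : d.1 = 0 := S.zero_of_recession hX hne this.1
    refine ⟨h1, fun i => ⟨fun j => ?_, fun j => ?_⟩⟩
    · have := this.2.1 i j
      simpa [h1] using this
    · have := this.2.2 i j
      simpa using this
  have hline : ∀ d, (∀ i, con i d = 0) → d = 0 := by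
    intro d hd
    have h1 := hrec d fun i => (hd i).le
    have h2 := hrec (-d) fun i => by rw [map_neg, hd i, neg_zero]
    refine Prod.ext h1.1 (funext fun i => le_antisymm ?_ (h1.2 i).2)
    exact neg_nonneg.mp (h2.2 i).2
  let V := (finite_vertices con rhs).toFinset
  refine ⟨V.image Prod.fst, ?_, ?_⟩
  · intro v hv
    obtain ⟨z, hz, rfl⟩ := Finset.mem_image.mp hv
    replace hz := (Set.Finite.mem_toFinset _).mp hz
    exact ((hfeas z).mp hz.1).1
  intro w hw x hx
  let l : (Fin p → ℝ) × (ι → Fin b → ℝ) →ₗ[ℝ] ℝ := ∑ i, w i • ((dotProductBilin ℝ ℝ S.c) ∘ₗ LinearMap.fst ℝ _ _ +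
    (dotProductBilin ℝ ℝ (S.q (ξ i))) ∘ₗ LinearMap.proj i ∘ₗ LinearMap.snd ℝ _ _)
  have hlapp : ∀ z : (Fin p → ℝ) × (ι → Fin b → ℝ), l z = ∑ i, w i * (dotProduct S.c z.1 + dotProduct (S.q (ξ i)) (z.2 i)) := by
    intro z
    simp [l, LinearMap.sum_apply, mul_add]
  have hl : ∀ d, (∀ i, con i d ≤ 0) → 0 ≤ l d := by
    intro d hd
    obtain ⟨h1, h2⟩ := hrec d hd
    rw [hlapp]
    refine Finset.sum_nonneg fun i _ => mul_nonneg (hw i) ?_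
    rw [h1, dotProduct_zero, zero_add]
    exact S.zero_le_of_recession (hfin x hx i).1 (hfin x hx i).2 (h2 i).1 (h2 i).2
  -- The second-stage infima are not yet known to be attained, so the vertex argument starts from
  -- `ε`-optimal recourse. The finiteness of `V` removes the `ε` afterwards.
  have key : ∀ ε : ℝ, 0 < ε → ∃ v ∈ V.image Prod.fst,
      ∑ i, w i * S.G v (ξ i) ≤ ∑ i, w i * S.G x (ξ i) + ε * ∑ i, w i := by
    intro ε hε
    choose y hy hlt using fun i => S.exists_feasible_lt (hfin x hx i).1 (hfin x hx i).2 hε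
    obtain ⟨v, hv1, hv2, hv3⟩ := exists_vertex_le con rhs hline l hl _ (x, y)
      ((hfeas (x, y)).mpr ⟨hx, hy⟩) le_rfl
    refine ⟨v.1, Finset.mem_image_of_mem _ ((Set.Finite.mem_toFinset _).mpr ⟨hv1, hv2⟩), ?_⟩
    obtain ⟨hvX, hvy⟩ := (hfeas v).mp hv1
    calc ∑ i, w i * S.G v.1 (ξ i) ≤ l v := by
          rw [hlapp]
          exact Finset.sum_le_sum fun i _ => mul_le_mul_of_nonneg_left
            (S.G_le_of_feasible (hfin _ hvX i).1 (hfin _ hvX i).2 (hvy i)) (hw i)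
      _ ≤ l (x, y) := hv3
      _ ≤ ∑ i, w i * (S.G x (ξ i) + ε) := by
          rw [hlapp]
          exact Finset.sum_le_sum fun i _ => mul_le_mul_of_nonneg_left (hlt i).le (hw i)
      _ = _ := by simp only [mul_add, Finset.sum_add_distrib, ← Finset.sum_mul, mul_comm ε]
  by_contra hcon'
  push Not at hcon'
  obtain ⟨v₀, hv₀, -⟩ := key 1 one_pos
  obtain ⟨v₁, hv₁, hmin⟩ := (V.image Prod.fst).exists_min_image
    (fun v => ∑ i, w i * S.G v (ξ i)) ⟨v₀, hv₀⟩
  have hpos := sub_pos.mpr (hcon' v₁ hv₁)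
  have hW : 0 ≤ ∑ i, w i := Finset.sum_nonneg fun i _ => hw i
  -- Here `ε` is the assumed gap divided by `∑ w + 1`, so that the total loss stays below the gap;
  -- the `1` covers zero weights.
  obtain ⟨v, hv, hle⟩ := key _ (div_pos hpos (by positivity : 0 < ∑ i, w i + 1))
  have h1 := hmin v hv
  have h2 : (∑ i, w i * S.G v₁ (ξ i) - ∑ i, w i * S.G x (ξ i)) / (∑ i, w i + 1) * ∑ i, w i <
      ∑ i, w i * S.G v₁ (ξ i) - ∑ i, w i * S.G x (ξ i) := by
    rw [div_mul_eq_mul_div, div_lt_iff₀ (by positivity)]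
    linarith
  linarith

/-- If `xs` is the unique minimizer for the weights `w₀`, it is a minimizer for all nearby
nonnegative weights. -/
theorem exists_stable_minimizer (hX : IsCompact S.X) {ι : Type*} [Fintype ι]
    (ξ : ι → Fin m → ℝ) (hfin : ∀ x ∈ S.X, ∀ i, S.costE x (ξ i) ≠ ⊤ ∧ S.costE x (ξ i) ≠ ⊥)
    {xs : Fin p → ℝ} (hxs : xs ∈ S.X) (w₀ : ι → ℝ)
    (huniq : ∀ x ∈ S.X, x ≠ xs → ∑ i, w₀ i * S.G xs (ξ i) < ∑ i, w₀ i * S.G x (ξ i)) :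
    ∃ δ : ℝ, 0 < δ ∧ ∀ w : ι → ℝ, (∀ i, 0 ≤ w i) → (∀ i, |w i - w₀ i| ≤ δ) →
      ∀ x ∈ S.X, ∑ i, w i * S.G xs (ξ i) ≤ ∑ i, w i * S.G x (ξ i) := by
  classical
  obtain ⟨V, hV, hmin⟩ := S.exists_finite_minimizers hX ⟨xs, hxs⟩ ξ hfin
  -- Only the finitely many competitors in `V` matter, and each strict inequality at `w₀` is an open
  -- condition on the weights.
  have hev : ∀ᶠ w in nhds w₀, ∀ v ∈ V, v ≠ xs →
      ∑ i, w i * S.G xs (ξ i) < ∑ i, w i * S.G v (ξ i) := by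
    rw [Filter.eventually_all_finset]
    intro v hv
    by_cases h : v = xs
    · simp [h]
    · have hc : ∀ x : Fin p → ℝ, Continuous fun w : ι → ℝ => ∑ i, w i * S.G x (ξ i) := fun x => by
        fun_prop
      filter_upwards [(hc xs).continuousAt.eventually_lt (hc v).continuousAt
        (huniq v (hV v hv) h)] with w hw _ using hw
  obtain ⟨δ, hδ, hball⟩ := Metric.eventually_nhds_iff.mp hev
  refine ⟨δ / 2, half_pos hδ, fun w hw hclose x hx => ?_⟩
  obtain ⟨v, hv, hle⟩ := hmin w hw x hx
  refine le_trans ?_ hle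
  by_cases h : v = xs
  · rw [h]
  · refine (hball ?_ v hv h).le
    rw [dist_pi_lt_iff hδ]
    intro i
    rw [Real.dist_eq]
    linarith [hclose i]

/-- The sample-average value is a minimum over a finite set. -/
theorem exists_iInf_eq_inf' (hX : IsCompact S.X) {ι : Type*} [Fintype ι]
    (ξ : ι → Fin m → ℝ) (hfin : ∀ x ∈ S.X, ∀ i, S.costE x (ξ i) ≠ ⊤ ∧ S.costE x (ξ i) ≠ ⊥)
    {xs : Fin p → ℝ} (hxs : xs ∈ S.X) :
    ∃ (V : Finset (Fin p → ℝ)) (hne : V.Nonempty), ∀ w : ι → ℝ, (∀ i, 0 ≤ w i) →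
      ⨅ x : S.X, ∑ i, w i * S.G x (ξ i) = V.inf' hne fun v => ∑ i, w i * S.G v (ξ i) := by
  obtain ⟨V, hV, hmin⟩ := S.exists_finite_minimizers hX ⟨xs, hxs⟩ ξ hfin
  have hne : V.Nonempty := by
    obtain ⟨v, hv, -⟩ := hmin 0 (fun _ => le_rfl) xs hxs
    exact ⟨v, hv⟩
  refine ⟨V, hne, fun w hw => ?_⟩
  have hlow : ∀ x : S.X, (V.inf' hne fun v => ∑ i, w i * S.G v (ξ i)) ≤
      ∑ i, w i * S.G x (ξ i) := by
    intro x
    obtain ⟨v, hv, hle⟩ := hmin w hw x x.2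
    exact (Finset.inf'_le _ hv).trans hle
  have : Nonempty S.X := ⟨⟨xs, hxs⟩⟩
  refine le_antisymm ?_ (le_ciInf hlow)
  refine Finset.le_inf' _ _ fun v hv => ?_
  exact ciInf_le (f := fun x : S.X => ∑ i, w i * S.G x (ξ i)) ⟨_, by
    rintro _ ⟨x, rfl⟩
    exact hlow x⟩ ⟨v, hV v hv⟩

end TwoStageLP

/-! ### Quantile functions of finitely supported laws. -/

/-- The quantile function of a law on the line whose support is discrete. -/
noncomputable def quantileFn (ν : Measure ℝ) (z : ℝ) : ℝ :=
  sInf {y : ℝ | y ∈ ν.support ∧ z ≤ cdf ν y}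

section Quantile

variable {ν : Measure ℝ} [IsProbabilityMeasure ν] (hν : ν.support.Finite)

/-- The distribution function has the same value at `y` and at the largest support point below `y`;
positivity of `z` guarantees that such a point exists. -/
theorem exists_mem_support_of_le_cdf (hν : ν.support.Finite) {z y : ℝ} (hz : 0 < z)
    (hy : z ≤ cdf ν y) :
    ∃ y' ∈ ν.support, y' ≤ y ∧ z ≤ cdf ν y' := by
  have hfin : (ν.support ∩ Set.Iic y).Finite := hν.subset Set.inter_subset_left
  have hmeas : ν (Set.Iic y) = ν (ν.support ∩ Set.Iic y) := by
    refine measure_congr ?_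
    filter_upwards [show ∀ᵐ x ∂ν, x ∈ ν.support from Measure.support_mem_ae_of_innerRegular]
      with x hx
    exact propext ⟨fun h => ⟨hx, h⟩, fun h => h.2⟩
  have hne : (ν.support ∩ Set.Iic y).Nonempty := by
    by_contra hemp
    rw [Set.not_nonempty_iff_eq_empty] at hemp
    rw [hemp, measure_empty, ← ofReal_cdf] at hmeas
    linarith [ENNReal.ofReal_eq_zero.mp hmeas]
  obtain ⟨y', hy', hmax⟩ := hfin.exists_maximalFor id _ hne
  refine ⟨y', hy'.1, hy'.2, hy.trans ?_⟩
  rw [cdf_eq_real, cdf_eq_real, Measure.real, Measure.real, hmeas]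
  refine ENNReal.toReal_mono (measure_ne_top _ _) (measure_mono fun x hx => ?_)
  rcases le_total x y' with h | h
  · exact h
  · exact hmax hx h

include hν

theorem quantileFn_mem {z : ℝ} (hz : z ∈ Set.Ioc (0 : ℝ) 1) :
    quantileFn ν z ∈ ν.support ∧ z ≤ cdf ν (quantileFn ν z) := by
  have hfin : {y : ℝ | y ∈ ν.support ∧ z ≤ cdf ν y}.Finite := hν.subset fun _ h => h.1
  refine Set.Nonempty.csInf_mem ?_ hfin
  obtain ⟨M, hM⟩ := hν.bddAbove
  have h1 : cdf ν M = 1 := by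
    rw [cdf_eq_real, Measure.real, ENNReal.toReal_eq_one_iff, ← mem_ae_iff_prob_eq_one
      measurableSet_Iic]
    · filter_upwards [show ∀ᵐ x ∂ν, x ∈ ν.support from Measure.support_mem_ae_of_innerRegular]
        with x hx using hM hx
  obtain ⟨y, hy, -, hzy⟩ := exists_mem_support_of_le_cdf hν hz.1 (hz.2.trans h1.ge)
  exact ⟨y, hy, hzy⟩

/-- The Galois connection between quantile and distribution functions, from which monotonicity and
the image law follow. -/
theorem quantileFn_le_iff {z y : ℝ} (hz : z ∈ Set.Ioc (0 : ℝ) 1) :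
    quantileFn ν z ≤ y ↔ z ≤ cdf ν y := by
  refine ⟨fun h => (quantileFn_mem hν hz).2.trans (monotone_cdf ν h), fun h => ?_⟩
  obtain ⟨y', hy', hle, hzy⟩ := exists_mem_support_of_le_cdf hν hz.1 h
  have hfin : {y : ℝ | y ∈ ν.support ∧ z ≤ cdf ν y}.Finite := hν.subset fun _ h => h.1
  exact (csInf_le hfin.bddBelow ⟨hy', hzy⟩).trans hle

theorem monotoneOn_quantileFn : MonotoneOn (quantileFn ν) (Set.Ioc 0 1) := by
  intro z hz z' hz' h
  rw [quantileFn_le_iff hν hz]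
  exact h.trans (quantileFn_mem hν hz').2

theorem map_quantileFn : (volume.restrict (Set.Ioc (0 : ℝ) 1)).map (quantileFn ν) = ν := by
  have hae : AEMeasurable (quantileFn ν) (volume.restrict (Set.Ioc (0 : ℝ) 1)) :=
    aemeasurable_restrict_of_monotoneOn measurableSet_Ioc (monotoneOn_quantileFn hν)
  have : IsProbabilityMeasure (volume.restrict (Set.Ioc (0 : ℝ) 1)) := ⟨by simp⟩
  have := Measure.isProbabilityMeasure_map hae
  refine Measure.ext_of_Iic _ _ fun y => ?_
  rw [Measure.map_apply_of_aemeasurable hae measurableSet_Iic,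
    Measure.restrict_apply' measurableSet_Ioc, ← ofReal_cdf]
  have : quantileFn ν ⁻¹' Set.Iic y ∩ Set.Ioc 0 1 = Set.Ioc 0 (cdf ν y) := by
    ext z
    constructor
    · rintro ⟨h1, h2⟩
      exact ⟨h2.1, (quantileFn_le_iff hν h2).mp h1⟩
    · rintro ⟨h1, h2⟩
      have hz : z ∈ Set.Ioc (0 : ℝ) 1 := ⟨h1, h2.trans (cdf_le_one _ _)⟩
      exact ⟨(quantileFn_le_iff hν hz).mpr h2, hz⟩
  rw [this, Real.volume_Ioc, sub_zero]

omit hν in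
-- The other support points form a closed set, so removing them leaves a neighbourhood of `y`, whose
-- mass is all carried by `y`.
theorem measure_singleton_pos_of_mem_support (hν : ν.support.Finite) {y : ℝ}
    (hy : y ∈ ν.support) : 0 < ν {y} := by
  have hU : (ν.support \ {y})ᶜ ∈ nhds y :=
    (hν.subset Set.sdiff_subset).isClosed.isOpen_compl.mem_nhds (by simp)
  have := (Measure.mem_support_iff_forall y).mp hy _ hU
  refine this.trans_le (le_of_eq (measure_congr ?_))
  filter_upwards [show ∀ᵐ x ∂ν, x ∈ ν.support from Measure.support_mem_ae_of_innerRegular]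
    with x hx
  refine propext ⟨fun h => ?_, fun h => fun h' => h'.2 h⟩
  by_contra hne
  exact h ⟨hx, hne⟩

end Quantile

/-- The part of `(0,1]` on which the quantile function takes the value `y`. -/
def quantileCell (ν : Measure ℝ) (y : ℝ) : Set ℝ := {z | z ∈ Set.Ioc 0 1 ∧ quantileFn ν z = y}

theorem quantileCell_subset (ν : Measure ℝ) (y : ℝ) : quantileCell ν y ⊆ Set.Ioc 0 1 :=
  fun _ h => h.1

/-- Level sets of a monotone function are intervals. This is the only geometric fact about scenarios
that the variance bounds use. -/
theorem ordConnected_quantileCell {ν : Measure ℝ} [IsProbabilityMeasure ν]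
    (hν : ν.support.Finite) (y : ℝ) : (quantileCell ν y).OrdConnected := by
  refine ⟨fun a ha b hb x hx => ?_⟩
  have hx' : x ∈ Set.Ioc (0 : ℝ) 1 := ⟨ha.1.1.trans_le hx.1, hx.2.trans hb.1.2⟩
  have hm := monotoneOn_quantileFn hν
  exact ⟨hx', le_antisymm ((hm hx' hb.1 hx.2).trans hb.2.le)
    (ha.2.ge.trans (hm ha.1 hx' hx.1))⟩

theorem volume_quantileCell {ν : Measure ℝ} [IsProbabilityMeasure ν]
    (hν : ν.support.Finite) (y : ℝ) : volume (quantileCell ν y) = ν {y} := by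
  have hae : AEMeasurable (quantileFn ν) (volume.restrict (Set.Ioc (0 : ℝ) 1)) :=
    aemeasurable_restrict_of_monotoneOn measurableSet_Ioc (monotoneOn_quantileFn hν)
  conv_rhs => rw [← map_quantileFn hν]
  rw [Measure.map_apply_of_aemeasurable hae (measurableSet_singleton _),
    Measure.restrict_apply' measurableSet_Ioc]
  congr 1
  ext z
  exact and_comm

/-! ### Averages over random permutations and independent families. -/

section Expect

theorem expect_const_real {α : Type*} [Fintype α] [Nonempty α] (c : ℝ) : 𝔼 _a : α, c = c :=
  Fintype.expect_const c

/-- Composing with a transposition shows that the position is irrelevant, so one may average over it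
too; then every single permutation gives the uniform average. -/
theorem expect_perm_apply {α : Type*} [Fintype α] [DecidableEq α] (a : α) (F : α → ℝ) :
    𝔼 π : Equiv.Perm α, F (π a) = 𝔼 j, F j := by
  have : Nonempty α := ⟨a⟩
  have h : ∀ b, 𝔼 π : Equiv.Perm α, F (π b) = 𝔼 π : Equiv.Perm α, F (π a) := fun b =>
    Fintype.expect_equiv (Equiv.mulRight (Equiv.swap a b)) _ _ fun π => by simp
  calc 𝔼 π : Equiv.Perm α, F (π a) = 𝔼 b, 𝔼 π : Equiv.Perm α, F (π b) := by
        simp_rw [h]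
        rw [expect_const_real]
    _ = 𝔼 π : Equiv.Perm α, 𝔼 b, F (π b) := Finset.expect_comm _ _ _
    _ = 𝔼 π : Equiv.Perm α, 𝔼 j, F j :=
        Finset.expect_congr rfl fun π _ => Fintype.expect_equiv π _ _ fun _ => rfl
    _ = _ := expect_const_real _

/-- Sampling two entries without replacement. -/
theorem expect_perm_apply_mul {α : Type*} [Fintype α] [DecidableEq α] {a b : α} (hab : a ≠ b)
    (F H : α → ℝ) :
    𝔼 π : Equiv.Perm α, F (π a) * H (π b) = (𝔼 j, F j) * (𝔼 j, H j) -
      (𝔼 j, F j * H j - (𝔼 j, F j) * (𝔼 j, H j)) / ((Fintype.card α : ℝ) - 1) := by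
  have : Nonempty α := ⟨a⟩
  have hcard : (1 : ℝ) < Fintype.card α := by
    exact_mod_cast Fintype.one_lt_card_iff.mpr ⟨a, b, hab⟩
  have h : ∀ c ∈ Finset.univ.erase a, 𝔼 π : Equiv.Perm α, F (π a) * H (π c) =
      𝔼 π : Equiv.Perm α, F (π a) * H (π b) := fun c hc =>
    Fintype.expect_equiv (Equiv.mulRight (Equiv.swap b c)) _ _ fun π => by
      have hca : a ≠ c := (Finset.ne_of_mem_erase hc).symm
      simp [Equiv.swap_apply_of_ne_of_ne hab hca]
  -- Summing over all positions `c` decouples the two factors. The term `c = a` is the mean of `F *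
  -- H`, the others are equal, so the wanted average can be solved for.
  have hsum : ∑ c, 𝔼 π : Equiv.Perm α, F (π a) * H (π c) =
      (Fintype.card α : ℝ) * ((𝔼 j, F j) * (𝔼 j, H j)) := by
    rw [← Finset.expect_sum_comm]
    have : ∀ π : Equiv.Perm α, ∑ c, F (π a) * H (π c) = F (π a) * ∑ c, H c := fun π => by
      rw [← Finset.mul_sum, Equiv.sum_comp π H]
    simp_rw [this]
    rw [← Finset.expect_mul, expect_perm_apply, ← Fintype.card_mul_expect H]
    ring
  rw [← Finset.add_sum_erase _ _ (Finset.mem_univ a), Finset.sum_congr rfl h, Finset.sum_const,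
    Finset.card_erase_of_mem (Finset.mem_univ a), Finset.card_univ, nsmul_eq_mul,
    Nat.cast_pred Fintype.card_pos, expect_perm_apply a fun j => F j * H j] at hsum
  have hne : (Fintype.card α : ℝ) - 1 ≠ 0 := by linarith
  field_simp
  linarith

theorem expect_pi_prod {ι α : Type*} [Fintype ι] [DecidableEq ι] [Fintype α]
    (g : ι → α → ℝ) : 𝔼 x : ι → α, ∏ i, g i (x i) = ∏ i, 𝔼 a, g i a := by
  simp_rw [Fintype.expect_eq_sum_div_card]
  rw [Finset.prod_div_distrib, Finset.prod_univ_sum, Fintype.piFinset_univ, Finset.prod_const,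
    Fintype.card_fun, Finset.card_univ]
  push_cast
  rfl

theorem expect_pi_apply {ι α : Type*} [Fintype ι] [DecidableEq ι] [Fintype α] [Nonempty α]
    (i : ι) (g : α → ℝ) : 𝔼 x : ι → α, g (x i) = 𝔼 a, g a := by
  have := expect_pi_prod fun j (a : α) => if j = i then g a else 1
  simp_rw [Finset.prod_ite_eq', Finset.mem_univ, if_true] at this
  rw [this, Finset.prod_eq_single i (fun j _ hj => by simp [hj]) (by simp)]
  simp

theorem expect_pi_apply_mul {ι α : Type*} [Fintype ι] [DecidableEq ι] [Fintype α] [Nonempty α]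
    {i j : ι} (hij : i ≠ j) (g h : α → ℝ) :
    𝔼 x : ι → α, g (x i) * h (x j) = (𝔼 a, g a) * 𝔼 a, h a := by
  have := expect_pi_prod fun k (a : α) => (if k = i then g a else 1) * if k = j then h a else 1
  simp_rw [Finset.prod_mul_distrib, Finset.prod_ite_eq', Finset.mem_univ, if_true] at this
  rw [this, ← Finset.mul_prod_erase _ _ (Finset.mem_univ i),
    ← Finset.mul_prod_erase _ _ (Finset.mem_erase.mpr ⟨hij.symm, Finset.mem_univ j⟩),
    Finset.prod_eq_one]
  · simp [hij, hij.symm]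
  · intro k hk
    simp only [Finset.mem_erase, Finset.mem_univ, and_true] at hk
    simp [hk.1, hk.2]

/-- Resampling one coordinate preserves the uniform law. This permits conditioning on all other
columns. -/
theorem expect_eq_expect_update {ι α : Type*} [Fintype ι] [DecidableEq ι] [Fintype α] [Group α]
    (k : ι) (F : (ι → α) → ℝ) :
    𝔼 x : ι → α, F x = 𝔼 x : ι → α, 𝔼 a, F (Function.update x k a) := by
  have h : ∀ g : α, 𝔼 x : ι → α, F (Function.update x k (x k * g)) = 𝔼 x : ι → α, F x := by
    intro g
    let e : (ι → α) ≃ (ι → α) :=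
      { toFun := fun x => Function.update x k (x k * g)
        invFun := fun x => Function.update x k (x k * g⁻¹)
        left_inv := fun x => by simp
        right_inv := fun x => by simp }
    exact Fintype.expect_equiv e _ _ fun x => rfl
  have h2 : ∀ x : ι → α, 𝔼 a, F (Function.update x k a) =
      𝔼 g, F (Function.update x k (x k * g)) := fun x =>
    (Fintype.expect_equiv (Equiv.mulLeft (x k)) _ _ fun g => rfl).symm
  simp_rw [h2]
  rw [Finset.expect_comm]
  simp_rw [h]
  rw [expect_const_real]

end Expect

/-! ### Exponential tail bounds for permutation statistics. -/

section Concentration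

/-- The convex exponential lies below its chord between `-θ` and `θ`. -/
theorem exp_mul_le_cosh_add {θ d : ℝ} (hd : |d| ≤ 1) :
    Real.exp (θ * d) ≤ Real.cosh θ + d * Real.sinh θ := by
  obtain ⟨h1, h2⟩ := abs_le.mp hd
  have := convexOn_exp.2 (Set.mem_univ θ) (Set.mem_univ (-θ))
    (by linarith : (0 : ℝ) ≤ (1 + d) / 2) (by linarith : (0 : ℝ) ≤ (1 - d) / 2) (by ring)
  simp only [smul_eq_mul] at this
  rw [Real.cosh_eq, Real.sinh_eq]
  calc Real.exp (θ * d) = Real.exp ((1 + d) / 2 * θ + (1 - d) / 2 * -θ) := by ring_nf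
    _ ≤ _ := this
    _ = _ := by ring

/-- Hoeffding's lemma: the linear term of the chord bound averages to zero, and `cosh θ ≤ exp
(θ²/2)`. -/
theorem expect_exp_le {α : Type*} [Fintype α] [Nonempty α] (θ : ℝ) (d : α → ℝ)
    (hd : ∀ a, |d a| ≤ 1) (hmean : 𝔼 a, d a = 0) :
    𝔼 a, Real.exp (θ * d a) ≤ Real.exp (θ ^ 2 / 2) := by
  calc 𝔼 a, Real.exp (θ * d a) ≤ 𝔼 a, (Real.cosh θ + d a * Real.sinh θ) :=
        Finset.expect_le_expect fun a _ => exp_mul_le_cosh_add (hd a)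
    _ = Real.cosh θ := by
        rw [Finset.expect_add_distrib, ← Finset.expect_mul, hmean, expect_const_real]
        ring
    _ ≤ _ := Real.cosh_le_exp_half_sq θ

/-- Moment generating function of a linear permutation statistic. -/
theorem expect_exp_perm_le (n : ℕ) : ∀ (a b : Fin n → ℝ), (∀ i, a i ∈ Set.Icc (0 : ℝ) 1) →
    (∀ i, b i ∈ Set.Icc (0 : ℝ) 1) → ∀ θ : ℝ,
    𝔼 π : Equiv.Perm (Fin n),
      Real.exp (θ * (∑ i, a i * b (π i) - (∑ i, a i) * (∑ i, b i) / n)) ≤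
        Real.exp (n * θ ^ 2 / 2) := by
  induction n with
  | zero =>
    intro a b _ _ θ
    simp
  | succ n ih =>
    intro a b ha hb θ
    set A' := ∑ i : Fin n, a i.succ with hA'
    set B := ∑ i, b i with hB
    have hA : ∑ i, a i = a 0 + A' := Fin.sum_univ_succ a
    -- Once `π 0 = p` is revealed, the centred statistic is `d p` plus the centred statistic of the
    -- remaining `n` entries. This martingale increment has mean zero and modulus at most one.
    let d : Fin (n + 1) → ℝ := fun p => (b p - B / (n + 1)) * (a 0 - A' / n)
    -- For `n = 0` the quotient `A' / n` is zero by convention, consistently with the empty sum.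
    have hn0 : (n : ℝ) = 0 → A' = 0 := by
      intro h
      have : n = 0 := by exact_mod_cast h
      subst this
      simp [hA']
    have hdmean : 𝔼 p, d p = 0 := by
      simp only [d]
      rw [← Finset.expect_mul, Finset.expect_sub_distrib, expect_const_real,
        Fintype.expect_eq_sum_div_card, ← hB]
      simp
    have hA'01 : A' / n ∈ Set.Icc (0 : ℝ) 1 := by
      refine ⟨div_nonneg (Finset.sum_nonneg fun i _ => (ha _).1) (Nat.cast_nonneg _),
        div_le_one_of_le₀ ?_ (Nat.cast_nonneg _)⟩
      refine (Finset.sum_le_sum fun (i : Fin n) _ => (ha i.succ).2).trans ?_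
      simp
    have hB01 : B / (n + 1) ∈ Set.Icc (0 : ℝ) 1 := by
      refine ⟨div_nonneg (Finset.sum_nonneg fun i _ => (hb _).1) (by positivity),
        div_le_one_of_le₀ ?_ (by positivity)⟩
      refine (Finset.sum_le_sum fun (i : Fin (n + 1)) _ => (hb i).2).trans ?_
      simp
    have hd1 : ∀ p, |d p| ≤ 1 := by
      intro p
      simp only [d, abs_mul]
      have h1 : |b p - B / (n + 1)| ≤ 1 := abs_le.mpr
        ⟨by linarith [(hb p).1, hB01.2], by linarith [(hb p).2, hB01.1]⟩
      have h2 : |a 0 - A' / n| ≤ 1 := abs_le.mpr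
        ⟨by linarith [(ha 0).1, hA'01.2], by linarith [(ha 0).2, hA'01.1]⟩
      exact mul_le_one₀ h1 (abs_nonneg _) h2
    have hstep : ∀ (p : Fin (n + 1)) (e : Equiv.Perm (Fin n)),
        Real.exp (θ * (∑ i, a i * b (Equiv.Perm.decomposeFin.symm (p, e) i) -
          (∑ i, a i) * B / ((n + 1 : ℕ) : ℝ))) = Real.exp (θ * d p) *
        Real.exp (θ * (∑ i : Fin n, a i.succ * b (Equiv.swap 0 p (e i).succ) -
          (∑ i : Fin n, a i.succ) * (∑ i : Fin n, b (Equiv.swap 0 p i.succ)) / n)) := by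
      intro p e
      have hb' : ∑ i : Fin n, b (Equiv.swap 0 p i.succ) = B - b p := by
        rw [hB, ← Equiv.sum_comp (Equiv.swap 0 p) b, Fin.sum_univ_succ, Equiv.swap_apply_left]
        ring
      rw [← Real.exp_add, ← mul_add]
      congr 2
      rw [Fin.sum_univ_succ, Equiv.Perm.decomposeFin_symm_apply_zero]
      simp_rw [Equiv.Perm.decomposeFin_symm_apply_succ]
      rw [hb', hA, ← hA']
      simp only [d]
      push_cast
      have h1 : (n : ℝ) + 1 ≠ 0 := by positivity
      by_cases h0 : (n : ℝ) = 0
      · rw [hn0 h0, h0]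
        simp
        ring
      · field_simp
        ring
    calc 𝔼 π : Equiv.Perm (Fin (n + 1)),
          Real.exp (θ * (∑ i, a i * b (π i) - (∑ i, a i) * B / ((n + 1 : ℕ) : ℝ)))
        = 𝔼 p : Fin (n + 1), 𝔼 e : Equiv.Perm (Fin n), Real.exp (θ * d p) *
        Real.exp (θ * (∑ i : Fin n, a i.succ * b (Equiv.swap 0 p (e i).succ) -
          (∑ i : Fin n, a i.succ) * (∑ i : Fin n, b (Equiv.swap 0 p i.succ)) / n)) := by
          simp_rw [← hstep]
          rw [← Finset.expect_product', Finset.univ_product_univ]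
          exact Fintype.expect_equiv Equiv.Perm.decomposeFin _ _ fun π => by simp
      _ ≤ 𝔼 p : Fin (n + 1), Real.exp (θ * d p) * Real.exp (n * θ ^ 2 / 2) := by
          refine Finset.expect_le_expect fun p _ => ?_
          rw [← Finset.mul_expect]
          exact mul_le_mul_of_nonneg_left (ih (fun i => a i.succ)
            (fun i => b (Equiv.swap 0 p i.succ)) (fun i => ha _) (fun i => hb _) θ)
            (Real.exp_pos _).le
      _ ≤ Real.exp (θ ^ 2 / 2) * Real.exp (n * θ ^ 2 / 2) := by
          rw [← Finset.expect_mul]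
          exact mul_le_mul_of_nonneg_right (expect_exp_le θ d hd1 hdmean) (Real.exp_pos _).le
      _ = _ := by
          rw [← Real.exp_add]
          congr 1
          push_cast
          ring

/-- Chernoff's bound for both signs; `θ = ±δ` optimizes the exponent `n θ²/2 - n δ |θ|`. -/
theorem expect_tail_perm_le {n : ℕ} (a b : Fin n → ℝ) (ha : ∀ i, a i ∈ Set.Icc (0 : ℝ) 1)
    (hb : ∀ i, b i ∈ Set.Icc (0 : ℝ) 1) {δ : ℝ} (hδ : 0 < δ) :
    𝔼 π : Equiv.Perm (Fin n),
      (if δ * n < |∑ i, a i * b (π i) - (∑ i, a i) * (∑ i, b i) / n| then (1 : ℝ) else 0) ≤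
        2 * Real.exp (-(n * δ ^ 2 / 2)) := by
  set X : Equiv.Perm (Fin n) → ℝ := fun π => ∑ i, a i * b (π i) - (∑ i, a i) * (∑ i, b i) / n
  calc 𝔼 π : Equiv.Perm (Fin n), (if δ * n < |X π| then (1 : ℝ) else 0)
      ≤ 𝔼 π : Equiv.Perm (Fin n), (Real.exp (-(n * δ ^ 2)) * Real.exp (δ * X π) +
          Real.exp (-(n * δ ^ 2)) * Real.exp (-δ * X π)) := by
        refine Finset.expect_le_expect fun π _ => ?_
        rw [← Real.exp_add, ← Real.exp_add]
        split_ifs with h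
        · rcases lt_abs.mp h with h | h
          · have : 1 ≤ Real.exp (-(n * δ ^ 2) + δ * X π) := Real.one_le_exp (by nlinarith)
            linarith [Real.exp_pos (-(n * δ ^ 2) + -δ * X π)]
          · have : 1 ≤ Real.exp (-(n * δ ^ 2) + -δ * X π) := Real.one_le_exp (by nlinarith)
            linarith [Real.exp_pos (-(n * δ ^ 2) + δ * X π)]
        · positivity
    _ ≤ Real.exp (-(n * δ ^ 2)) * Real.exp (n * δ ^ 2 / 2) +
          Real.exp (-(n * δ ^ 2)) * Real.exp (n * (-δ) ^ 2 / 2) := by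
        rw [Finset.expect_add_distrib, ← Finset.mul_expect, ← Finset.mul_expect]
        gcongr
        · exact expect_exp_perm_le n a b ha hb δ
        · exact expect_exp_perm_le n a b ha hb (-δ)
    _ = _ := by
        rw [neg_sq, ← two_mul, ← Real.exp_add]
        congr 2
        ring

/-- Frequencies of cells in an array with balanced columns, after independent uniform
permutations of the symbols of each column. -/
theorem expect_tail_prod_le {t lam m : ℕ} (ht : 0 < t) (hlam : 0 < lam) {I : Type*} [Fintype I]
    (hcard : Fintype.card I = t * lam) (o : I → Fin m → Fin t)
    (ho : ∀ k s, (Finset.univ.filter fun i => o i k = s).card = lam)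
    (β : Fin m → Fin t → ℝ) (hβ : ∀ k s, β k s ∈ Set.Icc (0 : ℝ) 1) {δ : ℝ} (hδ : 0 < δ)
    (u : Finset (Fin m)) :
    𝔼 σ : Fin m → Equiv.Perm (Fin t),
      (if u.card * δ < |((t * lam : ℕ) : ℝ)⁻¹ * ∑ i, ∏ k ∈ u, β k (σ k (o i k)) -
          ∏ k ∈ u, ((∑ s, β k s) / t)| then (1 : ℝ) else 0) ≤
        u.card * (2 * Real.exp (-(t * δ ^ 2 / 2))) := by
  classical
  have hlam' : (0 : ℝ) < lam := by exact_mod_cast hlam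
  have ht' : (0 : ℝ) < t := by exact_mod_cast ht
  induction u using Finset.induction_on with
  | empty =>
    simp only [Finset.card_empty, Nat.cast_zero, zero_mul, Finset.prod_empty]
    refine le_of_eq (Finset.expect_eq_zero fun σ _ => ?_)
    rw [Finset.sum_const, Finset.card_univ, hcard, nsmul_eq_mul, mul_one, inv_mul_cancel₀]
    · simp
    · positivity
  | insert k u hk ih =>
    have hβavg : (∑ s, β k s) / t ∈ Set.Icc (0 : ℝ) 1 := by
      refine ⟨div_nonneg (Finset.sum_nonneg fun i _ => (hβ _ _).1) (by positivity),
        div_le_one_of_le₀ ?_ (by positivity)⟩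
      refine (Finset.sum_le_sum fun (i : Fin t) _ => (hβ k i).2).trans ?_
      simp
    let D : (Fin m → Equiv.Perm (Fin t)) → ℝ := fun σ =>
      ((t * lam : ℕ) : ℝ)⁻¹ * ∑ i, ∏ j ∈ u, β j (σ j (o i j)) - ∏ j ∈ u, ((∑ s, β j s) / t)
    let w : (Fin m → Equiv.Perm (Fin t)) → I → ℝ := fun σ i => ∏ j ∈ u, β j (σ j (o i j))
    -- The weights from the columns already treated, averaged over the `lam` rows that carry symbol
    -- `s` in the new column. They do not involve `σ k`, so given the other columns a linear
    -- permutation statistic remains.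
    let a : (Fin m → Equiv.Perm (Fin t)) → Fin t → ℝ := fun σ s =>
      (∑ i ∈ Finset.univ.filter fun i => o i k = s, w σ i) / lam
    have hw : ∀ σ i, w σ i ∈ Set.Icc (0 : ℝ) 1 := fun σ i =>
      ⟨Finset.prod_nonneg fun j _ => (hβ _ _).1,
        Finset.prod_le_one (fun j _ => (hβ _ _).1) fun j _ => (hβ _ _).2⟩
    have ha : ∀ σ s, a σ s ∈ Set.Icc (0 : ℝ) 1 := fun σ s => by
      refine ⟨div_nonneg (Finset.sum_nonneg fun i _ => (hw _ _).1) hlam'.le,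
        div_le_one_of_le₀ ?_ hlam'.le⟩
      refine (Finset.sum_le_sum fun i _ => (hw σ i).2).trans ?_
      simp [ho k s]
    let E : (Fin m → Equiv.Perm (Fin t)) → ℝ := fun σ =>
      ∑ s, a σ s * β k (σ k s) - (∑ s, a σ s) * (∑ s, β k s) / t
    have hE : ∀ σ, 𝔼 π : Equiv.Perm (Fin t),
        (if δ * t < |E (Function.update σ k π)| then (1 : ℝ) else 0) ≤
          2 * Real.exp (-(t * δ ^ 2 / 2)) := by
      intro σ
      have haupd : ∀ π, a (Function.update σ k π) = a σ := by
        intro π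
        ext s
        simp only [a, w]
        congr 1
        refine Finset.sum_congr rfl fun i _ => Finset.prod_congr rfl fun j hj => ?_
        rw [Function.update_of_ne (ne_of_mem_of_not_mem hj hk)]
      simp only [E, haupd, Function.update_self]
      exact expect_tail_perm_le (a σ) (β k) (ha σ) (hβ k) hδ
    -- The new deviation is the fluctuation of column `k` plus a factor in `[0,1]` times the
    -- previous deviation, so every column adds one `δ` and one tail term.
    have hdecomp : ∀ σ, ((t * lam : ℕ) : ℝ)⁻¹ * ∑ i, ∏ j ∈ insert k u, β j (σ j (o i j)) -
        ∏ j ∈ insert k u, ((∑ s, β j s) / t) = E σ / t + (∑ s, β k s) / t * D σ := by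
      intro σ
      have h1 : ∑ i, ∏ j ∈ insert k u, β j (σ j (o i j)) =
          lam * ∑ s, a σ s * β k (σ k s) := by
        rw [← Finset.sum_fiberwise (s := Finset.univ) (g := fun i => o i k), Finset.mul_sum]
        refine Finset.sum_congr rfl fun s _ => ?_
        simp only [a]
        rw [div_mul_eq_mul_div, mul_div_cancel₀ _ hlam'.ne', Finset.sum_mul]
        refine Finset.sum_congr rfl fun i hi => ?_
        rw [Finset.prod_insert hk, (Finset.mem_filter.mp hi).2, mul_comm]
      have h2 : ∑ i, w σ i = lam * ∑ s, a σ s := by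
        rw [← Finset.sum_fiberwise (s := Finset.univ) (g := fun i => o i k), Finset.mul_sum]
        refine Finset.sum_congr rfl fun s _ => ?_
        simp only [a]
        rw [mul_div_cancel₀ _ hlam'.ne']
      rw [h1, Finset.prod_insert hk]
      simp only [D, E]
      rw [show ∑ i, ∏ j ∈ u, β j (σ j (o i j)) = lam * ∑ s, a σ s from h2]
      push_cast
      field_simp
      ring
    calc _ ≤ 𝔼 σ : Fin m → Equiv.Perm (Fin t), ((if u.card * δ < |D σ| then (1 : ℝ) else 0) +
          if δ * t < |E σ| then (1 : ℝ) else 0) := by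
          refine Finset.expect_le_expect fun σ _ => ?_
          rw [hdecomp σ, Finset.card_insert_of_notMem hk]
          by_cases h1 : u.card * δ < |D σ|
          · rw [if_pos h1]
            split_ifs <;> norm_num
          by_cases h2 : δ * t < |E σ|
          · rw [if_pos h2]
            split_ifs <;> norm_num
          rw [if_neg, if_neg h1, if_neg h2, add_zero]
          push Not at h1 h2 ⊢
          push_cast
          have h3 : |E σ / t| ≤ δ := by
            rw [abs_div, abs_of_pos ht', div_le_iff₀ ht']
            exact h2
          have h4 : |(∑ s, β k s) / t * D σ| ≤ u.card * δ := by
            rw [abs_mul, abs_of_nonneg hβavg.1]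
            exact (mul_le_of_le_one_left (abs_nonneg _) hβavg.2).trans h1
          linarith [abs_add_le (E σ / t) ((∑ s, β k s) / t * D σ)]
      _ ≤ u.card * (2 * Real.exp (-(t * δ ^ 2 / 2))) + 2 * Real.exp (-(t * δ ^ 2 / 2)) := by
          rw [Finset.expect_add_distrib]
          refine add_le_add ih ?_
          rw [expect_eq_expect_update k]
          exact Finset.expect_le Finset.univ_nonempty fun σ _ => hE σ
      _ = _ := by
          rw [Finset.card_insert_of_notMem hk]
          push_cast
          ring

end Concentration

/-! ### Cells of the unit interval and averages over grid cells. -/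

section Cells

/-- The `ℓ`th of the `t` equal cells of `(0,1]`. -/
def cell (t : ℕ) (ℓ : Fin t) : Set ℝ := Set.Ioc ((ℓ : ℝ) / t) (((ℓ : ℝ) + 1) / t)

/-- The real-valued indicator function of `J`. -/
noncomputable def ind (J : Set ℝ) : ℝ → ℝ := J.indicator fun _ => 1

theorem ind_mem_Icc (J : Set ℝ) (x : ℝ) : ind J x ∈ Set.Icc (0 : ℝ) 1 := by
  classical
  rw [ind, Set.indicator_apply]
  split_ifs <;> simp

theorem measurable_ind {J : Set ℝ} (hJ : J.OrdConnected) : Measurable (ind J) :=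
  measurable_const.indicator hJ.measurableSet

open Classical in
/-- The cells which `J` meets without containing them. -/
noncomputable def cutCells (t : ℕ) (J : Set ℝ) : Finset (Fin t) :=
  Finset.univ.filter fun ℓ => (∃ x ∈ cell t ℓ, x ∈ J) ∧ ∃ x ∈ cell t ℓ, x ∉ J

theorem cell_lt {t : ℕ} {ℓ ℓ' : Fin t} (h : ℓ < ℓ') {x y : ℝ} (hx : x ∈ cell t ℓ)
    (hy : y ∈ cell t ℓ') : x < y := by
  refine hx.2.trans_lt (lt_of_le_of_lt ?_ hy.1)
  have : (ℓ : ℝ) + 1 ≤ ℓ' := by exact_mod_cast h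
  gcongr

/-- Of three cut cells the middle one lies between two points of `J`, hence inside `J` by convexity,
and is not cut. Thus only a fraction `2/t` of the cells ever contributes to the errors below. -/
theorem card_cutCells_le (t : ℕ) {J : Set ℝ} (hJ : J.OrdConnected) :
    (cutCells t J).card ≤ 2 := by
  classical
  by_contra hcon
  push Not at hcon
  have key : ∀ a ∈ cutCells t J, ∀ b ∈ cutCells t J, ∀ c ∈ cutCells t J, a < b → b < c → False := by
    intro a ha b hb c hc hab hbc
    simp only [cutCells, Finset.mem_filter, Finset.mem_univ, true_and] at ha hb hc
    obtain ⟨⟨x, hx, hxJ⟩, -⟩ := ha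
    obtain ⟨-, ⟨y, hy, hyJ⟩⟩ := hb
    obtain ⟨⟨z, hz, hzJ⟩, -⟩ := hc
    exact hyJ (hJ.out hxJ hzJ ⟨(cell_lt hab hx hy).le, (cell_lt hbc hy hz).le⟩)
  obtain ⟨a, b, c, ha, hb, hc, hab, hac, hbc⟩ := Finset.two_lt_card_iff.mp hcon
  rcases lt_or_gt_of_ne hab with h1 | h1 <;> rcases lt_or_gt_of_ne hac with h2 | h2 <;>
    rcases lt_or_gt_of_ne hbc with h3 | h3
  · exact key a ha b hb c hc h1 h3
  · exact key a ha c hc b hb h2 h3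
  · exact lt_asymm h1 (h3.trans h2)
  · exact key c hc a ha b hb h2 h1
  · exact key b hb a ha c hc h1 h2
  · exact lt_asymm h1 (h2.trans h3)
  · exact key b hb c hc a ha h3 h2
  · exact key c hc b hb a ha h3 h1

theorem exists_ind_eq_of_notMem_cutCells {t : ℕ} {J : Set ℝ} {ℓ : Fin t}
    (h : ℓ ∉ cutCells t J) : ∃ c ∈ Set.Icc (0 : ℝ) 1, ∀ x ∈ cell t ℓ, ind J x = c := by
  classical
  simp only [cutCells, Finset.mem_filter, Finset.mem_univ, true_and, not_and, not_exists,
    not_not] at h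
  by_cases hx : ∃ x ∈ cell t ℓ, x ∈ J
  · refine ⟨1, by simp, fun y hy => ?_⟩
    rw [ind, Set.indicator_of_mem]
    exact h hx y hy
  · push Not at hx
    refine ⟨0, by simp, fun y hy => ?_⟩
    rw [ind, Set.indicator_of_notMem (hx y hy)]

/-- The average of `φ` over the `f`th of `N` equal cells. -/
noncomputable def jitterAvg (N : ℕ) (φ : ℝ → ℝ) (f : ℕ) : ℝ :=
  ∫ γ in Set.Ico (0 : ℝ) 1, φ (((f : ℝ) + 1 - γ) / N)

/-- A uniform jitter in a uniformly chosen grid cell is uniform on the whole interval; hence every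
design point has exactly the right marginals. -/
theorem integral_Ioc_eq_expect_jitterAvg {N : ℕ} (hN : 0 < N) {φ : ℝ → ℝ}
    (hφ : IntegrableOn φ (Set.Ioc 0 1)) :
    ∫ x in Set.Ioc (0 : ℝ) 1, φ x = 𝔼 f : Fin N, jitterAvg N φ f := by
  have hN' : (0 : ℝ) < N := by exact_mod_cast hN
  have h1 : ∀ f : ℕ, jitterAvg N φ f =
      N * ∫ x in ((f : ℝ) / N)..(((f + 1 : ℕ) : ℝ) / N), φ x := by
    intro f
    rw [jitterAvg, integral_Ico_eq_integral_Ioo, ← integral_Ioc_eq_integral_Ioo,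
      ← intervalIntegral.integral_of_le zero_le_one]
    have := intervalIntegral.integral_comp_sub_div (a := 0) (b := 1) φ hN'.ne' (((f : ℝ) + 1) / N)
    simp_rw [← sub_div] at this
    rw [this, smul_eq_mul]
    congr 3 <;> push_cast <;> ring
  have hsub : ∀ k < N, IntervalIntegrable φ volume ((k : ℝ) / N) (((k + 1 : ℕ) : ℝ) / N) := by
    intro k hk
    rw [intervalIntegrable_iff_integrableOn_Ioc_of_le (by push_cast; gcongr; linarith)]
    refine hφ.mono_set (Set.Ioc_subset_Ioc (by positivity) ?_)
    rw [div_le_one hN']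
    exact_mod_cast hk
  have h2 := intervalIntegral.sum_integral_adjacent_intervals (μ := volume) (f := φ)
    (a := fun k : ℕ => (k : ℝ) / N) (n := N) hsub
  rw [Fintype.expect_eq_sum_div_card, Fintype.card_fin]
  simp_rw [h1]
  rw [← Finset.mul_sum, mul_div_cancel_left₀ _ hN'.ne',
    Fin.sum_univ_eq_sum_range (fun f => ∫ x in ((f : ℝ) / N)..(((f + 1 : ℕ) : ℝ) / N), φ x) N, h2,
    ← intervalIntegral.integral_of_le zero_le_one]
  simp [div_self hN'.ne']

theorem expect_finProd (a b : ℕ) (F : Fin (a * b) → ℝ) :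
    𝔼 f, F f = 𝔼 i, 𝔼 j, F (finProdFinEquiv (i, j)) := by
  rw [← Finset.expect_product', Finset.univ_product_univ]
  exact (Fintype.expect_equiv finProdFinEquiv _ _ fun _ => rfl).symm

theorem grid_mem_Ioc {N : ℕ} (f : Fin N) {γ : ℝ} (hγ : γ ∈ Set.Ico (0 : ℝ) 1) :
    (((f : ℕ) : ℝ) + 1 - γ) / N ∈ Set.Ioc (0 : ℝ) 1 := by
  have hN : (0 : ℝ) < N := by exact_mod_cast f.pos
  have h1 : ((f : ℕ) : ℝ) + 1 ≤ N := by exact_mod_cast f.2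
  have h2 : (0 : ℝ) ≤ (f : ℕ) := Nat.cast_nonneg _
  exact ⟨div_pos (by linarith [hγ.2]) hN, (div_le_one hN).mpr (by linarith [hγ.1])⟩

theorem grid_mem_cell {t lam : ℕ} (ℓ : Fin t) (a : Fin lam) (j : Fin t) {γ : ℝ}
    (hγ : γ ∈ Set.Ico (0 : ℝ) 1) :
    (((finProdFinEquiv (finProdFinEquiv (ℓ, a), j) : Fin (t * lam * t)) : ℕ) + 1 - γ : ℝ) /
      ((t * lam * t : ℕ) : ℝ) ∈ cell t ℓ := by
  have ht : (0 : ℝ) < t := by exact_mod_cast ℓ.pos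
  have hl : (0 : ℝ) < lam := by exact_mod_cast a.pos
  have ha : (a : ℝ) + 1 ≤ lam := by exact_mod_cast a.2
  have hj : (j : ℝ) + 1 ≤ t := by exact_mod_cast j.2
  have ha0 : (0 : ℝ) ≤ (a : ℕ) := Nat.cast_nonneg _
  have hj0 : (0 : ℝ) ≤ (j : ℕ) := Nat.cast_nonneg _
  simp only [finProdFinEquiv_apply_val, Nat.cast_add, Nat.cast_mul]
  constructor
  · rw [div_lt_div_iff₀ ht (by positivity)]
    have : 0 ≤ (t : ℝ) * (a : ℕ) := by positivity
    nlinarith [hγ.2, mul_pos ht ht]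
  · rw [div_le_div_iff₀ (by positivity) ht]
    have : (t : ℝ) * ((a : ℕ) + 1) ≤ t * lam := by gcongr
    nlinarith [hγ.1, mul_pos ht ht]

theorem jitterAvg_mem_Icc {N : ℕ} {φ : ℝ → ℝ}
    (hφ : ∀ x, φ x ∈ Set.Icc (0 : ℝ) 1) (f : ℕ) : jitterAvg N φ f ∈ Set.Icc (0 : ℝ) 1 := by
  refine ⟨integral_nonneg fun x => (hφ _).1, ?_⟩
  have : IsProbabilityMeasure (volume.restrict (Set.Ico (0 : ℝ) 1)) := ⟨by simp⟩
  calc jitterAvg N φ f ≤ ∫ γ in Set.Ico (0 : ℝ) 1, (1 : ℝ) := by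
        refine integral_mono_of_nonneg (Filter.Eventually.of_forall fun x => (hφ _).1)
          (integrable_const _) (Filter.Eventually.of_forall fun x => (hφ _).2)
    _ = 1 := by simp

theorem jitterAvg_eq_of_cell {t lam : ℕ} {φ : ℝ → ℝ} {ℓ : Fin t} {c : ℝ}
    (hc : ∀ x ∈ cell t ℓ, φ x = c) (a : Fin lam) (j : Fin t) :
    jitterAvg (t * lam * t) φ (finProdFinEquiv (finProdFinEquiv (ℓ, a), j) : Fin (t * lam * t)) =
      c := by
  rw [jitterAvg, setIntegral_congr_fun (g := fun _ => c) measurableSet_Ico fun γ hγ =>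
    hc _ (grid_mem_cell ℓ a j hγ)]
  simp

theorem jitterAvg_ind_mul_of_cell {t lam : ℕ} {φ ψ : ℝ → ℝ} {ℓ : Fin t} {c : ℝ}
    (hc : ∀ x ∈ cell t ℓ, φ x = c) (a : Fin lam) (j : Fin t) :
    jitterAvg (t * lam * t) (fun x => φ x * ψ x)
      (finProdFinEquiv (finProdFinEquiv (ℓ, a), j) : Fin (t * lam * t)) =
      c * jitterAvg (t * lam * t) ψ
        (finProdFinEquiv (finProdFinEquiv (ℓ, a), j) : Fin (t * lam * t)) := by
  rw [jitterAvg, jitterAvg, ← integral_const_mul]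
  exact setIntegral_congr_fun measurableSet_Ico fun γ hγ => by
    simp only [hc _ (grid_mem_cell ℓ a j hγ)]

end Cells

/-! ### First and second moments of the entries of one column. -/

/-- The permutations that act on one column: symbols, levels within a symbol for each batch, and
positions within a level. -/
abbrev ColPerms (t lam : ℕ) : Type :=
  Equiv.Perm (Fin t) × (Fin t × Fin t → Equiv.Perm (Fin lam)) × (Fin (t * lam) → Equiv.Perm (Fin t))

namespace ColPerms

variable {t lam : ℕ}

/-- The level, among `t * lam`, of the entry with original symbol `s` and rank `a` in batch `r`. -/
def level (c : ColPerms t lam) (r s : Fin t) (a : Fin lam) : Fin (t * lam) :=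
  finProdFinEquiv (c.1 s, c.2.1 (r, c.1 s) a)

/-- The final level, among `t * lam * t`. -/
def fine (c : ColPerms t lam) (r s : Fin t) (a : Fin lam) : Fin (t * lam * t) :=
  finProdFinEquiv (c.level r s a, c.2.2 (c.level r s a) r)

end ColPerms

section ColumnExpectation

variable {t lam : ℕ}

/-- Average over the positions within a level. -/
noncomputable def levelAvg (F : Fin (t * lam * t) → ℝ) (L : Fin (t * lam)) : ℝ :=
  𝔼 j, F (finProdFinEquiv (L, j))

/-- Average over a cell. -/
noncomputable def cellAvg (F : Fin (t * lam * t) → ℝ) (ℓ : Fin t) : ℝ :=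
  𝔼 a, levelAvg F (finProdFinEquiv (ℓ, a))

theorem expect_cellAvg (F : Fin (t * lam * t) → ℝ) : 𝔼 ℓ, cellAvg F ℓ = 𝔼 f, F f := by
  rw [expect_finProd, expect_finProd]
  rfl

theorem expect_colPerms (X : ColPerms t lam → ℝ) :
    𝔼 c, X c = 𝔼 σ, 𝔼 τ, 𝔼 ρ, X (σ, τ, ρ) := by
  rw [← Finset.univ_product_univ, Finset.expect_product]
  refine Finset.expect_congr rfl fun σ _ => ?_
  rw [← Finset.univ_product_univ, Finset.expect_product]

/-- Each layer of permutations randomizes uniformly within the choice made by the layer above: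
symbol, level within the symbol, position within the level. -/
theorem expect_fine (F : Fin (t * lam * t) → ℝ) (r s : Fin t) (a : Fin lam) :
    𝔼 c : ColPerms t lam, F (c.fine r s a) = 𝔼 f, F f := by
  have h1 : ∀ L : Fin (t * lam),
      𝔼 ρ : Fin (t * lam) → Equiv.Perm (Fin t), F (finProdFinEquiv (L, ρ L r)) = levelAvg F L := by
    intro L
    rw [expect_pi_apply L fun π : Equiv.Perm (Fin t) => F (finProdFinEquiv (L, π r)),
      expect_perm_apply r fun j => F (finProdFinEquiv (L, j))]
    rfl
  have h2 : ∀ ℓ : Fin t, 𝔼 τ : Fin t × Fin t → Equiv.Perm (Fin lam),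
      levelAvg F (finProdFinEquiv (ℓ, τ (r, ℓ) a)) = cellAvg F ℓ := by
    intro ℓ
    rw [expect_pi_apply (r, ℓ) fun π : Equiv.Perm (Fin lam) =>
        levelAvg F (finProdFinEquiv (ℓ, π a)),
      expect_perm_apply a fun j => levelAvg F (finProdFinEquiv (ℓ, j))]
    rfl
  rw [expect_colPerms]
  simp only [ColPerms.fine, ColPerms.level, h1, h2]
  rw [expect_perm_apply s, expect_cellAvg]

section Pair

variable (F H : Fin (t * lam * t) → ℝ)

/-- Different symbols use different, hence independent, permutations in the two lower layers. The
only dependence left is that two symbols are drawn without replacement from `t`. -/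
theorem expect_fine_mul_of_symbol_ne (r r' : Fin t) {s s' : Fin t} (hs : s ≠ s')
    (a a' : Fin lam) :
    𝔼 c : ColPerms t lam, F (c.fine r s a) * H (c.fine r' s' a') =
      (𝔼 f, F f) * (𝔼 f, H f) -
        (𝔼 ℓ, cellAvg F ℓ * cellAvg H ℓ - (𝔼 f, F f) * (𝔼 f, H f)) / ((t : ℝ) - 1) := by
  have h1 : ∀ L L' : Fin (t * lam), L ≠ L' → 𝔼 ρ : Fin (t * lam) → Equiv.Perm (Fin t),
      F (finProdFinEquiv (L, ρ L r)) * H (finProdFinEquiv (L', ρ L' r')) =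
        levelAvg F L * levelAvg H L' := by
    intro L L' hL
    rw [expect_pi_apply_mul hL (fun π : Equiv.Perm (Fin t) => F (finProdFinEquiv (L, π r)))
        fun π : Equiv.Perm (Fin t) => H (finProdFinEquiv (L', π r')),
      expect_perm_apply r fun j => F (finProdFinEquiv (L, j)),
      expect_perm_apply r' fun j => H (finProdFinEquiv (L', j))]
    rfl
  have h2 : ∀ ℓ ℓ' : Fin t, ℓ ≠ ℓ' → 𝔼 τ : Fin t × Fin t → Equiv.Perm (Fin lam),
      levelAvg F (finProdFinEquiv (ℓ, τ (r, ℓ) a)) *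
        levelAvg H (finProdFinEquiv (ℓ', τ (r', ℓ') a')) = cellAvg F ℓ * cellAvg H ℓ' := by
    intro ℓ ℓ' hℓ
    rw [expect_pi_apply_mul (show (r, ℓ) ≠ (r', ℓ') by simp [hℓ])
        (fun π : Equiv.Perm (Fin lam) => levelAvg F (finProdFinEquiv (ℓ, π a)))
        fun π : Equiv.Perm (Fin lam) => levelAvg H (finProdFinEquiv (ℓ', π a')),
      expect_perm_apply a fun j => levelAvg F (finProdFinEquiv (ℓ, j)),
      expect_perm_apply a' fun j => levelAvg H (finProdFinEquiv (ℓ', j))]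
    rfl
  rw [expect_colPerms]
  have h3 : ∀ σ : Equiv.Perm (Fin t), σ s ≠ σ s' := fun σ => σ.injective.ne hs
  have h4 : ∀ (σ : Equiv.Perm (Fin t)) (τ : Fin t × Fin t → Equiv.Perm (Fin lam)),
      (finProdFinEquiv (σ s, τ (r, σ s) a) : Fin (t * lam)) ≠
        finProdFinEquiv (σ s', τ (r', σ s') a') := fun σ τ =>
    finProdFinEquiv.injective.ne fun h => h3 σ (Prod.ext_iff.mp h).1
  simp only [ColPerms.fine, ColPerms.level]
  simp_rw [fun σ τ => h1 _ _ (h4 σ τ), fun σ => h2 _ _ (h3 σ)]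
  rw [expect_perm_apply_mul hs, expect_cellAvg, expect_cellAvg, Fintype.card_fin]

/-- Same batch and symbol: two of the `lam` levels are drawn without replacement, and positions
within distinct levels are independent. -/
theorem expect_fine_mul_of_batch_eq (r s : Fin t) {a a' : Fin lam} (ha : a ≠ a') :
    𝔼 c : ColPerms t lam, F (c.fine r s a) * H (c.fine r s a') =
      𝔼 ℓ, (cellAvg F ℓ * cellAvg H ℓ -
        (𝔼 a, levelAvg F (finProdFinEquiv (ℓ, a)) * levelAvg H (finProdFinEquiv (ℓ, a)) -
          cellAvg F ℓ * cellAvg H ℓ) / ((lam : ℝ) - 1)) := by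
  have h1 : ∀ L L' : Fin (t * lam), L ≠ L' → 𝔼 ρ : Fin (t * lam) → Equiv.Perm (Fin t),
      F (finProdFinEquiv (L, ρ L r)) * H (finProdFinEquiv (L', ρ L' r)) =
        levelAvg F L * levelAvg H L' := by
    intro L L' hL
    rw [expect_pi_apply_mul hL (fun π : Equiv.Perm (Fin t) => F (finProdFinEquiv (L, π r)))
        fun π : Equiv.Perm (Fin t) => H (finProdFinEquiv (L', π r)),
      expect_perm_apply r fun j => F (finProdFinEquiv (L, j)),
      expect_perm_apply r fun j => H (finProdFinEquiv (L', j))]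
    rfl
  rw [expect_colPerms]
  have h4 : ∀ (σ : Equiv.Perm (Fin t)) (τ : Fin t × Fin t → Equiv.Perm (Fin lam)),
      (finProdFinEquiv (σ s, τ (r, σ s) a) : Fin (t * lam)) ≠
        finProdFinEquiv (σ s, τ (r, σ s) a') := fun σ τ =>
    finProdFinEquiv.injective.ne fun h => ha ((τ (r, σ s)).injective (Prod.ext_iff.mp h).2)
  have h2 : ∀ ℓ : Fin t, 𝔼 τ : Fin t × Fin t → Equiv.Perm (Fin lam),
      levelAvg F (finProdFinEquiv (ℓ, τ (r, ℓ) a)) *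
        levelAvg H (finProdFinEquiv (ℓ, τ (r, ℓ) a')) = cellAvg F ℓ * cellAvg H ℓ -
        (𝔼 a, levelAvg F (finProdFinEquiv (ℓ, a)) * levelAvg H (finProdFinEquiv (ℓ, a)) -
          cellAvg F ℓ * cellAvg H ℓ) / ((lam : ℝ) - 1) := by
    intro ℓ
    rw [expect_pi_apply (r, ℓ) fun π : Equiv.Perm (Fin lam) =>
        levelAvg F (finProdFinEquiv (ℓ, π a)) * levelAvg H (finProdFinEquiv (ℓ, π a')),
      expect_perm_apply_mul ha (fun j => levelAvg F (finProdFinEquiv (ℓ, j)))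
        (fun j => levelAvg H (finProdFinEquiv (ℓ, j))), Fintype.card_fin]
    rfl
  simp only [ColPerms.fine, ColPerms.level]
  simp_rw [fun σ τ => h1 _ _ (h4 σ τ), h2]
  rw [expect_perm_apply s fun ℓ => cellAvg F ℓ * cellAvg H ℓ -
        (𝔼 a, levelAvg F (finProdFinEquiv (ℓ, a)) * levelAvg H (finProdFinEquiv (ℓ, a)) -
          cellAvg F ℓ * cellAvg H ℓ) / ((lam : ℝ) - 1)]

/-- Covariance of two entries at distinct positions within the level `L`. -/
noncomputable def levelCov (L : Fin (t * lam)) : ℝ :=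
  𝔼 j, F (finProdFinEquiv (L, j)) * H (finProdFinEquiv (L, j)) - levelAvg F L * levelAvg H L

/-- In different batches the levels of a common symbol are independent, so they coincide with
probability `1/lam`. In that case the two positions are drawn without replacement from `t`. -/
theorem expect_fine_mul_of_batch_ne {r r' : Fin t} (hr : r ≠ r') (s : Fin t) (a a' : Fin lam) :
    𝔼 c : ColPerms t lam, F (c.fine r s a) * H (c.fine r' s a') =
      𝔼 ℓ, (cellAvg F ℓ * cellAvg H ℓ -
        (𝔼 a : Fin lam, levelCov F H (finProdFinEquiv (ℓ, a))) / (((t : ℝ) - 1) * lam)) := by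
  have h1 : ∀ L L' : Fin (t * lam), 𝔼 ρ : Fin (t * lam) → Equiv.Perm (Fin t),
      F (finProdFinEquiv (L, ρ L r)) * H (finProdFinEquiv (L', ρ L' r')) =
        levelAvg F L * levelAvg H L' - if L = L' then levelCov F H L / ((t : ℝ) - 1) else 0 := by
    intro L L'
    by_cases hL : L = L'
    · subst hL
      rw [expect_pi_apply L (fun π : Equiv.Perm (Fin t) => F (finProdFinEquiv (L, π r)) *
          H (finProdFinEquiv (L, π r'))),
        expect_perm_apply_mul hr (fun j => F (finProdFinEquiv (L, j)))
          (fun j => H (finProdFinEquiv (L, j))), Fintype.card_fin, if_pos rfl]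
      rfl
    · rw [expect_pi_apply_mul hL (fun π : Equiv.Perm (Fin t) => F (finProdFinEquiv (L, π r)))
          fun π : Equiv.Perm (Fin t) => H (finProdFinEquiv (L', π r')),
        expect_perm_apply r fun j => F (finProdFinEquiv (L, j)),
        expect_perm_apply r' fun j => H (finProdFinEquiv (L', j)), if_neg hL, sub_zero]
      rfl
  have hlam : (lam : ℝ) ≠ 0 := by exact_mod_cast (Fin.pos a).ne'
  have h2 : ∀ ℓ : Fin t, 𝔼 τ : Fin t × Fin t → Equiv.Perm (Fin lam),
      (levelAvg F (finProdFinEquiv (ℓ, τ (r, ℓ) a)) *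
        levelAvg H (finProdFinEquiv (ℓ, τ (r', ℓ) a')) -
        if (finProdFinEquiv (ℓ, τ (r, ℓ) a) : Fin (t * lam)) = finProdFinEquiv (ℓ, τ (r', ℓ) a')
        then levelCov F H (finProdFinEquiv (ℓ, τ (r, ℓ) a)) / ((t : ℝ) - 1) else 0) =
        cellAvg F ℓ * cellAvg H ℓ -
          (𝔼 a : Fin lam, levelCov F H (finProdFinEquiv (ℓ, a))) / (((t : ℝ) - 1) * lam) := by
    intro ℓ
    have hne : (r, ℓ) ≠ (r', ℓ) := by simp [hr]
    rw [Finset.expect_sub_distrib, expect_pi_apply_mul hne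
        (fun π : Equiv.Perm (Fin lam) => levelAvg F (finProdFinEquiv (ℓ, π a)))
        fun π : Equiv.Perm (Fin lam) => levelAvg H (finProdFinEquiv (ℓ, π a')),
      expect_perm_apply a fun j => levelAvg F (finProdFinEquiv (ℓ, j)),
      expect_perm_apply a' fun j => levelAvg H (finProdFinEquiv (ℓ, j))]
    congr 1
    -- The event of a common level is split according to the level, which separates the two
    -- independent permutations.
    have h5 : ∀ τ : Fin t × Fin t → Equiv.Perm (Fin lam),
        (if (finProdFinEquiv (ℓ, τ (r, ℓ) a) : Fin (t * lam)) = finProdFinEquiv (ℓ, τ (r', ℓ) a')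
        then levelCov F H (finProdFinEquiv (ℓ, τ (r, ℓ) a)) / ((t : ℝ) - 1) else 0) =
        ∑ b, (if τ (r, ℓ) a = b then levelCov F H (finProdFinEquiv (ℓ, b)) / ((t : ℝ) - 1) else 0) *
          (if τ (r', ℓ) a' = b then 1 else 0) := by
      intro τ
      by_cases h : τ (r, ℓ) a = τ (r', ℓ) a'
      · simp [h]
      · simp [h, eq_comm]
    simp_rw [h5]
    rw [Finset.expect_sum_comm]
    have h6 : ∀ b : Fin lam, 𝔼 τ : Fin t × Fin t → Equiv.Perm (Fin lam),
        (if τ (r, ℓ) a = b then levelCov F H (finProdFinEquiv (ℓ, b)) / ((t : ℝ) - 1) else 0) *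
          (if τ (r', ℓ) a' = b then 1 else 0) =
        (levelCov F H (finProdFinEquiv (ℓ, b)) / ((t : ℝ) - 1) / lam) * (1 / lam) := by
      intro b
      rw [expect_pi_apply_mul hne
        (fun π : Equiv.Perm (Fin lam) =>
          if π a = b then levelCov F H (finProdFinEquiv (ℓ, b)) / ((t : ℝ) - 1) else 0)
        fun π : Equiv.Perm (Fin lam) => if π a' = b then 1 else 0,
        expect_perm_apply a fun j =>
          if j = b then levelCov F H (finProdFinEquiv (ℓ, b)) / ((t : ℝ) - 1) else 0,
        expect_perm_apply a' fun j => if j = b then (1 : ℝ) else 0,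
        Fintype.expect_eq_sum_div_card, Fintype.expect_eq_sum_div_card]
      simp
    simp_rw [h6]
    rw [← Finset.sum_mul, Fintype.expect_eq_sum_div_card, Fintype.card_fin,
      ← Finset.sum_div, ← Finset.sum_div]
    rw [div_div, div_div, div_mul_div_comm, mul_one]
    congr 1
    ring
  rw [expect_colPerms]
  simp only [ColPerms.fine, ColPerms.level]
  simp_rw [h1, h2]
  rw [expect_perm_apply s fun ℓ => cellAvg F ℓ * cellAvg H ℓ -
          (𝔼 a : Fin lam, levelCov F H (finProdFinEquiv (ℓ, a))) / (((t : ℝ) - 1) * lam)]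

end Pair

section Bounds

theorem expect_mem_Icc {α : Type*} [Fintype α] {F : α → ℝ} (hF : ∀ a, F a ∈ Set.Icc (0 : ℝ) 1) :
    𝔼 a, F a ∈ Set.Icc (0 : ℝ) 1 := by
  refine ⟨Finset.expect_nonneg fun a _ => (hF a).1, ?_⟩
  rcases isEmpty_or_nonempty α with h | h
  · simp
  · exact Finset.expect_le Finset.univ_nonempty fun a _ => (hF a).2

theorem mul_mem_Icc {x y : ℝ} (hx : x ∈ Set.Icc (0 : ℝ) 1) (hy : y ∈ Set.Icc (0 : ℝ) 1) :
    x * y ∈ Set.Icc (0 : ℝ) 1 :=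
  ⟨mul_nonneg hx.1 hy.1, mul_le_one₀ hx.2 hy.1 hy.2⟩

theorem abs_sub_le_one_of_mem_Icc {x y : ℝ} (hx : x ∈ Set.Icc (0 : ℝ) 1)
    (hy : y ∈ Set.Icc (0 : ℝ) 1) : |x - y| ≤ 1 :=
  abs_le.mpr ⟨by linarith [hx.1, hy.2], by linarith [hx.2, hy.1]⟩

/-- The device by which every within-cell error becomes `O(1/t)`: `B` will be the set of cut cells.
-/
theorem abs_expect_le_of_card_le {B : Finset (Fin t)} (hB : B.card ≤ 2) {x : Fin t → ℝ}
    (h0 : ∀ ℓ ∉ B, x ℓ = 0) (h1 : ∀ ℓ, |x ℓ| ≤ 1) : |𝔼 ℓ, x ℓ| ≤ 2 / t := by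
  rw [Fintype.expect_eq_sum_div_card, Fintype.card_fin, abs_div, Nat.abs_cast]
  gcongr
  rw [← Finset.sum_subset (Finset.subset_univ B) fun ℓ _ h => h0 ℓ h]
  calc |∑ ℓ ∈ B, x ℓ| ≤ ∑ ℓ ∈ B, |x ℓ| := Finset.abs_sum_le_sum_abs _ _
    _ ≤ ∑ _ℓ ∈ B, (1 : ℝ) := Finset.sum_le_sum fun ℓ _ => h1 ℓ
    _ ≤ 2 := by
        rw [Finset.sum_const, nsmul_eq_mul, mul_one]
        exact_mod_cast hB

/-- The averages of `φ` over the `t * lam * t` equal cells. -/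
noncomputable def gridAvg (t lam : ℕ) (φ : ℝ → ℝ) (f : Fin (t * lam * t)) : ℝ :=
  jitterAvg (t * lam * t) φ f

variable {J K : Set ℝ}

theorem gridAvg_ind_mem_Icc (J : Set ℝ) (f : Fin (t * lam * t)) :
    gridAvg t lam (ind J) f ∈ Set.Icc (0 : ℝ) 1 := jitterAvg_mem_Icc (ind_mem_Icc J) _

theorem levelAvg_ind_mem_Icc (J : Set ℝ) (L : Fin (t * lam)) :
    levelAvg (gridAvg t lam (ind J)) L ∈ Set.Icc (0 : ℝ) 1 :=
  expect_mem_Icc fun _ => gridAvg_ind_mem_Icc J _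

theorem cellAvg_ind_mem_Icc (J : Set ℝ) (ℓ : Fin t) :
    cellAvg (gridAvg t lam (ind J)) ℓ ∈ Set.Icc (0 : ℝ) 1 :=
  expect_mem_Icc fun _ => levelAvg_ind_mem_Icc J _

theorem levelAvg_of_cell {φ : ℝ → ℝ} {ℓ : Fin t} {c : ℝ} (hc : ∀ x ∈ cell t ℓ, φ x = c)
    (a : Fin lam) : levelAvg (gridAvg t lam φ) (finProdFinEquiv (ℓ, a)) = c := by
  have : Nonempty (Fin t) := ⟨ℓ⟩
  simp only [levelAvg, gridAvg, jitterAvg_eq_of_cell hc]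
  exact expect_const_real c

theorem cellAvg_of_cell [NeZero lam] {φ : ℝ → ℝ} {ℓ : Fin t} {c : ℝ}
    (hc : ∀ x ∈ cell t ℓ, φ x = c) : cellAvg (gridAvg t lam φ) ℓ = c := by
  simp only [cellAvg, levelAvg_of_cell hc]
  exact expect_const_real c

/-- Covariance of two entries whose symbols agree, up to the variation inside the cells. -/
noncomputable def coarseCov (F H : Fin (t * lam * t) → ℝ) : ℝ :=
  𝔼 ℓ, cellAvg F ℓ * cellAvg H ℓ - (𝔼 f, F f) * 𝔼 f, H f

/-- Bound on the effect of the variation inside the cells, for entries with the given batches,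
symbols and ranks. -/
noncomputable def errBound (t lam : ℕ) (κ κ' : Fin t × Fin t × Fin lam) : ℝ :=
  (if κ = κ' then 2 / (t : ℝ) else 0) +
    (if κ.1 = κ'.1 ∧ κ.2.1 = κ'.2.1 ∧ κ.2.2 ≠ κ'.2.2 then 2 / t / ((lam : ℝ) - 1) else 0) +
    if κ.1 ≠ κ'.1 ∧ κ.2.1 = κ'.2.1 then 2 / t / (((t : ℝ) - 1) * lam) else 0

theorem errBound_nonneg [NeZero lam] (ht : 1 < t) (κ κ' : Fin t × Fin t × Fin lam) :
    0 ≤ errBound t lam κ κ' := by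
  have h1 : (1 : ℝ) ≤ lam := by exact_mod_cast NeZero.one_le
  have h2 : (1 : ℝ) < t := by exact_mod_cast ht
  have h3 := sub_nonneg.mpr h1
  have h4 := sub_pos.mpr h2
  unfold errBound
  refine add_nonneg (add_nonneg ?_ ?_) ?_ <;> split_ifs <;> positivity

/-- The three kinds of partner are the entry itself, `lam - 1` entries of the same batch and symbol,
and `(t - 1) * lam` entries of that symbol in other batches. These counts cancel the denominators,
leaving at most `2/t` for each kind. -/
theorem sum_errBound_le [NeZero lam] (ht : 1 < t) (κ : Fin t × Fin t × Fin lam) :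
    ∑ κ', errBound t lam κ κ' ≤ 6 / t := by
  obtain ⟨r, s, a⟩ := κ
  have h1 : (1 : ℝ) ≤ lam := by exact_mod_cast NeZero.one_le
  have h2 : (1 : ℝ) < t := by exact_mod_cast ht
  have hS1 : ∑ κ' : Fin t × Fin t × Fin lam,
      (if (r, s, a) = κ' then 2 / (t : ℝ) else 0) = 2 / t := by simp
  have hS2 : ∑ κ' : Fin t × Fin t × Fin lam,
      (if r = κ'.1 ∧ s = κ'.2.1 ∧ a ≠ κ'.2.2 then 2 / t / ((lam : ℝ) - 1) else 0) ≤ 2 / t := by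
    rw [← Finset.sum_filter, Finset.sum_const]
    have : (Finset.univ.filter fun κ' : Fin t × Fin t × Fin lam =>
        r = κ'.1 ∧ s = κ'.2.1 ∧ a ≠ κ'.2.2) = {r} ×ˢ {s} ×ˢ Finset.univ.erase a := by
      ext ⟨r', s', a'⟩
      simp only [ne_eq, Finset.mem_filter, Finset.mem_univ, true_and, Finset.mem_product,
        Finset.mem_singleton, Finset.mem_erase, and_true, eq_comm]
    rw [this, Finset.card_product, Finset.card_product, Finset.card_singleton,
      Finset.card_singleton, Finset.card_erase_of_mem (Finset.mem_univ a), Finset.card_univ,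
      Fintype.card_fin, one_mul, one_mul, nsmul_eq_mul, Nat.cast_pred (Nat.pos_of_neZero lam)]
    -- For `lam = 1` there are no entries of the second kind, and the division by zero is harmless.
    rcases h1.eq_or_lt with h | h
    · rw [← h, sub_self, zero_mul]
      positivity
    · rw [mul_div_cancel₀ _ (sub_pos.mpr h).ne']
  have hS3 : ∑ κ' : Fin t × Fin t × Fin lam,
      (if r ≠ κ'.1 ∧ s = κ'.2.1 then 2 / t / (((t : ℝ) - 1) * lam) else 0) = 2 / t := by
    rw [← Finset.sum_filter, Finset.sum_const]
    have : (Finset.univ.filter fun κ' : Fin t × Fin t × Fin lam =>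
        r ≠ κ'.1 ∧ s = κ'.2.1) = Finset.univ.erase r ×ˢ {s} ×ˢ Finset.univ := by
      ext ⟨r', s', a'⟩
      simp [eq_comm]
    rw [this, Finset.card_product, Finset.card_product, Finset.card_singleton,
      Finset.card_erase_of_mem (Finset.mem_univ r), Finset.card_univ, Finset.card_univ,
      Fintype.card_fin, Fintype.card_fin, one_mul, nsmul_eq_mul, Nat.cast_mul,
      Nat.cast_pred (by omega), mul_div_cancel₀]
    exact mul_ne_zero (sub_pos.mpr h2).ne' (by linarith)
  simp only [errBound]
  rw [Finset.sum_add_distrib, Finset.sum_add_distrib, hS1, hS3]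
  calc _ ≤ 2 / (t : ℝ) + 2 / t + 2 / t := by gcongr
    _ = _ := by ring

theorem abs_coarseCov_le_one (J K : Set ℝ) :
    |coarseCov (gridAvg t lam (ind J)) (gridAvg t lam (ind K))| ≤ 1 :=
  abs_sub_le_one_of_mem_Icc
    (expect_mem_Icc fun _ => mul_mem_Icc (cellAvg_ind_mem_Icc J _) (cellAvg_ind_mem_Icc K _))
    (mul_mem_Icc (expect_mem_Icc fun _ => gridAvg_ind_mem_Icc J _)
      (expect_mem_Icc fun _ => gridAvg_ind_mem_Icc K _))

/-- The covariance of the indicators at one point is close to the coarse covariance. -/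
theorem abs_expect_gridAvg_mul_sub_le [NeZero lam] (hJ : J.OrdConnected) (K : Set ℝ) :
    |𝔼 f, gridAvg t lam (fun x => ind J x * ind K x) f -
      𝔼 ℓ, cellAvg (gridAvg t lam (ind J)) ℓ * cellAvg (gridAvg t lam (ind K)) ℓ| ≤ 2 / t := by
  rw [← expect_cellAvg, ← Finset.expect_sub_distrib]
  refine abs_expect_le_of_card_le (card_cutCells_le t hJ) (fun ℓ hℓ => ?_) fun ℓ => ?_
  · obtain ⟨c, -, hc⟩ := exists_ind_eq_of_notMem_cutCells hℓ
    rw [cellAvg_of_cell hc]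
    simp only [cellAvg, levelAvg, gridAvg, jitterAvg_ind_mul_of_cell hc]
    simp_rw [← Finset.mul_expect]
    exact sub_self _
  · exact abs_sub_le_one_of_mem_Icc
      (expect_mem_Icc fun _ => expect_mem_Icc fun _ =>
        jitterAvg_mem_Icc (fun x => mul_mem_Icc (ind_mem_Icc J x) (ind_mem_Icc K x)) _)
      (mul_mem_Icc (cellAvg_ind_mem_Icc J _) (cellAvg_ind_mem_Icc K _))

/-- For different symbols the formula is exact. For equal symbols the correction is an average over
the cells of a covariance inside the cell, which vanishes wherever the indicator of `J` is constant.
-/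
theorem abs_expect_fine_mul_sub_le [NeZero lam] (ht : 1 < t) (hJ : J.OrdConnected) (K : Set ℝ)
    {κ κ' : Fin t × Fin t × Fin lam} (hκ : κ ≠ κ') :
    |𝔼 c : ColPerms t lam, gridAvg t lam (ind J) (c.fine κ.1 κ.2.1 κ.2.2) *
          gridAvg t lam (ind K) (c.fine κ'.1 κ'.2.1 κ'.2.2) -
        (𝔼 f, gridAvg t lam (ind J) f) * (𝔼 f, gridAvg t lam (ind K) f) -
        coarseCov (gridAvg t lam (ind J)) (gridAvg t lam (ind K)) *
          (if κ.2.1 = κ'.2.1 then 1 else -1 / ((t : ℝ) - 1))| ≤ errBound t lam κ κ' := by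
  obtain ⟨r, s, a⟩ := κ
  obtain ⟨r', s', a'⟩ := κ'
  have h1 : (1 : ℝ) ≤ lam := by exact_mod_cast NeZero.one_le
  have h2 : (1 : ℝ) < t := by exact_mod_cast ht
  have : Nonempty (Fin t) := ⟨r⟩
  set F := gridAvg t lam (ind J)
  set H := gridAvg t lam (ind K)
  dsimp only
  by_cases hs : s = s'
  · subst hs
    by_cases hr : r = r'
    · subst hr
      have ha : a ≠ a' := by
        rintro rfl
        exact hκ rfl
      have h3 : (1 : ℝ) < lam := by
        have : 1 < lam := by
          have h4 := Fintype.one_lt_card_iff.mpr ⟨a, a', ha⟩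
          rwa [Fintype.card_fin] at h4
        exact_mod_cast this
      rw [expect_fine_mul_of_batch_eq F H r s ha, Finset.expect_sub_distrib, ← Finset.expect_div]
      have hb : |𝔼 ℓ : Fin t, (𝔼 a, levelAvg F (finProdFinEquiv (ℓ, a)) *
          levelAvg H (finProdFinEquiv (ℓ, a)) - cellAvg F ℓ * cellAvg H ℓ)| ≤ 2 / t := by
        refine abs_expect_le_of_card_le (card_cutCells_le t hJ) (fun ℓ hℓ => ?_) fun ℓ => ?_
        · obtain ⟨c, -, hc⟩ := exists_ind_eq_of_notMem_cutCells hℓ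
          simp only [F, cellAvg_of_cell hc, levelAvg_of_cell hc]
          rw [← Finset.mul_expect]
          exact sub_self _
        · exact abs_sub_le_one_of_mem_Icc (expect_mem_Icc fun _ =>
            mul_mem_Icc (levelAvg_ind_mem_Icc J _) (levelAvg_ind_mem_Icc K _))
            (mul_mem_Icc (cellAvg_ind_mem_Icc J _) (cellAvg_ind_mem_Icc K _))
      have he : errBound t lam (r, s, a) (r, s, a') = 2 / t / ((lam : ℝ) - 1) := by
        simp [errBound, ha]
      rw [he, if_pos rfl, mul_one, coarseCov]
      calc _ = |(𝔼 ℓ : Fin t, (𝔼 a, levelAvg F (finProdFinEquiv (ℓ, a)) *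
          levelAvg H (finProdFinEquiv (ℓ, a)) - cellAvg F ℓ * cellAvg H ℓ)) /
            ((lam : ℝ) - 1)| := by
            rw [← abs_neg]
            congr 1
            ring
        _ ≤ _ := by
            rw [abs_div, abs_of_pos (sub_pos.mpr h3)]
            gcongr
    · rw [expect_fine_mul_of_batch_ne F H hr s a a', Finset.expect_sub_distrib,
        ← Finset.expect_div]
      have hb : |𝔼 ℓ : Fin t, 𝔼 a : Fin lam, levelCov F H (finProdFinEquiv (ℓ, a))| ≤ 2 / t := by
        refine abs_expect_le_of_card_le (card_cutCells_le t hJ) (fun ℓ hℓ => ?_) fun ℓ => ?_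
        · obtain ⟨c, -, hc⟩ := exists_ind_eq_of_notMem_cutCells hℓ
          refine Finset.expect_eq_zero fun a _ => ?_
          simp only [F, levelCov, levelAvg_of_cell hc]
          simp only [gridAvg, jitterAvg_eq_of_cell hc]
          rw [← Finset.mul_expect]
          exact sub_self _
        · refine (Finset.abs_expect_le _ _).trans
            (Finset.expect_le Finset.univ_nonempty fun b _ => ?_)
          exact abs_sub_le_one_of_mem_Icc (expect_mem_Icc fun _ =>
            mul_mem_Icc (gridAvg_ind_mem_Icc J _) (gridAvg_ind_mem_Icc K _))
            (mul_mem_Icc (levelAvg_ind_mem_Icc J _) (levelAvg_ind_mem_Icc K _))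
      have he : errBound t lam (r, s, a) (r', s, a') = 2 / t / (((t : ℝ) - 1) * lam) := by
        simp [errBound, hr]
      rw [he, if_pos rfl, mul_one, coarseCov]
      have h3 : 0 < ((t : ℝ) - 1) * lam := mul_pos (sub_pos.mpr h2) (by linarith)
      calc _ = |(𝔼 ℓ : Fin t, 𝔼 a : Fin lam, levelCov F H (finProdFinEquiv (ℓ, a))) /
            (((t : ℝ) - 1) * lam)| := by
            rw [← abs_neg]
            congr 1
            ring
        _ ≤ _ := by
            rw [abs_div, abs_of_pos h3]
            gcongr
  · rw [expect_fine_mul_of_symbol_ne F H r r' hs a a', if_neg hs, coarseCov]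
    refine le_trans (le_of_eq ?_) (errBound_nonneg ht _ _)
    rw [abs_eq_zero]
    ring

end Bounds

end ColumnExpectation

/-! ### Correlation sums over an array of strength two. -/

section Counting

variable {R : Type*} {t lam m : ℕ} (B : R → Fin m → Fin t)

/-- The correlation of the centred symbol indicators of two rows in column `k`. -/
noncomputable def agreeFactor (i j : R) (k : Fin m) : ℝ :=
  if B i k = B j k then 1 else -1 / ((t : ℝ) - 1)

variable {B}

theorem abs_agreeFactor_le (ht : 1 < t) (i j : R) (k : Fin m) : |agreeFactor B i j k| ≤ 1 := by
  have h2 : (2 : ℝ) ≤ t := by exact_mod_cast ht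
  unfold agreeFactor
  split_ifs
  · simp
  · rw [abs_div, abs_neg, abs_one, abs_of_pos (by linarith), div_le_one (by linarith)]
    linarith

theorem agreeFactor_eq (ht : 1 < t) (i j : R) (k : Fin m) :
    agreeFactor B i j k = (t * (if B j k = B i k then 1 else 0) - 1) / ((t : ℝ) - 1) := by
  have h2 : (2 : ℝ) ≤ t := by exact_mod_cast ht
  have h3 : (t : ℝ) - 1 ≠ 0 := by linarith
  unfold agreeFactor
  by_cases h : B i k = B j k
  · rw [if_pos h, if_pos h.symm, mul_one, div_self h3]
  · rw [if_neg h, if_neg (Ne.symm h), mul_zero, zero_sub]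

/-- Without full agreement the product has modulus `(t-1)⁻ᵈ`, with `d` the number of disagreeing
columns of `u`. If two or more columns agree, use `d ≥ 1`; if exactly one agrees, `d ≥ 2`; if none
agrees, `d ≥ 3`. The three terms on the right count these cases. -/
theorem abs_prod_agreeFactor_sub_le (ht : 1 < t) {u : Finset (Fin m)} (hu : 3 ≤ u.card) (i j : R) :
    |∏ k ∈ u, agreeFactor B i j k - if ∀ k ∈ u, B i k = B j k then 1 else 0| ≤
      (((t : ℝ) - 1)⁻¹ * ∑ k, ∑ l ∈ Finset.univ.erase k,
        (if B j k = B i k then (1 : ℝ) else 0) * (if B j l = B i l then 1 else 0)) +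
      (((t : ℝ) - 1)⁻¹) ^ 2 * (∑ k, if B j k = B i k then (1 : ℝ) else 0) +
      (((t : ℝ) - 1)⁻¹) ^ 3 := by
  classical
  have h2 : (2 : ℝ) ≤ t := by exact_mod_cast ht
  set τ := ((t : ℝ) - 1)⁻¹ with hτ
  have hτ0 : 0 ≤ τ := inv_nonneg.mpr (by linarith)
  have hτ1 : τ ≤ 1 := inv_le_one_of_one_le₀ (by linarith)
  have hS1 : 0 ≤ ∑ k, ∑ l ∈ Finset.univ.erase k,
      (if B j k = B i k then (1 : ℝ) else 0) * (if B j l = B i l then 1 else 0) :=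
    Finset.sum_nonneg fun k _ => Finset.sum_nonneg fun l _ => by positivity
  have hS2 : 0 ≤ ∑ k, if B j k = B i k then (1 : ℝ) else 0 :=
    Finset.sum_nonneg fun k _ => by positivity
  by_cases hall : ∀ k ∈ u, B i k = B j k
  · have h1 : ∏ k ∈ u, agreeFactor B i j k = 1 := Finset.prod_eq_one fun k hk => if_pos (hall k hk)
    rw [if_pos hall, h1, sub_self, abs_zero]
    positivity
  rw [if_neg hall, sub_zero, Finset.abs_prod]
  have habs : ∀ k ∈ u, |agreeFactor B i j k| = if B i k = B j k then 1 else τ := by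
    intro k _
    unfold agreeFactor
    split_ifs
    · simp
    · rw [abs_div, abs_neg, abs_one, abs_of_pos (by linarith), hτ, one_div]
  rw [Finset.prod_congr rfl habs, Finset.prod_ite, Finset.prod_const_one, one_mul,
    Finset.prod_const]
  set g := u.filter fun k => B i k = B j k with hg
  set d := u.filter fun k => ¬ B i k = B j k with hd
  have hgd : g.card + d.card = u.card := Finset.card_filter_add_card_filter_not _
  have hd1 : 1 ≤ d.card := by
    rw [Nat.one_le_iff_ne_zero, Ne, Finset.card_eq_zero, ← Ne, ← Finset.nonempty_iff_ne_empty]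
    push Not at hall
    obtain ⟨k, hk, hne⟩ := hall
    exact ⟨k, Finset.mem_filter.mpr ⟨hk, hne⟩⟩
  rcases Nat.lt_or_ge g.card 1 with h0 | h1
  · have : τ ^ d.card ≤ τ ^ 3 := pow_le_pow_of_le_one hτ0 hτ1 (by omega)
    have : 0 ≤ τ ^ 2 := by positivity
    nlinarith [mul_nonneg hτ0 hS1, mul_nonneg this hS2]
  obtain ⟨k, hk⟩ := Finset.card_pos.mp h1
  have hk' := (Finset.mem_filter.mp hk).2
  rcases Nat.lt_or_ge g.card 2 with h0 | h2'
  · have h3 : τ ^ d.card ≤ τ ^ 2 := pow_le_pow_of_le_one hτ0 hτ1 (by omega)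
    have h4 : 1 ≤ ∑ k, if B j k = B i k then (1 : ℝ) else 0 := by
      refine le_trans ?_ (Finset.single_le_sum (fun k _ => by positivity) (Finset.mem_univ k))
      rw [if_pos hk'.symm]
    have h5 : 0 ≤ τ ^ 2 := by positivity
    have h6 : 0 ≤ τ ^ 3 := by positivity
    nlinarith [mul_nonneg hτ0 hS1, mul_le_mul_of_nonneg_left h4 h5]
  · obtain ⟨a, ha, b, hb, hab⟩ := Finset.one_lt_card.mp h2'
    have ha' := (Finset.mem_filter.mp ha).2
    have hb' := (Finset.mem_filter.mp hb).2
    have h3 : τ ^ d.card ≤ τ ^ 1 := pow_le_pow_of_le_one hτ0 hτ1 hd1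
    rw [pow_one] at h3
    have h4 : 1 ≤ ∑ k, ∑ l ∈ Finset.univ.erase k,
        (if B j k = B i k then (1 : ℝ) else 0) * (if B j l = B i l then 1 else 0) := by
      refine le_trans ?_ (Finset.single_le_sum (fun k _ => Finset.sum_nonneg fun l _ => by
        positivity) (Finset.mem_univ a))
      refine le_trans ?_ (Finset.single_le_sum (fun l _ => by positivity)
        (Finset.mem_erase.mpr ⟨hab.symm, Finset.mem_univ b⟩))
      rw [if_pos ha'.symm, if_pos hb'.symm, one_mul]
    have h5 : 0 ≤ τ ^ 2 * ∑ k, if B j k = B i k then (1 : ℝ) else 0 := by positivity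
    have h6 : 0 ≤ τ ^ 3 := by positivity
    nlinarith [mul_le_mul_of_nonneg_left h4 hτ0]

variable [Fintype R] (hR : Fintype.card R = t * (t * lam))
  (h1 : ∀ k s, (Finset.univ.filter fun i => B i k = s).card = t * lam)
  (h2 : ∀ k k', k ≠ k' → ∀ s s',
    (Finset.univ.filter fun i => B i k = s ∧ B i k' = s').card = lam)

include h1 in
theorem sum_agree (k : Fin m) (s : Fin t) :
    ∑ j, (if B j k = s then (1 : ℝ) else 0) = t * lam := by
  rw [Finset.sum_boole, h1]
  push_cast
  rfl

include h2 in
theorem sum_agree_mul {k l : Fin m} (hkl : k ≠ l) (s s' : Fin t) :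
    ∑ j, (if B j k = s then (1 : ℝ) else 0) * (if B j l = s' then 1 else 0) = lam := by
  have : ∀ j, (if B j k = s then (1 : ℝ) else 0) * (if B j l = s' then 1 else 0) =
      if B j k = s ∧ B j l = s' then 1 else 0 := fun j => by
    by_cases h : B j k = s <;> simp [h]
  simp_rw [this]
  rw [Finset.sum_boole, h2 k l hkl]

include hR h1 in
theorem sum_agreeFactor (ht : 1 < t) (i : R) (k : Fin m) : ∑ j, agreeFactor B i j k = 0 := by
  simp_rw [agreeFactor_eq ht]
  rw [← Finset.sum_div, Finset.sum_sub_distrib, ← Finset.mul_sum, sum_agree h1, Finset.sum_const,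
    Finset.card_univ, hR]
  simp

include hR h1 h2 in
-- The centred agreement indicators of two columns are orthogonal because all pairs of symbols are
-- equally frequent.
theorem sum_agreeFactor_mul (ht : 1 < t) (i : R) {k l : Fin m} (hkl : k ≠ l) :
    ∑ j, agreeFactor B i j k * agreeFactor B i j l = 0 := by
  simp_rw [agreeFactor_eq ht]
  have : ∀ j, (t * (if B j k = B i k then (1 : ℝ) else 0) - 1) / ((t : ℝ) - 1) *
      ((t * (if B j l = B i l then 1 else 0) - 1) / ((t : ℝ) - 1)) =
      ((t : ℝ) ^ 2 * ((if B j k = B i k then (1 : ℝ) else 0) * (if B j l = B i l then 1 else 0)) -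
        t * (if B j k = B i k then (1 : ℝ) else 0) - t * (if B j l = B i l then (1 : ℝ) else 0) + 1) /
        ((t : ℝ) - 1) ^ 2 := fun j => by
    rw [div_mul_div_comm, ← sq]
    congr 1
    ring
  simp_rw [this]
  rw [← Finset.sum_div, Finset.sum_add_distrib, Finset.sum_sub_distrib, Finset.sum_sub_distrib,
    ← Finset.mul_sum, ← Finset.mul_sum, ← Finset.mul_sum, sum_agree h1, sum_agree h1,
    sum_agree_mul h2 hkl, Finset.sum_const, Finset.card_univ, hR]
  simp only [nsmul_eq_mul]
  push_cast
  ring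

include hR h1 h2 in
/-- For at least three columns, the sum of the correlations over all pairs of rows is close to the
number of pairs that agree in all the columns. -/
theorem abs_sum_prod_agreeFactor_sub_le (ht : 1 < t) {u : Finset (Fin m)} (hu : 3 ≤ u.card)
    (i : R) :
    |∑ j, ∏ k ∈ u, agreeFactor B i j k - ∑ j, if ∀ k ∈ u, B i k = B j k then (1 : ℝ) else 0| ≤
      (2 * (m : ℝ) ^ 2 + 4 * m + 8) * lam / t := by
  have h2' : (2 : ℝ) ≤ t := by exact_mod_cast ht
  have hτ : ((t : ℝ) - 1)⁻¹ ≤ 2 / t := by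
    rw [inv_eq_one_div, div_le_div_iff₀ (by linarith) (by linarith)]
    linarith
  have hτ0 : 0 ≤ ((t : ℝ) - 1)⁻¹ := inv_nonneg.mpr (by linarith)
  have hlam : (0 : ℝ) ≤ lam := Nat.cast_nonneg _
  rw [← Finset.sum_sub_distrib]
  refine (Finset.abs_sum_le_sum_abs _ _).trans
    ((Finset.sum_le_sum fun j _ => abs_prod_agreeFactor_sub_le ht hu i j).trans ?_)
  rw [Finset.sum_add_distrib, Finset.sum_add_distrib, ← Finset.mul_sum, ← Finset.mul_sum,
    Finset.sum_comm, Finset.sum_comm (s := Finset.univ (α := R)) (t := Finset.univ (α := Fin m)),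
    Finset.sum_const, Finset.card_univ, hR]
  simp_rw [sum_agree h1]
  have hS : ∑ k : Fin m, ∑ j : R, ∑ l ∈ Finset.univ.erase k,
      (if B j k = B i k then (1 : ℝ) else 0) * (if B j l = B i l then 1 else 0) ≤ m ^ 2 * lam := by
    calc _ ≤ ∑ _k : Fin m, (m : ℝ) * lam := by
          refine Finset.sum_le_sum fun k _ => ?_
          rw [Finset.sum_comm, Finset.sum_congr rfl fun l hl =>
            sum_agree_mul h2 (Finset.ne_of_mem_erase hl).symm (B i k) (B i l), Finset.sum_const,
            nsmul_eq_mul]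
          gcongr
          exact (Finset.card_le_univ _).trans (by simp)
      _ = _ := by
          simp
          ring
  rw [Finset.sum_const, Finset.card_univ, Fintype.card_fin, nsmul_eq_mul, nsmul_eq_mul]
  push_cast
  -- For a fixed row there are at most `m² lam` agreements in ordered pairs of columns, `m t lam` in
  -- single columns, and `t² lam` rows in all; `(t-1)⁻¹ ≤ 2/t` yields the constants.
  calc _ ≤ 2 / (t : ℝ) * (m ^ 2 * lam) + (2 / (t : ℝ)) ^ 2 * (m * (t * lam)) +
        t * (t * lam) * (2 / (t : ℝ)) ^ 3 := by gcongr
    _ = _ := by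
        field_simp
        ring

include h2 in
theorem sum_agree_all_le {u : Finset (Fin m)} (hu : 2 ≤ u.card) (i : R) :
    ∑ j, (if ∀ k ∈ u, B i k = B j k then (1 : ℝ) else 0) ≤ lam := by
  obtain ⟨a, ha, b, hb, hab⟩ := Finset.one_lt_card.mp hu
  rw [← sum_agree_mul h2 hab (B i a) (B i b)]
  refine Finset.sum_le_sum fun j _ => ?_
  split_ifs with h h3 h4 <;> simp_all

include hR h1 h2 in
-- This removes main effects and bivariate interactions from the leading term; it needs one- and
-- two-column balance only.
theorem sum_prod_agreeFactor_eq_zero (ht : 1 < t) {u : Finset (Fin m)} (hu : u.Nonempty)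
    (hu3 : u.card < 3) (i : R) : ∑ j, ∏ k ∈ u, agreeFactor B i j k = 0 := by
  have hpos := Finset.card_pos.mpr hu
  have : u.card = 1 ∨ u.card = 2 := by omega
  rcases this with h | h
  · obtain ⟨k, rfl⟩ := Finset.card_eq_one.mp h
    simp_rw [Finset.prod_singleton]
    exact sum_agreeFactor hR h1 ht i k
  · obtain ⟨k, l, hkl, rfl⟩ := Finset.card_eq_two.mp h
    simp_rw [Finset.prod_pair hkl]
    exact sum_agreeFactor_mul hR h1 h2 ht i hkl

end Counting

/-! ### Invariance of the coincidence counts and structure of the batches. -/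

theorem coincidences_card {N k s : ℕ} (C : Fin N → Fin k → Fin s) (u : Finset (Fin k)) :
    (coincidences C u u.card : ℝ) =
      ∑ i, ∑ j, if ∀ l ∈ u, C i l = C j l then (1 : ℝ) else 0 := by
  rw [← Fintype.sum_prod_type' (f := fun i j => if ∀ l ∈ u, C i l = C j l then (1 : ℝ) else 0),
    Finset.sum_boole, coincidences]
  congr 2
  ext ij
  simp only [Finset.mem_filter, Finset.mem_univ, true_and]
  rw [Finset.card_filter_eq_iff]

/-- Relabelling the symbols of a column preserves agreement and permuting the rows permutes the
pairs, so only the column order survives. -/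
theorem coincidences_randomizedArray {t lam m : ℕ} (O : Fin (t * (t * lam)) → Fin (m + 1) → Fin t)
    (ω : SolhPerms t lam m) (u : Finset (Fin m)) :
    (coincidences (fun i (k : Fin m) => randomizedArray O ω i k.castSucc) u u.card : ℝ) =
      coincidences (fun i (k : Fin m) => O i (ω.col k.castSucc)) u u.card := by
  rw [coincidences_card, coincidences_card]
  symm
  rw [← Equiv.sum_comp ω.row]
  refine Finset.sum_congr rfl fun i _ => ?_
  rw [← Equiv.sum_comp ω.row]
  simp [randomizedArray]

/-- The permutations that determine which rows of the array form which batch. -/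
abbrev SliceBase (t lam m : ℕ) : Type :=
  Equiv.Perm (Fin (t * (t * lam))) × Equiv.Perm (Fin (m + 1)) × Equiv.Perm (Fin t)

/-- Given the permutations that determine the batches, those of the columns are independent. -/
def solhPermsEquiv (t lam m : ℕ) :
    SolhPerms t lam m ≃ SliceBase t lam m × (Fin m → ColPerms t lam) where
  toFun ω := ((ω.row, ω.col, ω.sym (Fin.last m)),
    fun k => (ω.sym k.castSucc, fun rs => ω.sub rs.1 k rs.2, ω.lev k))
  invFun x := ⟨x.1.1, x.1.2.1,
    Fin.lastCases (motive := fun _ => Equiv.Perm (Fin t)) x.1.2.2 fun k => (x.2 k).1,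
    fun r k s => (x.2 k).2.1 (r, s), fun k => (x.2 k).2.2⟩
  left_inv ω := by
    ext1 <;> try rfl
    ext1 k
    refine Fin.lastCases ?_ (fun k => ?_) k <;> simp
  right_inv x := by
    refine Prod.ext ?_ (funext fun k => ?_) <;> simp

section OrthogonalArray

variable {t lam m : ℕ} {O : Fin (t * (t * lam)) → Fin (m + 1) → Fin t}

theorem IsOrthogonalArray.card_pair (hO : IsOrthogonalArray 2 lam O) {k k' : Fin (m + 1)}
    (hk : k ≠ k') (s s' : Fin t) :
    (Finset.univ.filter fun i => O i k = s ∧ O i k' = s').card = lam := by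
  have hinj : Function.Injective ![k, k'] := by
    intro i j h
    fin_cases i <;> fin_cases j <;> simp_all [eq_comm]
  refine Eq.trans ?_ (hO.2 ⟨![k, k'], hinj⟩ ![s, s'])
  congr 1
  ext i
  simp [Fin.forall_fin_two]

theorem IsOrthogonalArray.card_single (hO : IsOrthogonalArray 2 lam O) (k : Fin (m + 1))
    (s : Fin t) : (Finset.univ.filter fun i => O i k = s).card = t * lam := by
  have hm : 1 < m + 1 := hO.1
  have : Nontrivial (Fin (m + 1)) := Fin.nontrivial_iff_two_le.mpr hm
  obtain ⟨k', hk'⟩ := exists_ne k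
  rw [Finset.card_eq_sum_card_fiberwise (f := fun i => O i k') (t := Finset.univ)
    (fun _ _ => Finset.mem_univ _)]
  simp_rw [Finset.filter_filter]
  simp [hO.card_pair hk'.symm]

end OrthogonalArray

/-- For each `v` exactly `v * n` indices have value below `v`, and by monotonicity they form an
initial segment. Thus sorting the rows does cut the array into blocks of constant batch symbol. -/
theorem eq_of_monotone_of_card_fiber {t n : ℕ} {f : Fin (t * n) → Fin t} (hf : Monotone f)
    (hcard : ∀ s, (Finset.univ.filter fun j => f j = s).card = n) (r : Fin t) (i : Fin n) :
    f (finProdFinEquiv (r, i)) = r := by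
  have key : ∀ (v : ℕ), v ≤ t → ∀ j : Fin (t * n), (f j : ℕ) < v ↔ (j : ℕ) < v * n := by
    intro v hv j
    have hc : (Finset.univ.filter fun j => (f j : ℕ) < v).card = v * n := by
      rw [Finset.card_eq_sum_card_fiberwise (f := f)
        (t := Finset.univ.filter fun s : Fin t => (s : ℕ) < v) (fun x hx => by simpa using hx)]
      have hfib : ∀ s ∈ Finset.univ.filter fun s : Fin t => (s : ℕ) < v,
          ((Finset.univ.filter fun j => (f j : ℕ) < v).filter fun j => f j = s).card = n := by
        intro s hs
        refine Eq.trans ?_ (hcard s)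
        rw [Finset.filter_filter]
        congr 1
        ext x
        simp only [Finset.mem_filter, Finset.mem_univ, true_and] at hs ⊢
        exact ⟨fun h => h.2, fun h => ⟨h ▸ hs, h⟩⟩
      rw [Finset.sum_congr rfl hfib, Finset.sum_const, Fin.card_filter_val_lt, min_eq_right hv,
        smul_eq_mul]
    constructor
    · intro h
      have hsub : Finset.Iic j ⊆ Finset.univ.filter fun j => (f j : ℕ) < v := by
        intro x hx
        simp only [Finset.mem_filter, Finset.mem_univ, true_and]
        exact lt_of_le_of_lt (hf (Finset.mem_Iic.mp hx)) h
      have := Finset.card_le_card hsub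
      rw [Fin.card_Iic, hc] at this
      omega
    · intro h
      by_contra hcon
      have hsub : (Finset.univ.filter fun j => (f j : ℕ) < v) ⊆ Finset.Iio j := by
        intro x hx
        simp only [Finset.mem_filter, Finset.mem_univ, true_and] at hx
        rw [Finset.mem_Iio]
        by_contra hx'
        exact hcon (lt_of_le_of_lt (hf (not_lt.mp hx')) hx)
      have := Finset.card_le_card hsub
      rw [Fin.card_Iio, hc] at this
      omega
  have hj : ((finProdFinEquiv (r, i) : Fin (t * n)) : ℕ) = i + n * r := rfl
  have h1 := key r r.2.le (finProdFinEquiv (r, i))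
  have h2 := key (r + 1) r.2 (finProdFinEquiv (r, i))
  rw [hj] at h1 h2
  have h3 : (i : ℕ) + n * r < (r + 1) * n := by
    have := i.2
    nlinarith
  have h4 : ¬ (i : ℕ) + n * r < r * n := by
    rw [mul_comm]
    omega
  ext
  have := h2.mpr h3
  have := mt h1.mp h4
  omega

/-! ### Batches, symbols and ranks of the positions. -/

section Slices

variable {t lam m : ℕ} (O : Fin (t * (t * lam)) → Fin (m + 1) → Fin t) (b : SliceBase t lam m)

/-- The symbol that determines the batch of a row. -/
def batchSymbol (j : Fin (t * (t * lam))) : Fin t := b.2.2 (O (b.1 j) (b.2.1 (Fin.last m)))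

/-- The row of the original array at a given position of a given batch. -/
noncomputable def rowAt : Fin t × Fin (t * lam) ≃ Fin (t * (t * lam)) :=
  finProdFinEquiv.trans ((Tuple.sort (batchSymbol O b)).trans b.1)

/-- The original symbol at a given position. -/
noncomputable def symbolAt (p : Fin t × Fin (t * lam)) (k : Fin m) : Fin t :=
  O (rowAt O b p) (b.2.1 k.castSucc)

/-- The rank of a position among those with the same symbol in the same batch. -/
noncomputable def rankAt [NeZero lam] (p : Fin t × Fin (t * lam)) (k : Fin m) : Fin lam :=
  Fin.ofNat lam (Finset.univ.filter fun i' : Fin (t * lam) =>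
    i' < p.2 ∧ symbolAt O b (p.1, i') k = symbolAt O b p k).card

/-- Batch, symbol and rank of a position. -/
noncomputable def keyAt [NeZero lam] (k : Fin m) (p : Fin t × Fin (t * lam)) :
    Fin t × Fin t × Fin lam := (p.1, symbolAt O b p k, rankAt O b p k)

/-- Ranks compare symbols only for equality, so they may be computed from the original symbols.
Batch, symbol and rank of a position thus depend on the slice base alone, and all other randomness
sits in the independent column permutations. -/
theorem fineLevel_eq [NeZero lam] (ω : SolhPerms t lam m) (r : Fin t) (i : Fin (t * lam))
    (k : Fin m) :
    fineLevel O ω r i k = ((solhPermsEquiv t lam m ω).2 k).fine r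
      (symbolAt O (solhPermsEquiv t lam m ω).1 (r, i) k)
      (rankAt O (solhPermsEquiv t lam m ω).1 (r, i) k) := by
  have hs : ∀ i, sliceSymbol O ω r i k =
      ω.sym k.castSucc (symbolAt O (solhPermsEquiv t lam m ω).1 (r, i) k) := fun i => rfl
  have hr : sliceRank O ω r i k = (Finset.univ.filter fun i' : Fin (t * lam) =>
      i' < i ∧ symbolAt O (solhPermsEquiv t lam m ω).1 (r, i') k =
        symbolAt O (solhPermsEquiv t lam m ω).1 (r, i) k).card := by
    simp only [sliceRank, hs, EmbeddingLike.apply_eq_iff_eq]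
  have hl : sliceLevel O ω r i k = ((solhPermsEquiv t lam m ω).2 k).level r
      (symbolAt O (solhPermsEquiv t lam m ω).1 (r, i) k)
      (rankAt O (solhPermsEquiv t lam m ω).1 (r, i) k) := by
    rw [sliceLevel, hr, hs]
    rfl
  rw [fineLevel, hl]
  rfl

variable {O} (hO : IsOrthogonalArray 2 lam O)

include hO

theorem batchSymbol_rowAt (p : Fin t × Fin (t * lam)) :
    b.2.2 (O (rowAt O b p) (b.2.1 (Fin.last m))) = p.1 := by
  refine eq_of_monotone_of_card_fiber (f := batchSymbol O b ∘ Tuple.sort (batchSymbol O b))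
    (Tuple.monotone_sort _) (fun s => ?_) p.1 p.2
  refine Eq.trans ?_ (hO.card_single (b.2.1 (Fin.last m)) (b.2.2.symm s))
  refine Finset.card_equiv ((Tuple.sort (batchSymbol O b)).trans b.1) fun j => ?_
  rw [Finset.mem_filter, Finset.mem_filter, Equiv.eq_symm_apply]
  simp [batchSymbol]

/-- Strength two for the batch column together with column `k`. -/
theorem card_symbolAt_eq (r : Fin t) (k : Fin m) (s : Fin t) :
    (Finset.univ.filter fun i : Fin (t * lam) => symbolAt O b (r, i) k = s).card = lam := by
  have hne : b.2.1 (Fin.last m) ≠ b.2.1 k.castSucc :=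
    b.2.1.injective.ne (Fin.castSucc_lt_last k).ne'
  refine Eq.trans ?_ (hO.card_pair hne (b.2.2.symm r) s)
  refine Finset.card_bij (fun i _ => rowAt O b (r, i)) (fun i hi => ?_) (fun i _ i' _ h => ?_)
    fun j hj => ?_
  · simp only [Finset.mem_filter, Finset.mem_univ, true_and] at hi ⊢
    exact ⟨by rw [Equiv.eq_symm_apply, batchSymbol_rowAt b hO], hi⟩
  · exact (Prod.ext_iff.mp ((rowAt O b).injective h)).2
  · simp only [Finset.mem_filter, Finset.mem_univ, true_and] at hj
    obtain ⟨⟨r', i⟩, rfl⟩ := (rowAt O b).surjective j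
    have hr : r' = r := by
      rw [Equiv.eq_symm_apply, batchSymbol_rowAt b hO] at hj
      exact hj.1
    subst hr
    exact ⟨i, Finset.mem_filter.mpr ⟨Finset.mem_univ _, hj.2⟩, rfl⟩

theorem keyAt_injective [NeZero lam] (k : Fin m) : Function.Injective (keyAt O b k) := by
  let c : Fin t → Fin (t * lam) → Finset (Fin (t * lam)) := fun r i =>
    Finset.univ.filter fun i' => i' < i ∧ symbolAt O b (r, i') k = symbolAt O b (r, i) k
  -- The rank stays below `lam`, so the reduction modulo `lam` in its definition never wraps around.
  have hlt : ∀ r i, (c r i).card < lam := by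
    intro r i
    refine lt_of_lt_of_eq ?_ (card_symbolAt_eq b hO r k (symbolAt O b (r, i) k))
    refine Finset.card_lt_card ((Finset.ssubset_iff_of_subset fun x hx => ?_).mpr ⟨i, ?_, ?_⟩)
    · simp only [c, Finset.mem_filter, Finset.mem_univ, true_and] at hx ⊢
      exact hx.2
    · simp
    · simp [c]
  have hmono : ∀ r i i', i < i' → symbolAt O b (r, i) k = symbolAt O b (r, i') k →
      (c r i).card < (c r i').card := by
    intro r i i' hi hs
    refine Finset.card_lt_card ((Finset.ssubset_iff_of_subset fun x hx => ?_).mpr ⟨i, ?_, ?_⟩)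
    · simp only [c, Finset.mem_filter, Finset.mem_univ, true_and] at hx ⊢
      exact ⟨hx.1.trans hi, hx.2.trans hs⟩
    · simpa [c] using ⟨hi, hs⟩
    · simp [c]
  rintro ⟨r, i⟩ ⟨r', i'⟩ h
  simp only [keyAt, Prod.mk.injEq] at h
  obtain ⟨rfl, hs, hrank⟩ := h
  have hcard : (c r i).card = (c r i').card := by
    have := congrArg Fin.val hrank
    simp only [rankAt, Fin.val_ofNat] at this
    change (c r i).card % lam = (c r i').card % lam at this
    rwa [Nat.mod_eq_of_lt (hlt r i), Nat.mod_eq_of_lt (hlt r i')] at this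
  rcases lt_trichotomy i i' with hi | hi | hi
  · exact absurd hcard (hmono r i i' hi hs).ne
  · rw [hi]
  · exact absurd hcard (hmono r i' i hi hs.symm).ne'

end Slices

/-! ### Product estimates, step functions and jitters. -/

/-- Telescoping: factors are exchanged one at a time while all others are bounded by one. -/
theorem abs_prod_sub_prod_le {κ : Type*} (u : Finset κ) (x y : κ → ℝ)
    (hx : ∀ k, |x k| ≤ 1) (hy : ∀ k, |y k| ≤ 1) :
    |∏ k ∈ u, x k - ∏ k ∈ u, y k| ≤ ∑ k ∈ u, |x k - y k| := by
  classical
  induction u using Finset.induction_on with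
  | empty => simp
  | insert k u hk ih =>
    rw [Finset.prod_insert hk, Finset.prod_insert hk, Finset.sum_insert hk]
    have h1 : x k * ∏ k ∈ u, x k - y k * ∏ k ∈ u, y k =
        (x k - y k) * ∏ k ∈ u, x k + y k * (∏ k ∈ u, x k - ∏ k ∈ u, y k) := by ring
    have h2 : |∏ k ∈ u, x k| ≤ 1 := by
      rw [Finset.abs_prod]
      exact Finset.prod_le_one (fun _ _ => abs_nonneg _) fun k _ => hx k
    rw [h1]
    refine (abs_add_le _ _).trans (add_le_add ?_ ?_)
    · rw [abs_mul]
      exact mul_le_of_le_one_right (abs_nonneg _) h2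
    · rw [abs_mul]
      exact (mul_le_of_le_one_left (abs_nonneg _) (hy k)).trans ih

/-- The length of the part of `J` in `(0,1]`. -/
noncomputable def mass (J : Set ℝ) : ℝ := ∫ x in Set.Ioc (0 : ℝ) 1, ind J x

/-- The covariance of the indicators of `J` and `K` under the uniform distribution. -/
noncomputable def indCov (J K : Set ℝ) : ℝ :=
  (∫ x in Set.Ioc (0 : ℝ) 1, ind J x * ind K x) - mass J * mass K

/-- Linear combination of products of indicators. -/
noncomputable def stepFn {ι : Type*} [Fintype ι] {m : ℕ} (c : ι → ℝ) (J : ι → Fin m → Set ℝ)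
    (z : Fin m → ℝ) : ℝ := ∑ s, c s * ∏ k, ind (J s k) (z k)

section StepFn

variable {ι : Type*} [Fintype ι] {m : ℕ} (c : ι → ℝ) (J : ι → Fin m → Set ℝ)

theorem prod_ind_mem_Icc {κ : Type*} (u : Finset κ) (J : κ → Set ℝ) (z : κ → ℝ) :
    ∏ k ∈ u, ind (J k) (z k) ∈ Set.Icc (0 : ℝ) 1 :=
  ⟨Finset.prod_nonneg fun _ _ => (ind_mem_Icc _ _).1,
    Finset.prod_le_one (fun _ _ => (ind_mem_Icc _ _).1) fun _ _ => (ind_mem_Icc _ _).2⟩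

theorem abs_stepFn_le (z : Fin m → ℝ) : |stepFn c J z| ≤ ∑ s, |c s| := by
  refine (Finset.abs_sum_le_sum_abs _ _).trans (Finset.sum_le_sum fun s _ => ?_)
  have h := prod_ind_mem_Icc Finset.univ (J s) z
  rw [abs_mul, abs_of_nonneg h.1]
  exact mul_le_of_le_one_right (abs_nonneg _) h.2

variable {J}

theorem measurable_stepFn (hJ : ∀ s k, (J s k).OrdConnected) : Measurable (stepFn c J) :=
  Finset.measurable_fun_sum _ fun s _ => measurable_const.mul
    (Finset.measurable_fun_prod _ fun k _ => (measurable_ind (hJ s k)).comp (measurable_pi_apply k))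

end StepFn

/-- The law of the jitters. -/
noncomputable def jitterLaw (t lam m : ℕ) : Measure (Fin t → Fin (t * lam) → Fin m → ℝ) :=
  Measure.pi fun _ => Measure.pi fun _ => Measure.pi fun _ => volume.restrict (Set.Ico (0 : ℝ) 1)

instance isProbabilityMeasure_restrict_Ico :
    IsProbabilityMeasure (volume.restrict (Set.Ico (0 : ℝ) 1)) := ⟨by simp⟩

instance isProbabilityMeasure_restrict_Ioc :
    IsProbabilityMeasure (volume.restrict (Set.Ioc (0 : ℝ) 1)) := ⟨by simp⟩

instance (t lam m : ℕ) : IsProbabilityMeasure (jitterLaw t lam m) := by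
  unfold jitterLaw
  infer_instance

theorem integral_jitterLaw_prod {t lam m : ℕ} (g : Fin t → Fin (t * lam) → Fin m → ℝ → ℝ) :
    ∫ γ, ∏ r, ∏ i, ∏ k, g r i k (γ r i k) ∂(jitterLaw t lam m) =
      ∏ r, ∏ i, ∏ k, ∫ x in Set.Ico (0 : ℝ) 1, g r i k x := by
  unfold jitterLaw
  rw [integral_fintype_prod_eq_prod (fun r (y : Fin (t * lam) → Fin m → ℝ) =>
    ∏ i, ∏ k, g r i k (y i k))]
  refine Finset.prod_congr rfl fun r _ => ?_
  rw [integral_fintype_prod_eq_prod (fun i (y : Fin m → ℝ) => ∏ k, g r i k (y k))]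
  refine Finset.prod_congr rfl fun i _ => ?_
  rw [integral_fintype_prod_eq_prod (fun k (y : ℝ) => g r i k y)]

/-- Jitters of different positions are independent, so the averages factor; a position paired with
itself shares its jitter, so there the product stays under one average. -/
theorem integral_jitterLaw_pair {t lam m : ℕ} (a : Fin t × Fin (t * lam) → Fin m → Fin (t * lam * t))
    (p q : Fin t × Fin (t * lam)) (φ ψ : Fin m → ℝ → ℝ) :
    ∫ γ, ∏ k, (φ k (((a p k : ℕ) + 1 - γ p.1 p.2 k) / ((t * lam * t : ℕ) : ℝ)) *
        ψ k (((a q k : ℕ) + 1 - γ q.1 q.2 k) / ((t * lam * t : ℕ) : ℝ))) ∂(jitterLaw t lam m) =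
      ∏ k, if p = q then gridAvg t lam (fun x => φ k x * ψ k x) (a p k)
        else gridAvg t lam (φ k) (a p k) * gridAvg t lam (ψ k) (a q k) := by
  classical
  -- Padding with ones turns the two-position product into a product over all jitters, to which
  -- Fubini applies.
  let g : Fin t × Fin (t * lam) → Fin m → ℝ → ℝ := fun x k y =>
    (if x = p then φ k (((a p k : ℕ) + 1 - y) / ((t * lam * t : ℕ) : ℝ)) else 1) *
      (if x = q then ψ k (((a q k : ℕ) + 1 - y) / ((t * lam * t : ℕ) : ℝ)) else 1)
  have h := integral_jitterLaw_prod (fun r i k => g (r, i) k)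
  have hL : ∀ γ : Fin t → Fin (t * lam) → Fin m → ℝ,
      ∏ r, ∏ i, ∏ k, g (r, i) k (γ r i k) =
      ∏ k, (φ k (((a p k : ℕ) + 1 - γ p.1 p.2 k) / ((t * lam * t : ℕ) : ℝ)) *
        ψ k (((a q k : ℕ) + 1 - γ q.1 q.2 k) / ((t * lam * t : ℕ) : ℝ))) := by
    intro γ
    rw [← Fintype.prod_prod_type' (f := fun r i => ∏ k, g (r, i) k (γ r i k)), Finset.prod_comm]
    refine Finset.prod_congr rfl fun k _ => ?_
    simp only [g, Prod.mk.eta, Finset.prod_mul_distrib]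
    simp
  simp_rw [hL] at h
  rw [h, ← Fintype.prod_prod_type' (f := fun r i => ∏ k, ∫ x in Set.Ico (0 : ℝ) 1, g (r, i) k x),
    Finset.prod_comm]
  refine Finset.prod_congr rfl fun k _ => ?_
  simp only [Prod.mk.eta]
  by_cases hpq : p = q
  · subst hpq
    rw [if_pos rfl, Fintype.prod_eq_single p fun x hx => by simp [g, hx]]
    simp [g, gridAvg, jitterAvg]
  · rw [if_neg hpq, Fintype.prod_eq_mul p q hpq fun x hx => by simp [g, hx.1, hx.2]]
    simp [g, gridAvg, jitterAvg, hpq, Ne.symm hpq]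

/-! ### Covariances within one column. -/

section Column

variable {t lam : ℕ} [NeZero lam]

/-- Expectation of a product of functions of two entries of a column, given the batches, original
symbols and ranks. -/
noncomputable def colMean {P : Type*} [DecidableEq P] (key : P → Fin t × Fin t × Fin lam)
    (φ ψ : ℝ → ℝ) (p q : P) : ℝ :=
  𝔼 c : ColPerms t lam, if p = q then
      gridAvg t lam (fun x => φ x * ψ x) (c.fine (key p).1 (key p).2.1 (key p).2.2)
    else gridAvg t lam φ (c.fine (key p).1 (key p).2.1 (key p).2.2) *
      gridAvg t lam ψ (c.fine (key q).1 (key q).2.1 (key q).2.2)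

variable {P : Type*} [DecidableEq P] (key : P → Fin t × Fin t × Fin lam) {J K : Set ℝ}

omit [NeZero lam] in
theorem colMean_self (φ ψ : ℝ → ℝ) (p : P) :
    colMean key φ ψ p p = 𝔼 f, gridAvg t lam (fun x => φ x * ψ x) f := by
  simp only [colMean, if_true]
  rw [expect_fine]

omit [NeZero lam] in
theorem expect_gridAvg (hN : 0 < t * lam * t) {φ : ℝ → ℝ} (hφ : IntegrableOn φ (Set.Ioc 0 1)) :
    𝔼 f, gridAvg t lam φ f = ∫ x in Set.Ioc (0 : ℝ) 1, φ x :=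
  (integral_Ioc_eq_expect_jitterAvg hN hφ).symm

theorem integrableOn_ind (hJ : J.OrdConnected) : IntegrableOn (ind J) (Set.Ioc 0 1) :=
  Integrable.of_bound (measurable_ind hJ).aestronglyMeasurable 1
    (Filter.Eventually.of_forall fun x => by
      rw [Real.norm_of_nonneg (ind_mem_Icc J x).1]
      exact (ind_mem_Icc J x).2)

theorem integrableOn_ind_mul (hJ : J.OrdConnected) (hK : K.OrdConnected) :
    IntegrableOn (fun x => ind J x * ind K x) (Set.Ioc 0 1) :=
  Integrable.of_bound ((measurable_ind hJ).mul (measurable_ind hK)).aestronglyMeasurable 1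
    (Filter.Eventually.of_forall fun x => by
      have := mul_mem_Icc (ind_mem_Icc J x) (ind_mem_Icc K x)
      rw [Real.norm_of_nonneg this.1]
      exact this.2)

theorem mass_mem_Icc (J : Set ℝ) : mass J ∈ Set.Icc (0 : ℝ) 1 := by
  refine ⟨integral_nonneg fun x => (ind_mem_Icc J x).1, ?_⟩
  calc mass J ≤ ∫ x in Set.Ioc (0 : ℝ) 1, (1 : ℝ) := by
        refine integral_mono_of_nonneg (Filter.Eventually.of_forall fun x => (ind_mem_Icc J x).1)
          (integrable_const _) (Filter.Eventually.of_forall fun x => (ind_mem_Icc J x).2)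
    _ = 1 := by simp

omit [NeZero lam] in
theorem colMean_mem_Icc (p q : P) :
    colMean key (ind J) (ind K) p q ∈ Set.Icc (0 : ℝ) 1 := by
  refine expect_mem_Icc fun c => ?_
  split_ifs
  · exact jitterAvg_mem_Icc (fun x => mul_mem_Icc (ind_mem_Icc J x) (ind_mem_Icc K x)) _
  · exact mul_mem_Icc (gridAvg_ind_mem_Icc J _) (gridAvg_ind_mem_Icc K _)

theorem abs_colMean_sub_le (ht : 1 < t) (hJ : J.OrdConnected) (hK : K.OrdConnected)
    (hkey : Function.Injective key) (p q : P) :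
    |colMean key (ind J) (ind K) p q - mass J * mass K -
      coarseCov (gridAvg t lam (ind J)) (gridAvg t lam (ind K)) *
        (if (key p).2.1 = (key q).2.1 then 1 else -1 / ((t : ℝ) - 1))| ≤
      errBound t lam (key p) (key q) := by
  have hlam := Nat.pos_of_neZero lam
  have hN : 0 < t * lam * t := by positivity
  have hmJ : mass J = 𝔼 f, gridAvg t lam (ind J) f := (expect_gridAvg hN (integrableOn_ind hJ)).symm
  have hmK : mass K = 𝔼 f, gridAvg t lam (ind K) f := (expect_gridAvg hN (integrableOn_ind hK)).symm
  by_cases hpq : p = q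
  · subst hpq
    rw [colMean_self, if_pos rfl, mul_one, coarseCov, ← hmJ, ← hmK]
    have h1 : errBound t lam (key p) (key p) = 2 / t := by simp [errBound]
    rw [h1]
    refine le_trans (le_of_eq ?_) (abs_expect_gridAvg_mul_sub_le (lam := lam) hJ K)
    congr 1
    ring
  · rw [hmJ, hmK]
    simp only [colMean, if_neg hpq]
    exact abs_expect_fine_mul_sub_le ht hJ K (hkey.ne hpq)

theorem abs_coarseCov_sub_indCov_le (ht : 1 < t) (hJ : J.OrdConnected) (hK : K.OrdConnected) :
    |coarseCov (gridAvg t lam (ind J)) (gridAvg t lam (ind K)) - indCov J K| ≤ 2 / t := by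
  have hlam := Nat.pos_of_neZero lam
  have hN : 0 < t * lam * t := by positivity
  have h := abs_expect_gridAvg_mul_sub_le (t := t) (lam := lam) hJ K
  rw [expect_gridAvg hN (integrableOn_ind_mul hJ hK)] at h
  rw [indCov, coarseCov, mass, mass, expect_gridAvg hN (integrableOn_ind hJ),
    expect_gridAvg hN (integrableOn_ind hK), abs_sub_comm]
  refine le_trans (le_of_eq ?_) h
  congr 1
  ring

theorem abs_indCov_le_one (J K : Set ℝ) : |indCov J K| ≤ 1 := by
  refine abs_sub_le_one_of_mem_Icc ⟨integral_nonneg fun x =>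
    mul_nonneg (ind_mem_Icc J x).1 (ind_mem_Icc K x).1, ?_⟩
    (mul_mem_Icc (mass_mem_Icc J) (mass_mem_Icc K))
  calc ∫ x in Set.Ioc (0 : ℝ) 1, ind J x * ind K x ≤ ∫ x in Set.Ioc (0 : ℝ) 1, (1 : ℝ) := by
        refine integral_mono_of_nonneg (Filter.Eventually.of_forall fun x =>
          (mul_mem_Icc (ind_mem_Icc J x) (ind_mem_Icc K x)).1)
          (integrable_const _) (Filter.Eventually.of_forall fun x =>
          (mul_mem_Icc (ind_mem_Icc J x) (ind_mem_Icc K x)).2)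
    _ = 1 := by simp

end Column

/-! ### Covariance sums over all pairs of positions. -/

section SecondMoment

variable {t lam m : ℕ} [NeZero lam] {O : Fin (t * (t * lam)) → Fin (m + 1) → Fin t}
  (b : SliceBase t lam m)

omit [NeZero lam] in
theorem card_symbolAt (hO : IsOrthogonalArray 2 lam O) (k : Fin m) (s : Fin t) :
    (Finset.univ.filter fun p => symbolAt O b p k = s).card = t * lam := by
  refine Eq.trans ?_ (hO.card_single (b.2.1 k.castSucc) s)
  refine Finset.card_equiv (rowAt O b) fun p => ?_
  rw [Finset.mem_filter, Finset.mem_filter]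
  simp [symbolAt]

omit [NeZero lam] in
theorem card_symbolAt_pair (hO : IsOrthogonalArray 2 lam O) {k k' : Fin m} (hk : k ≠ k')
    (s s' : Fin t) :
    (Finset.univ.filter fun p => symbolAt O b p k = s ∧ symbolAt O b p k' = s').card = lam := by
  have hne : b.2.1 k.castSucc ≠ b.2.1 k'.castSucc :=
    b.2.1.injective.ne ((Fin.castSucc_injective m).ne hk)
  refine Eq.trans ?_ (hO.card_pair hne s s')
  refine Finset.card_equiv (rowAt O b) fun p => ?_
  rw [Finset.mem_filter, Finset.mem_filter]
  simp [symbolAt]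

omit [NeZero lam] in
theorem coincidences_symbolAt (u : Finset (Fin m)) :
    (coincidences (fun i (k : Fin m) => O i (b.2.1 k.castSucc)) u u.card : ℝ) =
      ∑ p, ∑ q, if ∀ k ∈ u, symbolAt O b p k = symbolAt O b q k then (1 : ℝ) else 0 := by
  rw [coincidences_card, ← Equiv.sum_comp (rowAt O b)]
  refine Finset.sum_congr rfl fun i _ => ?_
  rw [← Equiv.sum_comp (rowAt O b)]
  rfl

/-- Distinct positions have distinct keys, so the error sum over positions is at most the sum over
all keys. -/
theorem sum_abs_colMean_sub_le (ht : 1 < t) (hO : IsOrthogonalArray 2 lam O) (k : Fin m)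
    {J K : Set ℝ} (hJ : J.OrdConnected) (hK : K.OrdConnected) (p : Fin t × Fin (t * lam)) :
    ∑ q, |colMean (keyAt O b k) (ind J) (ind K) p q - mass J * mass K -
      coarseCov (gridAvg t lam (ind J)) (gridAvg t lam (ind K)) *
        agreeFactor (symbolAt O b) p q k| ≤ 6 / t := by
  have hinj := keyAt_injective b hO k
  calc _ ≤ ∑ q, errBound t lam (keyAt O b k p) (keyAt O b k q) :=
        Finset.sum_le_sum fun q _ => abs_colMean_sub_le _ ht hJ hK hinj p q
    _ = ∑ κ ∈ Finset.univ.image (keyAt O b k), errBound t lam (keyAt O b k p) κ :=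
        (Finset.sum_image fun x _ y _ h => hinj h).symm
    _ ≤ ∑ κ, errBound t lam (keyAt O b k p) κ :=
        Finset.sum_le_sum_of_subset_of_nonneg (Finset.subset_univ _)
          fun κ _ _ => errBound_nonneg ht _ _
    _ ≤ _ := sum_errBound_le ht _

/-- The sum over all pairs of positions of the covariances in the columns of `u`. -/
theorem abs_sum_prod_cov_sub_le (ht : 1 < t) (hO : IsOrthogonalArray 2 lam O)
    {J K : Fin m → Set ℝ} (hJ : ∀ k, (J k).OrdConnected) (hK : ∀ k, (K k).OrdConnected)
    {u : Finset (Fin m)} (hu : u.Nonempty) :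
    |∑ p, ∑ q, ∏ k ∈ u, (colMean (keyAt O b k) (ind (J k)) (ind (K k)) p q -
        mass (J k) * mass (K k)) -
      (if 3 ≤ u.card then
        (coincidences (fun i (k : Fin m) => O i (b.2.1 k.castSucc)) u u.card : ℝ) *
          ∏ k ∈ u, indCov (J k) (K k) else 0)| ≤
      (2 * (m : ℝ) ^ 2 + 12 * m + 8) * ((t * lam * t : ℕ) * lam / t) := by
  have ht2 : (2 : ℝ) ≤ t := by exact_mod_cast ht
  have ht0 : (0 : ℝ) < t := by linarith
  have hlam1 : (1 : ℝ) ≤ lam := by exact_mod_cast NeZero.one_le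
  set N : ℝ := ((t * lam * t : ℕ) : ℝ) with hN
  have hN0 : 0 ≤ N := Nat.cast_nonneg _
  have hR : Fintype.card (Fin t × Fin (t * lam)) = t * (t * lam) := by simp
  have hcardN : ((Finset.univ : Finset (Fin t × Fin (t * lam))).card : ℝ) = N := by
    rw [Finset.card_univ, hR, hN]
    push_cast
    ring
  have hum : (u.card : ℝ) ≤ m := by
    exact_mod_cast (Finset.card_le_univ u).trans (by simp)
  set cov : Fin m → ℝ := fun k =>
    coarseCov (gridAvg t lam (ind (J k))) (gridAvg t lam (ind (K k))) with hcov
  set B : Fin t × Fin (t * lam) → Fin t × Fin (t * lam) → Fin m → ℝ := fun p q k =>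
    colMean (keyAt O b k) (ind (J k)) (ind (K k)) p q - mass (J k) * mass (K k) with hB
  set a : Fin t × Fin (t * lam) → Fin t × Fin (t * lam) → Fin m → ℝ := fun p q k =>
    agreeFactor (symbolAt O b) p q k with ha
  have hB1 : ∀ p q k, |B p q k| ≤ 1 := fun p q k =>
    abs_sub_le_one_of_mem_Icc (colMean_mem_Icc _ p q)
      (mul_mem_Icc (mass_mem_Icc _) (mass_mem_Icc _))
  have hcov1 : ∀ k, |cov k| ≤ 1 := fun k => abs_coarseCov_le_one _ _
  have ha1 : ∀ p q k, |cov k * a p q k| ≤ 1 := fun p q k => by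
    rw [abs_mul]
    exact mul_le_one₀ (hcov1 k) (abs_nonneg _) (abs_agreeFactor_le ht p q k)
  have hprodcov : |∏ k ∈ u, cov k| ≤ 1 := by
    rw [Finset.abs_prod]
    exact Finset.prod_le_one (fun _ _ => abs_nonneg _) fun k _ => hcov1 k
  have hNt : N / t ≤ N * lam / t := by
    gcongr
    exact le_mul_of_one_le_right hN0 hlam1
  -- First error: exchange the true covariances for constants times `agreeFactor`, one column at a
  -- time, at cost `6/t` per row and column.
  have hstep1 : |∑ p, ∑ q, ∏ k ∈ u, B p q k -
      (∏ k ∈ u, cov k) * ∑ p, ∑ q, ∏ k ∈ u, a p q k| ≤ 6 * m * (N * lam / t) := by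
    have h1 : ∀ p q, |∏ k ∈ u, B p q k - (∏ k ∈ u, cov k) * ∏ k ∈ u, a p q k| ≤
        ∑ k ∈ u, |B p q k - cov k * a p q k| := fun p q => by
      rw [← Finset.prod_mul_distrib]
      exact abs_prod_sub_prod_le u _ _ (hB1 p q) (ha1 p q)
    calc _ = |∑ p, ∑ q, (∏ k ∈ u, B p q k - (∏ k ∈ u, cov k) * ∏ k ∈ u, a p q k)| := by
          simp only [Finset.sum_sub_distrib, Finset.mul_sum]
      _ ≤ ∑ p, ∑ q, ∑ k ∈ u, |B p q k - cov k * a p q k| := by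
          refine (Finset.abs_sum_le_sum_abs _ _).trans (Finset.sum_le_sum fun p _ => ?_)
          exact (Finset.abs_sum_le_sum_abs _ _).trans (Finset.sum_le_sum fun q _ => h1 p q)
      _ ≤ ∑ _p : Fin t × Fin (t * lam), ∑ _k ∈ u, 6 / (t : ℝ) := by
          refine Finset.sum_le_sum fun p _ => ?_
          rw [Finset.sum_comm]
          exact Finset.sum_le_sum fun k _ => sum_abs_colMean_sub_le b ht hO k (hJ k) (hK k) p
      _ = 6 * u.card * (N / t) := by
          rw [Finset.sum_const, Finset.sum_const, nsmul_eq_mul, nsmul_eq_mul, hcardN]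
          ring
      _ ≤ _ := by gcongr
  have hX : 0 ≤ N * lam / t := by positivity
  by_cases h3 : 3 ≤ u.card
  · rw [if_pos h3]
    set M : ℝ := (coincidences (fun i (k : Fin m) => O i (b.2.1 k.castSucc)) u u.card : ℝ) with hM
    have hMeq := coincidences_symbolAt (O := O) b u
    rw [← hM] at hMeq
    have hM0 : 0 ≤ M := Nat.cast_nonneg _
    have hMle : M ≤ N * lam := by
      rw [hMeq, ← hcardN, ← nsmul_eq_mul, ← Finset.sum_const]
      exact Finset.sum_le_sum fun p _ => sum_agree_all_le
        (fun k k' hk s s' => card_symbolAt_pair b hO hk s s') (by omega) p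
    -- Second error: the correlation sum against the number of coincidences.
    have hstep2 : |∑ p, ∑ q, ∏ k ∈ u, a p q k - M| ≤
        (2 * (m : ℝ) ^ 2 + 4 * m + 8) * (N * lam / t) := by
      rw [hMeq, ← Finset.sum_sub_distrib]
      refine (Finset.abs_sum_le_sum_abs _ _).trans ((Finset.sum_le_sum fun p _ =>
        abs_sum_prod_agreeFactor_sub_le hR (fun k s => card_symbolAt b hO k s)
          (fun k k' hk s s' => card_symbolAt_pair b hO hk s s') ht h3 p).trans (le_of_eq ?_))
      rw [Finset.sum_const, nsmul_eq_mul, hcardN]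
      ring
    -- Third error: the constants themselves against the covariances under the uniform law. It is
    -- multiplied by `M ≤ N * lam`.
    have hstep3 : |∏ k ∈ u, cov k - ∏ k ∈ u, indCov (J k) (K k)| ≤ m * (2 / t) := by
      refine (abs_prod_sub_prod_le u _ _ hcov1 fun k => abs_indCov_le_one _ _).trans
        ((Finset.sum_le_sum fun k _ =>
          abs_coarseCov_sub_indCov_le ht (hJ k) (hK k)).trans ?_)
      rw [Finset.sum_const, nsmul_eq_mul]
      gcongr
    have hdec : ∑ p, ∑ q, ∏ k ∈ u, B p q k - M * ∏ k ∈ u, indCov (J k) (K k) =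
        (∑ p, ∑ q, ∏ k ∈ u, B p q k - (∏ k ∈ u, cov k) * ∑ p, ∑ q, ∏ k ∈ u, a p q k) +
        (∏ k ∈ u, cov k) * (∑ p, ∑ q, ∏ k ∈ u, a p q k - M) +
        M * (∏ k ∈ u, cov k - ∏ k ∈ u, indCov (J k) (K k)) := by ring
    rw [hdec]
    calc _ ≤ 6 * m * (N * lam / t) + (2 * (m : ℝ) ^ 2 + 4 * m + 8) * (N * lam / t) +
          N * lam * (m * (2 / t)) := by
          refine (abs_add_le _ _).trans (add_le_add ((abs_add_le _ _).trans
            (add_le_add hstep1 ?_)) ?_)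
          · rw [abs_mul]
            exact (mul_le_of_le_one_left (abs_nonneg _) hprodcov).trans hstep2
          · rw [abs_mul, abs_of_nonneg hM0]
            exact mul_le_mul hMle hstep3 (abs_nonneg _) (by positivity)
      _ = _ := by ring
  · rw [if_neg h3, sub_zero]
    have hzero : ∑ p, ∑ q, ∏ k ∈ u, a p q k = 0 :=
      Finset.sum_eq_zero fun p _ => sum_prod_agreeFactor_eq_zero hR
        (fun k s => card_symbolAt b hO k s)
        (fun k k' hk s s' => card_symbolAt_pair b hO hk s s') ht hu (by omega) p
    rw [hzero, mul_zero, sub_zero] at hstep1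
    refine hstep1.trans ?_
    gcongr
    nlinarith [sq_nonneg (m : ℝ), (Nat.cast_nonneg m : (0 : ℝ) ≤ m)]

end SecondMoment

/-! ### Second moments of step functions, expanded over subsets of columns. -/

section StepMoments

variable {ι : Type*} [Fintype ι] {m : ℕ}

/-- The mean of a step function under the uniform distribution on the cube. -/
noncomputable def stepMean (c : ι → ℝ) (J : ι → Fin m → Set ℝ) : ℝ := ∑ s, c s * ∏ k, mass (J s k)

/-- The variance of the component of a step function that belongs to the coordinates in `u`. -/
noncomputable def stepVar (c : ι → ℝ) (J : ι → Fin m → Set ℝ) (u : Finset (Fin m)) : ℝ :=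
  ∑ s, ∑ s', c s * c s' * ((∏ k ∈ u, indCov (J s k) (J s' k)) *
    ∏ k ∈ Finset.univ \ u, (mass (J s k) * mass (J s' k)))

variable {t lam : ℕ} [NeZero lam] {O : Fin (t * (t * lam)) → Fin (m + 1) → Fin t}
  (b : SliceBase t lam m) {J : ι → Fin m → Set ℝ}

/-- In each column write the mean of the product as covariance plus product of means and expand. The
empty subset gives the squared mean; at most `2 ^ m` other subsets contribute an error. -/
theorem abs_sum_prod_colMean_sub_le (ht : 1 < t) (hO : IsOrthogonalArray 2 lam O)
    {J K : Fin m → Set ℝ} (hJ : ∀ k, (J k).OrdConnected) (hK : ∀ k, (K k).OrdConnected) :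
    |∑ p, ∑ q, ∏ k, colMean (keyAt O b k) (ind (J k)) (ind (K k)) p q -
        ((t * lam * t : ℕ) : ℝ) ^ 2 * ∏ k, (mass (J k) * mass (K k)) -
      ∑ u ∈ Finset.univ.filter (fun u : Finset (Fin m) => 3 ≤ u.card),
        (coincidences (fun i (k : Fin m) => O i (b.2.1 k.castSucc)) u u.card : ℝ) *
          ((∏ k ∈ u, indCov (J k) (K k)) * ∏ k ∈ Finset.univ \ u, (mass (J k) * mass (K k)))| ≤
      2 ^ m * ((2 * (m : ℝ) ^ 2 + 12 * m + 8) * ((t * lam * t : ℕ) * lam / t)) := by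
  classical
  set N : ℝ := ((t * lam * t : ℕ) : ℝ) with hN
  set E := (2 * (m : ℝ) ^ 2 + 12 * m + 8) * (N * lam / t) with hE
  have hE0 : 0 ≤ E := by positivity
  have hcard : ((Finset.univ : Finset (Fin t × Fin (t * lam))).card : ℝ) = N := by
    rw [Finset.card_univ, Fintype.card_prod, Fintype.card_fin, Fintype.card_fin, hN]
    push_cast
    ring
  set W : Finset (Fin m) → ℝ := fun u => ∑ p, ∑ q, ∏ k ∈ u,
    (colMean (keyAt O b k) (ind (J k)) (ind (K k)) p q - mass (J k) * mass (K k)) with hW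
  set μ : Finset (Fin m) → ℝ := fun u => ∏ k ∈ Finset.univ \ u, (mass (J k) * mass (K k)) with hμ
  set T : Finset (Fin m) → ℝ := fun u => if 3 ≤ u.card then
        (coincidences (fun i (k : Fin m) => O i (b.2.1 k.castSucc)) u u.card : ℝ) *
          ∏ k ∈ u, indCov (J k) (K k) else 0 with hT
  have hexp : ∑ p, ∑ q, ∏ k, colMean (keyAt O b k) (ind (J k)) (ind (K k)) p q =
      ∑ u, W u * μ u := by
    have h1 : ∀ p q, ∏ k, colMean (keyAt O b k) (ind (J k)) (ind (K k)) p q =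
        ∑ u, (∏ k ∈ u, (colMean (keyAt O b k) (ind (J k)) (ind (K k)) p q -
          mass (J k) * mass (K k))) * μ u := by
      intro p q
      rw [← Finset.powerset_univ, ← Finset.prod_add]
      exact Finset.prod_congr rfl fun k _ => by ring
    simp_rw [h1]
    rw [Finset.sum_congr rfl fun p _ => Finset.sum_comm, Finset.sum_comm]
    refine Finset.sum_congr rfl fun u _ => ?_
    simp_rw [hW, Finset.sum_mul]
  have hWempty : W ∅ * μ ∅ = N ^ 2 * ∏ k, (mass (J k) * mass (K k)) := by
    simp only [hW, hμ, Finset.prod_empty, Finset.sdiff_empty, Finset.sum_const, nsmul_eq_mul,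
      hcard]
    ring
  have hTsum : ∑ u ∈ Finset.univ.filter (fun u : Finset (Fin m) => 3 ≤ u.card),
        (coincidences (fun i (k : Fin m) => O i (b.2.1 k.castSucc)) u u.card : ℝ) *
          ((∏ k ∈ u, indCov (J k) (K k)) * μ u) = ∑ u ∈ Finset.univ.erase ∅, T u * μ u := by
    rw [Finset.sum_filter, ← Finset.add_sum_erase _ _ (Finset.mem_univ ∅)]
    rw [if_neg (by simp), zero_add]
    simp only [hT]
    refine Finset.sum_congr rfl fun u _ => ?_
    split_ifs <;> ring
  rw [hexp, hTsum, ← Finset.add_sum_erase _ _ (Finset.mem_univ ∅), hWempty, add_sub_cancel_left,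
    ← Finset.sum_sub_distrib]
  calc _ ≤ ∑ u ∈ (Finset.univ : Finset (Finset (Fin m))).erase ∅, E := by
        refine (Finset.abs_sum_le_sum_abs _ _).trans (Finset.sum_le_sum fun u hu => ?_)
        rw [← sub_mul, abs_mul]
        have hμ1 : |μ u| ≤ 1 := by
          rw [Finset.abs_prod]
          refine Finset.prod_le_one (fun _ _ => abs_nonneg _) fun k _ => ?_
          have := mul_mem_Icc (mass_mem_Icc (J k)) (mass_mem_Icc (K k))
          rw [abs_of_nonneg this.1]
          exact this.2
        exact (mul_le_of_le_one_right (abs_nonneg _) hμ1).trans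
          (abs_sum_prod_cov_sub_le b ht hO hJ hK
            (Finset.nonempty_iff_ne_empty.mpr (Finset.ne_of_mem_erase hu)))
    _ ≤ ∑ _u : Finset (Fin m), E :=
        Finset.sum_le_sum_of_subset_of_nonneg (Finset.erase_subset _ _) fun _ _ _ => hE0
    _ = _ := by simp

theorem abs_sum_colMean_sub_le (ht : 1 < t) (hO : IsOrthogonalArray 2 lam O) (c : ι → ℝ)
    (hJ : ∀ s k, (J s k).OrdConnected) :
    |∑ s, ∑ s', c s * c s' *
        ∑ p, ∑ q, ∏ k, colMean (keyAt O b k) (ind (J s k)) (ind (J s' k)) p q -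
        (((t * lam * t : ℕ) : ℝ) * stepMean c J) ^ 2 -
      ∑ u ∈ Finset.univ.filter (fun u : Finset (Fin m) => 3 ≤ u.card),
        (coincidences (fun i (k : Fin m) => O i (b.2.1 k.castSucc)) u u.card : ℝ) *
          stepVar c J u| ≤
      (∑ s, |c s|) ^ 2 *
        (2 ^ m * ((2 * (m : ℝ) ^ 2 + 12 * m + 8) * ((t * lam * t : ℕ) * lam / t))) := by
  set N : ℝ := ((t * lam * t : ℕ) : ℝ) with hN
  set E := 2 ^ m * ((2 * (m : ℝ) ^ 2 + 12 * m + 8) * (N * lam / t)) with hE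
  have h1 : (N * stepMean c J) ^ 2 =
      ∑ s, ∑ s', c s * c s' * (N ^ 2 * ∏ k, (mass (J s k) * mass (J s' k))) := by
    rw [mul_pow, sq (stepMean c J), stepMean, Finset.sum_mul_sum, Finset.mul_sum]
    refine Finset.sum_congr rfl fun s _ => ?_
    rw [Finset.mul_sum]
    refine Finset.sum_congr rfl fun s' _ => ?_
    rw [Finset.prod_mul_distrib]
    ring
  have h2 : ∑ u ∈ Finset.univ.filter (fun u : Finset (Fin m) => 3 ≤ u.card),
        (coincidences (fun i (k : Fin m) => O i (b.2.1 k.castSucc)) u u.card : ℝ) *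
          stepVar c J u =
      ∑ s, ∑ s', c s * c s' *
        ∑ u ∈ Finset.univ.filter (fun u : Finset (Fin m) => 3 ≤ u.card),
        (coincidences (fun i (k : Fin m) => O i (b.2.1 k.castSucc)) u u.card : ℝ) *
          ((∏ k ∈ u, indCov (J s k) (J s' k)) *
            ∏ k ∈ Finset.univ \ u, (mass (J s k) * mass (J s' k))) := by
    simp_rw [stepVar, Finset.mul_sum]
    rw [Finset.sum_comm]
    refine Finset.sum_congr rfl fun s _ => ?_
    rw [Finset.sum_comm]
    refine Finset.sum_congr rfl fun s' _ => Finset.sum_congr rfl fun u _ => ?_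
    ring
  rw [h1, h2]
  simp only [← Finset.sum_sub_distrib, ← mul_sub]
  calc _ ≤ ∑ s, ∑ s', |c s| * |c s'| * E := by
        refine (Finset.abs_sum_le_sum_abs _ _).trans (Finset.sum_le_sum fun s _ => ?_)
        refine (Finset.abs_sum_le_sum_abs _ _).trans (Finset.sum_le_sum fun s' _ => ?_)
        rw [abs_mul, abs_mul]
        exact mul_le_mul_of_nonneg_left (abs_sum_prod_colMean_sub_le b ht hO (hJ s) (hJ s'))
          (by positivity)
    _ = _ := by
        rw [sq, Finset.sum_mul_sum, Finset.sum_mul]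
        simp_rw [Finset.sum_mul]

end StepMoments

theorem integrable_of_abs_le {α : Type*} [MeasurableSpace α] {μ : Measure α} [IsFiniteMeasure μ]
    {f : α → ℝ} (hf : Measurable f) (C : ℝ) (h : ∀ x, |f x| ≤ C) : Integrable f μ :=
  Integrable.of_bound hf.aestronglyMeasurable C (Filter.Eventually.of_forall h)

/-! ### Moments of the design given the slice base. -/

section DesignMoments

variable {t lam m : ℕ} [NeZero lam] (O : Fin (t * (t * lam)) → Fin (m + 1) → Fin t)
  (b : SliceBase t lam m)

theorem measurable_solhDesign (ω : SolhPerms t lam m) (r : Fin t) (i : Fin (t * lam)) :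
    Measurable fun γ : Fin t → Fin (t * lam) → Fin m → ℝ => solhDesign O (ω, γ) r i := by
  refine measurable_pi_lambda _ fun k => ?_
  unfold solhDesign
  fun_prop

/-- With the slice base held fixed, the permutations of different columns are independent, so the
expectation factors over the columns. -/
theorem expect_integral_pair (φ ψ : Fin m → ℝ → ℝ) (p q : Fin t × Fin (t * lam)) :
    𝔼 x : Fin m → ColPerms t lam, ∫ γ, ∏ k,
        (φ k (solhDesign O ((solhPermsEquiv t lam m).symm (b, x), γ) p.1 p.2 k) *
          ψ k (solhDesign O ((solhPermsEquiv t lam m).symm (b, x), γ) q.1 q.2 k))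
        ∂(jitterLaw t lam m) = ∏ k, colMean (keyAt O b k) (φ k) (ψ k) p q := by
  simp only [solhDesign, fineLevel_eq, Equiv.apply_symm_apply]
  have h : ∀ x : Fin m → ColPerms t lam, _ := fun x => integral_jitterLaw_pair
    (fun p k => (x k).fine p.1 (symbolAt O b p k) (rankAt O b p k)) p q φ ψ
  simp_rw [h]
  exact expect_pi_prod fun k (y : ColPerms t lam) => if p = q then
      gridAvg t lam (fun x => φ k x * ψ k x)
        (y.fine (keyAt O b k p).1 (keyAt O b k p).2.1 (keyAt O b k p).2.2)
    else gridAvg t lam (φ k) (y.fine (keyAt O b k p).1 (keyAt O b k p).2.1 (keyAt O b k p).2.2) *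
      gridAvg t lam (ψ k) (y.fine (keyAt O b k q).1 (keyAt O b k q).2.1 (keyAt O b k q).2.2)

variable {ι : Type*} [Fintype ι] (c : ι → ℝ) {J : ι → Fin m → Set ℝ}

/-- The mean does not depend on the slice base, hence the variance of the conditional mean will not
contribute. It is the pair formula for a position with itself and second function `1`. -/
theorem expect_integral_stepFn (ht : 0 < t) (hJ : ∀ s k, (J s k).OrdConnected)
    (p : Fin t × Fin (t * lam)) :
    𝔼 x : Fin m → ColPerms t lam, ∫ γ,
        stepFn c J (solhDesign O ((solhPermsEquiv t lam m).symm (b, x), γ) p.1 p.2)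
        ∂(jitterLaw t lam m) = stepMean c J := by
  have hN : 0 < t * lam * t := by
    have := Nat.pos_of_neZero lam
    positivity
  have h : ∀ x : Fin m → ColPerms t lam, ∫ γ,
      stepFn c J (solhDesign O ((solhPermsEquiv t lam m).symm (b, x), γ) p.1 p.2)
        ∂(jitterLaw t lam m) = ∑ s, c s * ∫ γ, ∏ k,
        (ind (J s k) (solhDesign O ((solhPermsEquiv t lam m).symm (b, x), γ) p.1 p.2 k) * 1)
        ∂(jitterLaw t lam m) := by
    intro x
    unfold stepFn
    rw [integral_finsetSum _ fun s _ => ?_]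
    · simp_rw [integral_const_mul, mul_one]
    · refine integrable_of_abs_le ?_ |c s| fun γ => ?_
      · exact measurable_const.mul (Finset.measurable_fun_prod _ fun k _ =>
          (measurable_ind (hJ s k)).comp
            ((measurable_pi_apply k).comp (measurable_solhDesign O _ p.1 p.2)))
      · have h := prod_ind_mem_Icc Finset.univ (J s)
          (solhDesign O ((solhPermsEquiv t lam m).symm (b, x), γ) p.1 p.2)
        rw [abs_mul, abs_of_nonneg h.1]
        exact mul_le_of_le_one_right (abs_nonneg _) h.2
  simp_rw [h]
  rw [Finset.expect_sum_comm, stepMean]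
  refine Finset.sum_congr rfl fun s _ => ?_
  rw [← Finset.mul_expect, expect_integral_pair O b (fun k => ind (J s k)) (fun _ _ => 1) p p]
  congr 1
  refine Finset.prod_congr rfl fun k _ => ?_
  rw [colMean_self]
  simp only [mul_one]
  exact expect_gridAvg hN (integrableOn_ind (hJ s k))

theorem expect_integral_sum_stepFn_sq (hJ : ∀ s k, (J s k).OrdConnected) :
    𝔼 x : Fin m → ColPerms t lam, ∫ γ, (∑ p : Fin t × Fin (t * lam),
        stepFn c J (solhDesign O ((solhPermsEquiv t lam m).symm (b, x), γ) p.1 p.2)) ^ 2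
        ∂(jitterLaw t lam m) =
      ∑ s, ∑ s', c s * c s' *
        ∑ p, ∑ q, ∏ k, colMean (keyAt O b k) (ind (J s k)) (ind (J s' k)) p q := by
  have hsq : ∀ z : Fin t × Fin (t * lam) → Fin m → ℝ, (∑ p, stepFn c J (z p)) ^ 2 =
      ∑ y : (ι × ι) × (Fin t × Fin (t * lam)) × (Fin t × Fin (t * lam)),
        c y.1.1 * c y.1.2 *
          ∏ k, (ind (J y.1.1 k) (z y.2.1 k) * ind (J y.1.2 k) (z y.2.2 k)) := by
    intro z
    simp only [stepFn]
    rw [Finset.sum_comm, sq, Finset.sum_mul_sum]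
    simp_rw [Fintype.sum_prod_type (α₁ := ι × ι), Fintype.sum_prod_type (α₁ := ι),
      Fintype.sum_prod_type (α₁ := Fin t × Fin (t * lam)), Finset.sum_mul_sum,
      Finset.prod_mul_distrib]
    refine Finset.sum_congr rfl fun s _ => Finset.sum_congr rfl fun s' _ =>
      Finset.sum_congr rfl fun p _ => Finset.sum_congr rfl fun q _ => ?_
    ring
  have h : ∀ x : Fin m → ColPerms t lam, ∫ γ, (∑ p : Fin t × Fin (t * lam),
        stepFn c J (solhDesign O ((solhPermsEquiv t lam m).symm (b, x), γ) p.1 p.2)) ^ 2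
        ∂(jitterLaw t lam m) =
      ∑ y : (ι × ι) × (Fin t × Fin (t * lam)) × (Fin t × Fin (t * lam)),
        c y.1.1 * c y.1.2 * ∫ γ, ∏ k, (ind (J y.1.1 k)
          (solhDesign O ((solhPermsEquiv t lam m).symm (b, x), γ) y.2.1.1 y.2.1.2 k) *
          ind (J y.1.2 k)
            (solhDesign O ((solhPermsEquiv t lam m).symm (b, x), γ) y.2.2.1 y.2.2.2 k))
        ∂(jitterLaw t lam m) := by
    intro x
    simp_rw [fun γ => hsq fun p => solhDesign O ((solhPermsEquiv t lam m).symm (b, x), γ) p.1 p.2]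
    rw [integral_finsetSum _ fun y _ => ?_]
    · simp_rw [integral_const_mul]
    · refine integrable_of_abs_le ?_ |c y.1.1 * c y.1.2| fun γ => ?_
      · exact measurable_const.mul (Finset.measurable_fun_prod _ fun k _ =>
          ((measurable_ind (hJ _ k)).comp
            ((measurable_pi_apply k).comp (measurable_solhDesign O _ _ _))).mul
          ((measurable_ind (hJ _ k)).comp
            ((measurable_pi_apply k).comp (measurable_solhDesign O _ _ _))))
      · rw [Finset.prod_mul_distrib]
        have h := mul_mem_Icc (prod_ind_mem_Icc Finset.univ (J y.1.1)
          (solhDesign O ((solhPermsEquiv t lam m).symm (b, x), γ) y.2.1.1 y.2.1.2))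
          (prod_ind_mem_Icc Finset.univ (J y.1.2)
          (solhDesign O ((solhPermsEquiv t lam m).symm (b, x), γ) y.2.2.1 y.2.2.2))
        rw [abs_mul, abs_of_nonneg h.1]
        exact mul_le_of_le_one_right (abs_nonneg _) h.2
  simp_rw [h]
  rw [Finset.expect_sum_comm]
  simp_rw [← Finset.mul_expect]
  have h2 : ∀ y : (ι × ι) × (Fin t × Fin (t * lam)) × (Fin t × Fin (t * lam)), _ := fun y =>
    expect_integral_pair O b (fun k => ind (J y.1.1 k)) (fun k => ind (J y.1.2 k)) y.2.1 y.2.2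
  simp_rw [h2]
  simp_rw [Fintype.sum_prod_type (α₁ := ι × ι), Fintype.sum_prod_type (α₁ := ι),
      Fintype.sum_prod_type (α₁ := Fin t × Fin (t * lam)), Finset.mul_sum]

end DesignMoments

/-! ### Conditioning on the column order. -/

section Laws

variable {t lam m : ℕ}

/-- The law of the construction given that the order of the columns belongs to `A`. -/
noncomputable def colLaw (t lam m : ℕ) (A : Finset (Equiv.Perm (Fin (m + 1)))) :
    Measure (SolhSpace t lam m) :=
  (uniformOn {ω : SolhPerms t lam m | ω.col ∈ A}).prod (jitterLaw t lam m)

theorem solhLaw_eq_colLaw : solhLaw t lam m = colLaw t lam m Finset.univ := by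
  simp [solhLaw, colLaw, jitterLaw]

theorem cond_prod_univ {α β : Type*} [MeasurableSpace α] [MeasurableSpace β] (μ : Measure α)
    [SFinite μ] (ν : Measure β) [IsProbabilityMeasure ν] (s : Set α) :
    ProbabilityTheory.cond (μ.prod ν) (s ×ˢ Set.univ) = (ProbabilityTheory.cond μ s).prod ν := by
  rw [ProbabilityTheory.cond, ProbabilityTheory.cond, Measure.prod_smul_left, Measure.prod_prod, measure_univ, mul_one,
    ← Measure.prod_restrict, Measure.restrict_univ]

/-- The event concerns the permutations only, and a uniform law conditioned on a subset is uniform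
there. So (a) is the case of a singleton `A` and (b) that of the full set. -/
theorem cond_solhLaw (κ : Equiv.Perm (Fin (m + 1))) :
    cond (solhLaw t lam m) {ω | ω.1.col = κ} = colLaw t lam m {κ} := by
  have h1 : {ω : SolhSpace t lam m | ω.1.col = κ} =
      {ω : SolhPerms t lam m | ω.col = κ} ×ˢ Set.univ := by
    ext ω
    simp
  have : IsProbabilityMeasure (uniformOn (Set.univ : Set (SolhPerms t lam m))) :=
    isProbabilityMeasure_uniformOn Set.finite_univ Set.univ_nonempty
  rw [h1, solhLaw]
  change ProbabilityTheory.cond ((uniformOn Set.univ).prod (jitterLaw t lam m)) _ = _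
  rw [cond_prod_univ, colLaw, uniformOn, uniformOn,
    cond_cond_eq_cond_inter' MeasurableSet.univ MeasurableSet.of_discrete (by
      exact (Measure.count_apply_lt_top.mpr Set.finite_univ).ne)]
  simp

theorem nonempty_col_mem {A : Finset (Equiv.Perm (Fin (m + 1)))} (hA : A.Nonempty) :
    {ω : SolhPerms t lam m | ω.col ∈ A}.Nonempty := by
  obtain ⟨κ, hκ⟩ := hA
  exact ⟨⟨1, κ, fun _ => 1, fun _ _ _ => 1, fun _ _ => 1⟩, hκ⟩

theorem isProbabilityMeasure_colLaw {A : Finset (Equiv.Perm (Fin (m + 1)))} (hA : A.Nonempty) :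
    IsProbabilityMeasure (colLaw t lam m A) := by
  have : IsProbabilityMeasure (uniformOn {ω : SolhPerms t lam m | ω.col ∈ A}) :=
    isProbabilityMeasure_uniformOn (Set.toFinite _) (nonempty_col_mem hA)
  unfold colLaw
  infer_instance

theorem integral_uniformOn_finset {α : Type*} [Fintype α] [MeasurableSpace α]
    [MeasurableSingletonClass α] (s : Finset α) (h : α → ℝ) :
    ∫ x, h x ∂(uniformOn (s : Set α)) = 𝔼 x ∈ s, h x := by
  classical
  rw [integral_countable (Integrable.of_finite), tsum_fintype, Finset.expect_eq_sum_div_card,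
    Finset.sum_div, ← Finset.sum_subset (Finset.subset_univ s)]
  · refine Finset.sum_congr rfl fun x hx => ?_
    rw [Measure.real, ← Finset.coe_singleton, uniformOn_apply_finset,
      Finset.inter_singleton_of_mem hx]
    simp [div_eq_inv_mul]
  · intro x _ hx
    rw [Measure.real, ← Finset.coe_singleton, uniformOn_apply_finset,
      Finset.inter_singleton_of_notMem hx]
    simp

/-- The slice bases whose column order belongs to `A`. -/
def basesOf (t lam m : ℕ) (A : Finset (Equiv.Perm (Fin (m + 1)))) : Finset (SliceBase t lam m) :=
  Finset.univ.filter fun b => b.2.1 ∈ A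

theorem basesOf_nonempty {A : Finset (Equiv.Perm (Fin (m + 1)))} (hA : A.Nonempty) :
    (basesOf t lam m A).Nonempty := by
  obtain ⟨κ, hκ⟩ := hA
  exact ⟨(1, κ, 1), by simpa [basesOf] using hκ⟩

/-- Restricting the column order constrains only the slice base; the column permutations remain
uniform and independent of it. -/
theorem integral_colLaw {A : Finset (Equiv.Perm (Fin (m + 1)))} (hA : A.Nonempty)
    {F : SolhSpace t lam m → ℝ} (hF : Integrable F (colLaw t lam m A)) :
    ∫ ω, F ω ∂(colLaw t lam m A) =
      𝔼 b ∈ basesOf t lam m A, 𝔼 x : Fin m → ColPerms t lam,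
        ∫ γ, F ((solhPermsEquiv t lam m).symm (b, x), γ) ∂(jitterLaw t lam m) := by
  classical
  have : Fintype (SolhPerms t lam m) := Fintype.ofFinite _
  have : IsProbabilityMeasure (uniformOn {ω : SolhPerms t lam m | ω.col ∈ A}) :=
    isProbabilityMeasure_uniformOn (Set.toFinite _) (nonempty_col_mem hA)
  unfold colLaw at hF ⊢
  rw [integral_prod _ hF]
  have hs : {ω : SolhPerms t lam m | ω.col ∈ A} =
      ((Finset.univ.filter fun ω : SolhPerms t lam m => ω.col ∈ A : Finset _) : Set _) := by
    ext ω
    simp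
  rw [hs, integral_uniformOn_finset, ← Finset.expect_product']
  refine Finset.expect_equiv (solhPermsEquiv t lam m) (fun ω => ?_) fun ω _ => ?_
  · simp [basesOf, solhPermsEquiv]
  · simp

end Laws

/-! ### Concentration of the box frequencies of a batch. -/

section BatchFrequencies

theorem expect_pi_fst {ι α β : Type*} [Fintype ι] [DecidableEq ι] [Fintype α] [Fintype β]
    [Nonempty β] (F : (ι → α) → ℝ) :
    𝔼 x : ι → α × β, F (fun i => (x i).1) = 𝔼 y : ι → α, F y := by
  refine (Fintype.expect_equiv (Equiv.arrowProdEquivProdArrow ι (fun _ => α) fun _ => β) _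
    (fun z => F z.1) fun x => rfl).trans ?_
  rw [← Finset.univ_product_univ, Finset.expect_product]
  refine Finset.expect_congr rfl fun y _ => ?_
  exact Fintype.expect_const (F y)

open Classical in
/-- Indicator of the cells contained in `J`. -/
noncomputable def cellInd (t : ℕ) (J : Set ℝ) (ℓ : Fin t) : ℝ := if cell t ℓ ⊆ J then 1 else 0

theorem cellInd_mem_Icc (t : ℕ) (J : Set ℝ) (ℓ : Fin t) : cellInd t J ℓ ∈ Set.Icc (0 : ℝ) 1 := by
  unfold cellInd
  split_ifs <;> simp

theorem ind_eq_cellInd {t : ℕ} {J : Set ℝ} {ℓ : Fin t} (h : ℓ ∉ cutCells t J) {x : ℝ}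
    (hx : x ∈ cell t ℓ) : ind J x = cellInd t J ℓ := by
  classical
  simp only [cutCells, Finset.mem_filter, Finset.mem_univ, true_and, not_and, not_exists,
    not_not] at h
  by_cases hxJ : x ∈ J
  · rw [ind, Set.indicator_of_mem hxJ, cellInd, 
      if_pos (show cell t ℓ ⊆ J from h ⟨x, hx, hxJ⟩)]
  · rw [ind, Set.indicator_of_notMem hxJ, cellInd, if_neg fun hc => hxJ (hc hx)]

theorem abs_mean_cellInd_sub_mass_le {t : ℕ} (ht : 0 < t) {J : Set ℝ} (hJ : J.OrdConnected) :
    |(∑ ℓ, cellInd t J ℓ) / t - mass J| ≤ 2 / t := by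
  -- The mass is independent of the refinement of the cells, so the coarsest grid, with `lam = 1`,
  -- suffices.
  have hmass : mass J = 𝔼 ℓ, cellAvg (gridAvg t 1 (ind J)) ℓ := by
    rw [expect_cellAvg, expect_gridAvg (by positivity) (integrableOn_ind hJ)]
    rfl
  have h1 : (∑ ℓ, cellInd t J ℓ) / t = 𝔼 ℓ, cellInd t J ℓ := by
    rw [Fintype.expect_eq_sum_div_card, Fintype.card_fin]
  rw [hmass, h1, ← Finset.expect_sub_distrib]
  refine abs_expect_le_of_card_le (card_cutCells_le t hJ) (fun ℓ hℓ => ?_) fun ℓ =>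
    abs_sub_le_one_of_mem_Icc (cellInd_mem_Icc t J ℓ) (cellAvg_ind_mem_Icc J ℓ)
  rw [cellAvg_of_cell fun x hx => ind_eq_cellInd hℓ hx, sub_self]

variable {t lam m : ℕ} [NeZero lam]

/-- The fraction of the points of batch `r` that lie in the box with sides `J`. -/
noncomputable def boxFreq (O : Fin (t * (t * lam)) → Fin (m + 1) → Fin t) (J : Fin m → Set ℝ)
    (r : Fin t) (ω : SolhSpace t lam m) : ℝ :=
  ((t * lam : ℕ) : ℝ)⁻¹ * ∑ i, ∏ k, ind (J k) (solhDesign O ω r i k)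

/-- The fraction of the points of batch `r` whose cells are contained in the box. -/
noncomputable def cellFreq (O : Fin (t * (t * lam)) → Fin (m + 1) → Fin t) (J : Fin m → Set ℝ)
    (r : Fin t) (ω : SolhPerms t lam m) : ℝ :=
  ((t * lam : ℕ) : ℝ)⁻¹ * ∑ i, ∏ k, cellInd t (J k) (sliceSymbol O ω r i k)

variable {O : Fin (t * (t * lam)) → Fin (m + 1) → Fin t}

theorem solhDesign_mem_cell (ω : SolhSpace t lam m) (hγ : ∀ r i k, ω.2 r i k ∈ Set.Ico (0 : ℝ) 1)
    (r : Fin t) (i : Fin (t * lam)) (k : Fin m) :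
    solhDesign O ω r i k ∈ cell t (sliceSymbol O ω.1 r i k) := by
  exact grid_mem_cell _ _ _ (hγ r i k)

theorem solhDesign_mem_Ioc (ω : SolhSpace t lam m) (hγ : ∀ r i k, ω.2 r i k ∈ Set.Ico (0 : ℝ) 1)
    (r : Fin t) (i : Fin (t * lam)) (k : Fin m) :
    solhDesign O ω r i k ∈ Set.Ioc (0 : ℝ) 1 :=
  grid_mem_Ioc _ (hγ r i k)

omit [NeZero lam] in
theorem sliceSymbol_eq (ω : SolhPerms t lam m) (r : Fin t) (i : Fin (t * lam)) (k : Fin m) :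
    sliceSymbol O ω r i k = ((solhPermsEquiv t lam m ω).2 k).1
      (symbolAt O (solhPermsEquiv t lam m ω).1 (r, i) k) := rfl

omit [NeZero lam] in
theorem card_sliceSymbol_eq (hO : IsOrthogonalArray 2 lam O) (ω : SolhPerms t lam m) (r : Fin t)
    (k : Fin m) (s : Fin t) :
    (Finset.univ.filter fun i => sliceSymbol O ω r i k = s).card = lam := by
  refine Eq.trans ?_ (card_symbolAt_eq (solhPermsEquiv t lam m ω).1 hO r k
    (((solhPermsEquiv t lam m ω).2 k).1.symm s))
  congr 1
  ext i
  rw [Finset.mem_filter, Finset.mem_filter, sliceSymbol_eq, Equiv.eq_symm_apply]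

/-- A point contributes differently only if one of its coordinates falls in a cut cell. Each column
has at most two cut symbols, each occurring `lam` times among the `t * lam` points. -/
theorem abs_boxFreq_sub_cellFreq_le (ht : 0 < t) (hO : IsOrthogonalArray 2 lam O)
    {J : Fin m → Set ℝ} (hJ : ∀ k, (J k).OrdConnected) (r : Fin t) (ω : SolhSpace t lam m)
    (hγ : ∀ r i k, ω.2 r i k ∈ Set.Ico (0 : ℝ) 1) :
    |boxFreq O J r ω - cellFreq O J r ω.1| ≤ 2 * m / t := by
  classical
  have hlam : (0 : ℝ) < lam := by exact_mod_cast Nat.pos_of_neZero lam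
  have ht' : (0 : ℝ) < t := by exact_mod_cast ht
  have h1 : ∀ i, |∏ k, ind (J k) (solhDesign O ω r i k) -
      ∏ k, cellInd t (J k) (sliceSymbol O ω.1 r i k)| ≤
      ∑ k, if sliceSymbol O ω.1 r i k ∈ cutCells t (J k) then (1 : ℝ) else 0 := by
    intro i
    refine (abs_prod_sub_prod_le Finset.univ _ _ (fun k => ?_) fun k => ?_).trans
      (Finset.sum_le_sum fun k _ => ?_)
    · rw [abs_of_nonneg (ind_mem_Icc _ _).1]
      exact (ind_mem_Icc _ _).2
    · rw [abs_of_nonneg (cellInd_mem_Icc _ _ _).1]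
      exact (cellInd_mem_Icc _ _ _).2
    · split_ifs with h
      · exact abs_sub_le_one_of_mem_Icc (ind_mem_Icc _ _) (cellInd_mem_Icc _ _ _)
      · rw [ind_eq_cellInd h (solhDesign_mem_cell ω hγ r i k), sub_self, abs_zero]
  have h2 : ∀ k, ∑ i, (if sliceSymbol O ω.1 r i k ∈ cutCells t (J k) then (1 : ℝ) else 0) ≤
      2 * lam := by
    intro k
    have hmaps : ∀ i ∈ (Finset.univ.filter fun i => sliceSymbol O ω.1 r i k ∈ cutCells t (J k)),
        sliceSymbol O ω.1 r i k ∈ cutCells t (J k) := fun i hi => (Finset.mem_filter.mp hi).2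
    rw [Finset.sum_boole, Finset.card_eq_sum_card_fiberwise hmaps]
    have h3 : ∀ s ∈ cutCells t (J k), ((Finset.univ.filter fun i =>
        sliceSymbol O ω.1 r i k ∈ cutCells t (J k)).filter
          fun i => sliceSymbol O ω.1 r i k = s).card ≤ lam := by
      intro s _
      refine (Finset.card_le_card (Finset.filter_subset_filter _ (Finset.subset_univ _))).trans
        (card_sliceSymbol_eq hO ω.1 r k s).le
    have h4 := (Finset.sum_le_sum h3).trans_eq (Finset.sum_const lam)
    have h5 := h4.trans (Nat.mul_le_mul_right lam (card_cutCells_le t (hJ k)))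
    exact_mod_cast h5
  unfold boxFreq cellFreq
  rw [← mul_sub, ← Finset.sum_sub_distrib, abs_mul, abs_of_nonneg (by positivity)]
  calc _ ≤ ((t * lam : ℕ) : ℝ)⁻¹ * ∑ i, ∑ k,
        (if sliceSymbol O ω.1 r i k ∈ cutCells t (J k) then (1 : ℝ) else 0) := by
        gcongr
        exact (Finset.abs_sum_le_sum_abs _ _).trans (Finset.sum_le_sum fun i _ => h1 i)
    _ ≤ ((t * lam : ℕ) : ℝ)⁻¹ * ∑ _k : Fin m, 2 * (lam : ℝ) := by
        rw [Finset.sum_comm]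
        gcongr with k
        exact h2 k
    _ = _ := by
        rw [Finset.sum_const, Finset.card_univ, Fintype.card_fin, nsmul_eq_mul]
        push_cast
        field_simp

/-- Exponential tail bound for the fraction of cells of a batch contained in a box. -/
theorem expect_tail_cellFreq_le (ht : 0 < t) (hO : IsOrthogonalArray 2 lam O)
    (J : Fin m → Set ℝ) (r : Fin t) (b : SliceBase t lam m) {δ : ℝ} (hδ : 0 < δ) :
    𝔼 x : Fin m → ColPerms t lam, (if m * δ <
        |cellFreq O J r ((solhPermsEquiv t lam m).symm (b, x)) -
          ∏ k, ((∑ ℓ, cellInd t (J k) ℓ) / t)| then (1 : ℝ) else 0) ≤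
      m * (2 * Real.exp (-(t * δ ^ 2 / 2))) := by
  have h := expect_tail_prod_le ht (Nat.pos_of_neZero lam) (by simp)
    (fun i k => symbolAt O b (r, i) k) (fun k s => card_symbolAt_eq b hO r k s)
    (fun k => cellInd t (J k)) (fun k s => cellInd_mem_Icc t (J k) s) hδ Finset.univ
  rw [Finset.card_univ, Fintype.card_fin] at h
  refine le_trans (le_of_eq ?_) h
  -- The coarse frequency involves only the symbol permutations, so the lower layers are averaged
  -- out.
  refine Eq.trans ?_ (expect_pi_fst (β := (Fin t × Fin t → Equiv.Perm (Fin lam)) ×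
    (Fin (t * lam) → Equiv.Perm (Fin t))) _)
  refine Finset.expect_congr rfl fun x _ => ?_
  simp only [cellFreq, sliceSymbol_eq, Equiv.apply_symm_apply]

end BatchFrequencies

/-! ### ANOVA components of step functions. -/

section Anova

variable {m : ℕ}

instance (m : ℕ) : IsProbabilityMeasure (uniformCube m) := by
  unfold uniformCube
  infer_instance

theorem ae_uniformCube_mem_Ioc : ∀ᵐ w ∂(uniformCube m), ∀ k, w k ∈ Set.Ioc (0 : ℝ) 1 := by
  rw [ae_all_iff]
  intro k
  exact (Measure.tendsto_eval_ae_ae (μ := fun _ : Fin m => volume.restrict (Set.Ioc (0 : ℝ) 1))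
    (i := k)).eventually (ae_restrict_mem measurableSet_Ioc)

theorem integral_uniformCube_prod (u : Finset (Fin m)) (h : Fin m → ℝ → ℝ) :
    ∫ w, ∏ k ∈ u, h k (w k) ∂(uniformCube m) = ∏ k ∈ u, ∫ x in Set.Ioc (0 : ℝ) 1, h k x := by
  have h1 := integral_fintype_prod_eq_prod (μ := fun _ : Fin m => volume.restrict (Set.Ioc (0 : ℝ) 1))
    (fun k (x : ℝ) => if k ∈ u then h k x else 1)
  have h2 : ∀ k, ∫ x in Set.Ioc (0 : ℝ) 1, (if k ∈ u then h k x else 1) =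
      if k ∈ u then ∫ x in Set.Ioc (0 : ℝ) 1, h k x else 1 := by
    intro k
    split_ifs <;> simp
  simp_rw [h2, Finset.prod_ite_mem, Finset.univ_inter] at h1
  exact h1

variable {ι : Type*} [Fintype ι] (c : ι → ℝ) (J : ι → Fin m → Set ℝ)

/-- The ANOVA component of `stepFn c J` that belongs to `u`. -/
noncomputable def centeredFn (u : Finset (Fin m)) (z : Fin m → ℝ) : ℝ :=
  ∑ s, c s * ((∏ k ∈ u, (ind (J s k) (z k) - mass (J s k))) * ∏ k ∈ Finset.univ \ u, mass (J s k))

/-- Expansion of each indicator as its centred version plus its mass; the right-hand side is the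
projection of the step function onto the coordinates in `u`. -/
theorem sum_powerset_centeredFn (u : Finset (Fin m)) (z : Fin m → ℝ) :
    ∑ v ∈ u.powerset, centeredFn c J v z =
      ∑ s, c s * ((∏ k ∈ u, ind (J s k) (z k)) * ∏ k ∈ Finset.univ \ u, mass (J s k)) := by
  unfold centeredFn
  rw [Finset.sum_comm]
  refine Finset.sum_congr rfl fun s _ => ?_
  rw [← Finset.mul_sum]
  congr 1
  have h1 := Finset.prod_add (fun k => ind (J s k) (z k) - mass (J s k)) (fun k => mass (J s k)) u
  simp only [sub_add_cancel] at h1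
  rw [h1, Finset.sum_mul]
  refine Finset.sum_congr rfl fun v hv => ?_
  rw [Finset.mem_powerset] at hv
  rw [mul_assoc, ← Finset.prod_union (Finset.disjoint_sdiff.mono_left Finset.sdiff_subset)]
  congr 2
  ext k
  simp only [Finset.mem_sdiff, Finset.mem_univ, true_and, Finset.mem_union]
  have := @hv k
  tauto

variable {J}

omit [Fintype ι] in
theorem integrable_prod_ind (hJ : ∀ s k, (J s k).OrdConnected) (s : ι) (u : Finset (Fin m))
    (z : Fin m → ℝ) :
    Integrable (fun w => ∏ k, ind (J s k) (u.piecewise z w k)) (uniformCube m) := by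
  refine integrable_of_abs_le (C := 1) ?_ fun w => ?_
  · refine Finset.measurable_fun_prod _ fun k _ => (measurable_ind (hJ s k)).comp ?_
    by_cases hk : k ∈ u
    · simp only [Finset.piecewise_eq_of_mem _ _ _ hk]
      exact measurable_const
    · simp only [Finset.piecewise_eq_of_notMem _ _ _ hk]
      exact measurable_pi_apply k
  · have h := prod_ind_mem_Icc Finset.univ (J s) (u.piecewise z w)
    rw [abs_of_nonneg h.1]
    exact h.2

theorem integral_stepFn_piecewise (hJ : ∀ s k, (J s k).OrdConnected) (u : Finset (Fin m))
    (z : Fin m → ℝ) :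
    ∫ w, stepFn c J (u.piecewise z w) ∂(uniformCube m) =
      ∑ s, c s * ((∏ k ∈ u, ind (J s k) (z k)) * ∏ k ∈ Finset.univ \ u, mass (J s k)) := by
  unfold stepFn
  rw [integral_finsetSum _ fun s _ => (integrable_prod_ind hJ s u z).const_mul (c s)]
  refine Finset.sum_congr rfl fun s _ => ?_
  rw [integral_const_mul]
  congr 1
  have h1 : ∀ w : Fin m → ℝ, ∏ k, ind (J s k) (u.piecewise z w k) =
      (∏ k ∈ u, ind (J s k) (z k)) * ∏ k ∈ Finset.univ \ u, ind (J s k) (w k) := by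
    intro w
    rw [← Finset.prod_sdiff (Finset.subset_univ u), mul_comm]
    congr 1
    · exact Finset.prod_congr rfl fun k hk => by rw [Finset.piecewise_eq_of_mem _ _ _ hk]
    · exact Finset.prod_congr rfl fun k hk => by
        rw [Finset.piecewise_eq_of_notMem _ _ _ (Finset.mem_sdiff.mp hk).2]
  simp_rw [h1]
  rw [integral_const_mul, integral_uniformCube_prod (Finset.univ \ u) fun k => ind (J s k)]
  rfl

theorem centeredFn_piecewise {u v : Finset (Fin m)} (hvu : v ⊆ u) (z w : Fin m → ℝ) :
    centeredFn c J v (u.piecewise z w) = centeredFn c J v z := by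
  unfold centeredFn
  refine Finset.sum_congr rfl fun s _ => ?_
  congr 2
  exact Finset.prod_congr rfl fun k hk => by rw [Finset.piecewise_eq_of_mem _ _ _ (hvu hk)]

/-- The projection onto `u` is the sum of the centred terms over all `v ⊆ u`; by induction the
proper subsets cancel. Everything is confined to the cube because `f` is known only there. -/
theorem anova_eq_centeredFn (hJ : ∀ s k, (J s k).OrdConnected) {f : (Fin m → ℝ) → ℝ}
    (hf : ∀ z, (∀ k, z k ∈ Set.Ioc (0 : ℝ) 1) → f z = stepFn c J z) (u : Finset (Fin m)) :
    ∀ z, (∀ k, z k ∈ Set.Ioc (0 : ℝ) 1) → anova f u z = centeredFn c J u z := by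
  induction u using Finset.strongInduction with
  | H u ih =>
    intro z hz
    have hmem : ∀ w : Fin m → ℝ, (∀ k, w k ∈ Set.Ioc (0 : ℝ) 1) →
        ∀ k, u.piecewise z w k ∈ Set.Ioc (0 : ℝ) 1 := fun w hw k => by
      by_cases hk : k ∈ u
      · rw [Finset.piecewise_eq_of_mem _ _ _ hk]
        exact hz k
      · rw [Finset.piecewise_eq_of_notMem _ _ _ hk]
        exact hw k
    have h1 : anova f u z = ∫ w, (stepFn c J (u.piecewise z w) -
        ∑ v ∈ u.ssubsets, centeredFn c J v z) ∂(uniformCube m) := by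
      rw [anova]
      refine integral_congr_ae ?_
      filter_upwards [ae_uniformCube_mem_Ioc] with w hw
      rw [hf _ (hmem w hw), ← Finset.sum_attach u.ssubsets fun v => centeredFn c J v z]
      congr 1
      refine Finset.sum_congr rfl fun v _ => ?_
      have hv := Finset.mem_ssubsets.mp v.2
      rw [ih v.1 hv _ (hmem w hw), centeredFn_piecewise c hv.subset]
    have hint : Integrable (fun w => stepFn c J (u.piecewise z w)) (uniformCube m) := by
      unfold stepFn
      exact integrable_finsetSum _ fun s _ => (integrable_prod_ind hJ s u z).const_mul (c s)
    rw [h1, integral_sub hint (integrable_const _), integral_stepFn_piecewise c hJ,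
      ← sum_powerset_centeredFn, integral_const]
    have h2 : u.ssubsets = u.powerset.erase u := rfl
    rw [h2, ← Finset.add_sum_erase _ _ (Finset.mem_powerset_self u)]
    simp

theorem measurable_centeredFn (hJ : ∀ s k, (J s k).OrdConnected) (u : Finset (Fin m)) :
    Measurable (centeredFn c J u) :=
  Finset.measurable_fun_sum _ fun s _ => measurable_const.mul ((Finset.measurable_fun_prod _
    fun k _ => ((measurable_ind (hJ s k)).comp (measurable_pi_apply k)).sub
      measurable_const).mul measurable_const)

omit [Fintype ι] in
theorem integral_ind_sub_mass (s : ι) (k : Fin m) (hJ : ∀ s k, (J s k).OrdConnected) :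
    ∫ x in Set.Ioc (0 : ℝ) 1, (ind (J s k) x - mass (J s k)) = 0 := by
  rw [integral_sub (integrableOn_ind (hJ s k)) (integrable_const _)]
  simp [mass]

omit [Fintype ι] in
theorem integral_ind_sub_mass_mul (s s' : ι) (k : Fin m) (hJ : ∀ s k, (J s k).OrdConnected) :
    ∫ x in Set.Ioc (0 : ℝ) 1, (ind (J s k) x - mass (J s k)) * (ind (J s' k) x - mass (J s' k)) =
      indCov (J s k) (J s' k) := by
  have h0 : ∀ x, (ind (J s k) x - mass (J s k)) * (ind (J s' k) x - mass (J s' k)) =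
      ind (J s k) x * ind (J s' k) x - mass (J s' k) * ind (J s k) x -
        mass (J s k) * (ind (J s' k) x - mass (J s' k)) := fun x => by ring
  simp_rw [h0]
  have i1 : Integrable (fun x => ind (J s k) x * ind (J s' k) x)
      (volume.restrict (Set.Ioc (0 : ℝ) 1)) := integrableOn_ind_mul (hJ s k) (hJ s' k)
  have i2 : Integrable (fun x => mass (J s' k) * ind (J s k) x)
      (volume.restrict (Set.Ioc (0 : ℝ) 1)) := (integrableOn_ind (hJ s k)).const_mul _
  have i3 : Integrable (fun x => mass (J s k) * (ind (J s' k) x - mass (J s' k)))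
      (volume.restrict (Set.Ioc (0 : ℝ) 1)) :=
    (Integrable.sub (integrableOn_ind (hJ s' k)) (integrable_const _)).const_mul _
  have i4 : Integrable (fun x => ind (J s k) x * ind (J s' k) x - mass (J s' k) * ind (J s k) x)
      (volume.restrict (Set.Ioc (0 : ℝ) 1)) := i1.sub i2
  rw [integral_sub i4 i3, integral_sub i1 i2, integral_const_mul, integral_const_mul, integral_ind_sub_mass s' k hJ]
  simp only [indCov, mass]
  ring

omit [Fintype ι] in
theorem abs_prod_ind_sub_mass_le (s : ι) (u : Finset (Fin m)) (z : Fin m → ℝ) :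
    |∏ k ∈ u, (ind (J s k) (z k) - mass (J s k))| ≤ 1 := by
  rw [Finset.abs_prod]
  exact Finset.prod_le_one (fun _ _ => abs_nonneg _) fun k _ =>
    abs_sub_le_one_of_mem_Icc (ind_mem_Icc _ _) (mass_mem_Icc _)

omit [Fintype ι] in
theorem measurable_prod_ind_sub_mass (hJ : ∀ s k, (J s k).OrdConnected) (s : ι)
    (u : Finset (Fin m)) :
    Measurable fun z : Fin m → ℝ => ∏ k ∈ u, (ind (J s k) (z k) - mass (J s k)) :=
  Finset.measurable_fun_prod _ fun k _ => ((measurable_ind (hJ s k)).comp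
    (measurable_pi_apply k)).sub measurable_const

theorem integral_centeredFn (hJ : ∀ s k, (J s k).OrdConnected) {u : Finset (Fin m)}
    (hu : u.Nonempty) : ∫ z, centeredFn c J u z ∂(uniformCube m) = 0 := by
  unfold centeredFn
  rw [integral_finsetSum _ fun s _ => ((integrable_of_abs_le (measurable_prod_ind_sub_mass hJ s u) 1
    (abs_prod_ind_sub_mass_le s u)).mul_const _).const_mul (c s)]
  refine Finset.sum_eq_zero fun s _ => ?_
  obtain ⟨k, hk⟩ := hu
  rw [integral_const_mul, integral_mul_const,
    integral_uniformCube_prod u fun k x => ind (J s k) x - mass (J s k),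
    Finset.prod_eq_zero hk (integral_ind_sub_mass s k hJ)]
  ring

theorem integral_centeredFn_sq (hJ : ∀ s k, (J s k).OrdConnected) (u : Finset (Fin m)) :
    ∫ z, centeredFn c J u z ^ 2 ∂(uniformCube m) = stepVar c J u := by
  have h0 : ∀ z, centeredFn c J u z ^ 2 = ∑ s, ∑ s', c s * c s' *
      ((∏ k ∈ u, (ind (J s k) (z k) - mass (J s k)) * (ind (J s' k) (z k) - mass (J s' k))) *
        ∏ k ∈ Finset.univ \ u, mass (J s k) * mass (J s' k)) := by
    intro z
    rw [centeredFn, sq, Finset.sum_mul_sum]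
    refine Finset.sum_congr rfl fun s _ => Finset.sum_congr rfl fun s' _ => ?_
    rw [Finset.prod_mul_distrib, Finset.prod_mul_distrib]
    ring
  have hint : ∀ s s', Integrable (fun z => c s * c s' *
      ((∏ k ∈ u, (ind (J s k) (z k) - mass (J s k)) * (ind (J s' k) (z k) - mass (J s' k))) *
        ∏ k ∈ Finset.univ \ u, mass (J s k) * mass (J s' k))) (uniformCube m) := by
    intro s s'
    refine (Integrable.mul_const ?_ _).const_mul _
    simp_rw [Finset.prod_mul_distrib]
    refine integrable_of_abs_le ((measurable_prod_ind_sub_mass hJ s u).mul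
      (measurable_prod_ind_sub_mass hJ s' u)) 1 fun z => ?_
    rw [abs_mul]
    exact mul_le_one₀ (abs_prod_ind_sub_mass_le s u z) (abs_nonneg _)
      (abs_prod_ind_sub_mass_le s' u z)
  simp_rw [h0]
  rw [integral_finsetSum _ fun s _ => integrable_finsetSum _ fun s' _ => hint s s', stepVar]
  refine Finset.sum_congr rfl fun s _ => ?_
  rw [integral_finsetSum _ fun s' _ => hint s s']
  refine Finset.sum_congr rfl fun s' _ => ?_
  rw [integral_const_mul, integral_mul_const, integral_uniformCube_prod u fun k x =>
    (ind (J s k) x - mass (J s k)) * (ind (J s' k) x - mass (J s' k))]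
  simp_rw [integral_ind_sub_mass_mul _ _ _ hJ]

/-- The variance of an ANOVA component of a linear combination of indicators of boxes. -/
theorem variance_anova (hJ : ∀ s k, (J s k).OrdConnected) {f : (Fin m → ℝ) → ℝ}
    (hf : ∀ z, (∀ k, z k ∈ Set.Ioc (0 : ℝ) 1) → f z = stepFn c J z) {u : Finset (Fin m)}
    (hu : u.Nonempty) : variance (anova f u) (uniformCube m) = stepVar c J u := by
  have h : anova f u =ᵐ[uniformCube m] centeredFn c J u := by
    filter_upwards [ae_uniformCube_mem_Ioc] with z hz
    exact anova_eq_centeredFn c hJ hf u z hz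
  rw [variance_congr h, variance_of_integral_eq_zero (measurable_centeredFn c hJ u).aemeasurable
    (integral_centeredFn c hJ hu), integral_centeredFn_sq c hJ]

end Anova

/-! ### Scenarios as boxes of the cube. -/

section Scenarios

variable {m : ℕ} {ν : Fin m → Measure ℝ}

/-- The support of the product of the measures `ν k`. -/
noncomputable def scenarios (hν : ∀ k, (ν k).support.Finite) : Finset (Fin m → ℝ) :=
  Fintype.piFinset fun k => (hν k).toFinset

/-- The box of the points of the cube that the quantile transform maps to the scenario `s`. -/
noncomputable def scenarioBox (hν : ∀ k, (ν k).support.Finite) (s : scenarios hν) (k : Fin m) :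
    Set ℝ := quantileCell (ν k) (s.1 k)

variable (hν : ∀ k, (ν k).support.Finite)

theorem mem_scenarios {ξ : Fin m → ℝ} : ξ ∈ scenarios hν ↔ ∀ k, ξ k ∈ (ν k).support := by
  simp [scenarios, Fintype.mem_piFinset]

variable [∀ k, IsProbabilityMeasure (ν k)]

theorem ordConnected_scenarioBox (s : scenarios hν) (k : Fin m) :
    (scenarioBox hν s k).OrdConnected := ordConnected_quantileCell (hν k) (s.1 k)

theorem quantileMap_mem_scenarios {z : Fin m → ℝ} (hz : ∀ k, z k ∈ Set.Ioc (0 : ℝ) 1) :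
    quantileMap ν z ∈ scenarios hν :=
  (mem_scenarios hν).mpr fun k => (quantileFn_mem (hν k) (hz k)).1

omit [∀ k, IsProbabilityMeasure (ν k)] in
theorem prod_ind_scenarioBox (s : scenarios hν) {z : Fin m → ℝ}
    (hz : ∀ k, z k ∈ Set.Ioc (0 : ℝ) 1) :
    ∏ k, ind (scenarioBox hν s k) (z k) = if quantileMap ν z = s.1 then 1 else 0 := by
  classical
  have h1 : ∀ k, ind (scenarioBox hν s k) (z k) = if quantileMap ν z k = s.1 k then 1 else 0 := by
    intro k
    by_cases h : quantileMap ν z k = s.1 k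
    · rw [if_pos h]
      exact Set.indicator_of_mem (show z k ∈ quantileCell (ν k) (s.1 k) from ⟨hz k, h⟩) _
    · rw [if_neg h]
      exact Set.indicator_of_notMem (fun hc : z k ∈ quantileCell (ν k) (s.1 k) => h hc.2) _
  simp_rw [h1, Finset.prod_boole, funext_iff]
  simp

/-- The scenario boxes partition the cube, so exactly one summand survives. -/
theorem comp_quantileMap_eq_stepFn (F : (Fin m → ℝ) → ℝ) {z : Fin m → ℝ}
    (hz : ∀ k, z k ∈ Set.Ioc (0 : ℝ) 1) :
    F (quantileMap ν z) = stepFn (fun s : scenarios hν => F s) (scenarioBox hν) z := by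
  unfold stepFn
  simp_rw [prod_ind_scenarioBox hν _ hz]
  rw [Finset.sum_eq_single (⟨quantileMap ν z, quantileMap_mem_scenarios hν hz⟩ : scenarios hν)]
  · simp
  · intro s _ hs
    rw [if_neg fun h => hs (Subtype.ext h.symm), mul_zero]
  · simp

theorem mass_scenarioBox (s : scenarios hν) (k : Fin m) :
    mass (scenarioBox hν s k) = (ν k).real {s.1 k} := by
  have hm : MeasurableSet (quantileCell (ν k) (s.1 k)) :=
    (ordConnected_quantileCell (hν k) (s.1 k)).measurableSet
  unfold mass ind scenarioBox
  rw [integral_indicator hm, Measure.restrict_restrict hm,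
    Set.inter_eq_left.mpr (quantileCell_subset _ _), setIntegral_const, smul_eq_mul, mul_one,
    Measure.real, volume_quantileCell (hν k), Measure.real]

theorem integral_pi_eq_sum (F : (Fin m → ℝ) → ℝ) :
    ∫ ξ, F ξ ∂(Measure.pi ν) =
      ∑ s : scenarios hν, (∏ k, mass (scenarioBox hν s k)) * F s := by
  have h1 : ∀ᵐ ξ ∂(Measure.pi ν), ξ ∈ (scenarios hν : Set (Fin m → ℝ)) := by
    have h2 : ∀ᵐ ξ ∂(Measure.pi ν), ∀ k, ξ k ∈ (ν k).support := by
      rw [ae_all_iff]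
      intro k
      exact (Measure.tendsto_eval_ae_ae (μ := ν) (i := k)).eventually Measure.support_mem_ae
    filter_upwards [h2] with ξ hξ
    exact (mem_scenarios hν).mpr hξ
  rw [← Measure.restrict_eq_self_of_ae_mem h1, setIntegral_finset _ IntegrableOn.finset,
    ← Finset.sum_coe_sort]
  refine Finset.sum_congr rfl fun s _ => ?_
  rw [Measure.real, Measure.pi_singleton, ENNReal.toReal_prod, smul_eq_mul]
  congr 1
  exact Finset.prod_congr rfl fun k _ => (mass_scenarioBox hν s k).symm

theorem uniformCube_pi_scenarioBox_pos (s : scenarios hν) :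
    0 < uniformCube m (Set.univ.pi (scenarioBox hν s)) := by
  unfold uniformCube
  rw [Measure.pi_pi, pos_iff_ne_zero, Finset.prod_ne_zero_iff]
  intro k _
  rw [scenarioBox, Measure.restrict_apply (ordConnected_quantileCell (hν k) (s.1 k)).measurableSet,
    Set.inter_eq_left.mpr (quantileCell_subset _ _), volume_quantileCell (hν k)]
  exact (measure_singleton_pos_of_mem_support (hν k) ((mem_scenarios hν).mp s.2 k)).ne'

namespace TwoStageLP

variable {p e a b : ℕ} (S : TwoStageLP m p e a b)

/-- Every scenario box has positive measure, so an infinite cost in one scenario would make the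
second moment infinite. -/
theorem costE_ne_top_ne_bot {x : Fin p → ℝ}
    (hG : ∫⁻ z, (S.costE x (quantileMap ν z)).abs ^ 2 ∂(uniformCube m) < ⊤) (s : scenarios hν) :
    S.costE x s ≠ ⊤ ∧ S.costE x s ≠ ⊥ := by
  have hm : MeasurableSet (Set.univ.pi (scenarioBox hν s)) :=
    MeasurableSet.univ_pi fun k => (ordConnected_scenarioBox hν s k).measurableSet
  have h1 : ∫⁻ z in Set.univ.pi (scenarioBox hν s), (S.costE x (quantileMap ν z)).abs ^ 2
      ∂(uniformCube m) = (S.costE x s).abs ^ 2 * uniformCube m (Set.univ.pi (scenarioBox hν s)) := by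
    rw [setLIntegral_congr_fun (g := fun _ => (S.costE x s).abs ^ 2) hm fun z hz => ?_,
      setLIntegral_const]
    have hz' : quantileMap ν z = s := funext fun k => (hz k (Set.mem_univ k)).2
    simp only [hz']
  have h2 : (S.costE x s).abs ≠ ⊤ := by
    intro h
    have h3 := (setLIntegral_le_lintegral (Set.univ.pi (scenarioBox hν s)) _).trans_lt hG
    rw [h1, h, ENNReal.top_pow two_ne_zero,
      ENNReal.top_mul (uniformCube_pi_scenarioBox_pos hν s).ne'] at h3
    exact lt_irrefl _ h3
  constructor
  · intro h
    exact h2 (by rw [h]; exact EReal.abs_top)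
  · intro h
    exact h2 (by rw [h]; exact EReal.abs_bot)

theorem g_eq_sum (x : Fin p → ℝ) :
    S.g ν x = ∑ s : scenarios hν, (∏ k, mass (scenarioBox hν s k)) * S.G x s :=
  integral_pi_eq_sum hν _

/-- The unique solution stays optimal under small perturbations of the scenario probabilities. -/
theorem exists_stable_optimum (hX : IsCompact S.X)
    (hG : ∀ x ∈ S.X, ∫⁻ z, (S.costE x (quantileMap ν z)).abs ^ 2 ∂(uniformCube m) < ⊤)
    {xs : Fin p → ℝ} (hS : S.optimalSet ν = {xs}) :
    ∃ δ > 0, ∀ w : scenarios hν → ℝ, (∀ s, 0 ≤ w s) →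
      (∀ s, |w s - ∏ k, mass (scenarioBox hν s k)| ≤ δ) →
      ∀ x ∈ S.X, ∑ s, w s * S.G xs s ≤ ∑ s, w s * S.G x s := by
  have hxs : xs ∈ S.optimalSet ν := by rw [hS]; rfl
  refine S.exists_stable_minimizer hX (fun s : scenarios hν => s.1)
    (fun x hx s => S.costE_ne_top_ne_bot hν (hG x hx) s) hxs.1 _ fun x hx hne => ?_
  rw [← S.g_eq_sum hν, ← S.g_eq_sum hν]
  have h1 : x ∉ S.optimalSet ν := by rw [hS]; exact hne
  have h2 : ∃ y ∈ S.X, S.g ν y < S.g ν x := by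
    by_contra hc
    push Not at hc
    exact h1 ⟨hx, hc⟩
  obtain ⟨y, hy, hlt⟩ := h2
  exact (hxs.2 y hy).trans_lt hlt

end TwoStageLP

end Scenarios

/-! ### Variance of the linearized estimator. -/

/-- Bounded random variables that are close in mean have close variances. -/
theorem abs_variance_sub_variance_le {Ω : Type*} [MeasurableSpace Ω] {P : Measure Ω}
    [IsProbabilityMeasure P] {X Y : Ω → ℝ} (hX : Measurable X) (hY : Measurable Y) {B : ℝ}
    (hXB : ∀ ω, |X ω| ≤ B) (hYB : ∀ ω, |Y ω| ≤ B) :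
    |variance X P - variance Y P| ≤ 4 * B * ∫ ω, |X ω - Y ω| ∂P := by
  have iX := integrable_of_abs_le (μ := P) hX B hXB
  have iY := integrable_of_abs_le (μ := P) hY B hYB
  have hsq : ∀ {Z : Ω → ℝ}, (∀ ω, |Z ω| ≤ B) → ∀ ω, |(Z ^ 2) ω| ≤ B ^ 2 := fun hZ ω => by
    rw [Pi.pow_apply, abs_pow]
    exact pow_le_pow_left₀ (abs_nonneg _) (hZ ω) 2
  have mX : MemLp X 2 P := MemLp.of_bound hX.aestronglyMeasurable B (ae_of_all _ hXB)
  have mY : MemLp Y 2 P := MemLp.of_bound hY.aestronglyMeasurable B (ae_of_all _ hYB)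
  have iX2 : Integrable (X ^ 2) P := integrable_of_abs_le (hX.pow_const 2) _ (hsq hXB)
  have iY2 : Integrable (Y ^ 2) P := integrable_of_abs_le (hY.pow_const 2) _ (hsq hYB)
  have iD : Integrable (fun ω => |X ω - Y ω|) P := (iX.sub iY).abs
  have hd : |∫ ω, X ω ∂P - ∫ ω, Y ω ∂P| ≤ ∫ ω, |X ω - Y ω| ∂P := by
    rw [← integral_sub iX iY]
    exact abs_integral_le_integral_abs
  have hb : ∀ {Z : Ω → ℝ}, (∀ ω, |Z ω| ≤ B) → |∫ ω, Z ω ∂P| ≤ B := fun {Z} hZ => by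
    have := norm_integral_le_of_norm_le_const (μ := P) (f := Z) (ae_of_all _ hZ)
    simpa using this
  have h1 : |∫ ω, (X ^ 2) ω ∂P - ∫ ω, (Y ^ 2) ω ∂P| ≤ 2 * B * ∫ ω, |X ω - Y ω| ∂P := by
    rw [← integral_sub iX2 iY2, ← integral_const_mul]
    refine abs_integral_le_integral_abs.trans (integral_mono (iX2.sub iY2).abs
      (iD.const_mul _) fun ω => ?_)
    have h2 : (X ^ 2) ω - (Y ^ 2) ω = (X ω + Y ω) * (X ω - Y ω) := by
      simp only [Pi.pow_apply]
      ring
    change |(X ^ 2) ω - (Y ^ 2) ω| ≤ 2 * B * |X ω - Y ω|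
    rw [h2, abs_mul]
    gcongr
    linarith [abs_add_le (X ω) (Y ω), hXB ω, hYB ω]
  have h3 : |(∫ ω, X ω ∂P) ^ 2 - (∫ ω, Y ω ∂P) ^ 2| ≤ 2 * B * ∫ ω, |X ω - Y ω| ∂P := by
    rw [sq_sub_sq, abs_mul]
    refine mul_le_mul ?_ hd (abs_nonneg _) ?_
    · linarith [abs_add_le (∫ ω, X ω ∂P) (∫ ω, Y ω ∂P), hb hXB, hb hYB]
    · linarith [(abs_nonneg _).trans (hb hXB)]
  rw [variance_eq_sub mX, variance_eq_sub mY]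
  rw [abs_le] at h1 h3 ⊢
  constructor <;> linarith [h1.1, h1.2, h3.1, h3.2]

section Estimator

variable {t lam m : ℕ} [NeZero lam] {O : Fin (t * (t * lam)) → Fin (m + 1) → Fin t}
  {A : Finset (Equiv.Perm (Fin (m + 1)))}

omit [NeZero lam] in
theorem measurable_of_forall_solhPerms {β : Type*} [MeasurableSpace β]
    {F : SolhSpace t lam m → β} (hF : ∀ ω, Measurable fun γ => F (ω, γ)) : Measurable F :=
  measurable_from_prod_countable_right hF

omit [NeZero lam] in
theorem ae_colLaw_mem_Ico :
    ∀ᵐ ω ∂(colLaw t lam m A), ∀ r i k, ω.2 r i k ∈ Set.Ico (0 : ℝ) 1 := by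
  have h : ∀ᵐ γ ∂(jitterLaw t lam m), ∀ r i k, γ r i k ∈ Set.Ico (0 : ℝ) 1 := by
    simp_rw [ae_all_iff]
    intro r i k
    have h1 := (Measure.tendsto_eval_ae_ae (μ := fun _ : Fin m =>
      volume.restrict (Set.Ico (0 : ℝ) 1)) (i := k)).eventually (ae_restrict_mem measurableSet_Ico)
    have h2 := (Measure.tendsto_eval_ae_ae (μ := fun _ : Fin (t * lam) => Measure.pi fun _ : Fin m =>
      volume.restrict (Set.Ico (0 : ℝ) 1)) (i := i)).eventually h1
    exact (Measure.tendsto_eval_ae_ae (μ := fun _ : Fin t => Measure.pi fun _ : Fin (t * lam) =>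
      Measure.pi fun _ : Fin m => volume.restrict (Set.Ico (0 : ℝ) 1)) (i := r)).eventually h2
  exact Measure.quasiMeasurePreserving_snd.ae h

theorem boxFreq_mem_Icc (J : Fin m → Set ℝ) (r : Fin t) (ω : SolhSpace t lam m) :
    boxFreq O J r ω ∈ Set.Icc (0 : ℝ) 1 := by
  have h : ∀ i, ∏ k, ind (J k) (solhDesign O ω r i k) ∈ Set.Icc (0 : ℝ) 1 := fun i =>
    prod_ind_mem_Icc Finset.univ J _
  refine ⟨mul_nonneg (by positivity) (Finset.sum_nonneg fun i _ => (h i).1), ?_⟩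
  have h1 := Finset.sum_le_card_nsmul Finset.univ _ 1 fun i _ => (h i).2
  rw [Finset.card_univ, Fintype.card_fin, nsmul_eq_mul, mul_one] at h1
  exact inv_mul_le_one_of_le₀ h1 (by positivity)

theorem measurable_boxFreq {J : Fin m → Set ℝ} (hJ : ∀ k, (J k).OrdConnected) (r : Fin t) :
    Measurable (boxFreq O J r) :=
  measurable_of_forall_solhPerms fun ω => measurable_const.mul (Finset.measurable_fun_sum _
    fun i _ => Finset.measurable_fun_prod _ fun k _ => (measurable_ind (hJ k)).comp
      ((measurable_pi_apply k).comp (measurable_solhDesign O ω r i)))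

variable {ι : Type*} [Fintype ι] {J : ι → Fin m → Set ℝ}

/-- The average over the batches of a function of the box frequencies. -/
noncomputable def batchAvg (O : Fin (t * (t * lam)) → Fin (m + 1) → Fin t)
    (J : ι → Fin m → Set ℝ) (Φ : (ι → ℝ) → ℝ) (ω : SolhSpace t lam m) : ℝ :=
  (t : ℝ)⁻¹ * ∑ r, Φ fun s => boxFreq O (J s) r ω

omit [Fintype ι] in
theorem measurable_batchAvg (hJ : ∀ s k, (J s k).OrdConnected) {Φ : (ι → ℝ) → ℝ}
    (hΦ : Measurable Φ) : Measurable (batchAvg O J Φ) :=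
  measurable_const.mul (Finset.measurable_fun_sum _ fun r _ =>
    hΦ.comp (measurable_pi_lambda _ fun s => measurable_boxFreq (hJ s) r))

theorem abs_inv_mul_sum_le {t : ℕ} (ht : 0 < t) {x : Fin t → ℝ} {B : ℝ} (h : ∀ r, |x r| ≤ B) :
    |(t : ℝ)⁻¹ * ∑ r, x r| ≤ B := by
  have ht' : (0 : ℝ) < t := by exact_mod_cast ht
  rw [abs_mul, abs_of_nonneg (by positivity), inv_mul_le_iff₀ ht']
  refine (Finset.abs_sum_le_sum_abs _ _).trans ((Finset.sum_le_card_nsmul _ _ B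
    fun r _ => h r).trans_eq ?_)
  simp

theorem batchAvg_linear (c : ι → ℝ) (ω : SolhSpace t lam m) :
    batchAvg O J (fun w => ∑ s, w s * c s) ω =
      ((t * lam * t : ℕ) : ℝ)⁻¹ * ∑ p : Fin t × Fin (t * lam),
        stepFn c J (solhDesign O ω p.1 p.2) := by
  have h1 : ∀ r, ∑ s, boxFreq O (J s) r ω * c s =
      ((t * lam : ℕ) : ℝ)⁻¹ * ∑ i, stepFn c J (solhDesign O ω r i) := by
    intro r
    unfold boxFreq stepFn
    rw [Finset.sum_comm, Finset.mul_sum]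
    refine Finset.sum_congr rfl fun s _ => ?_
    rw [mul_assoc, Finset.sum_mul]
    congr 1
    exact Finset.sum_congr rfl fun i _ => mul_comm _ _
  unfold batchAvg
  simp_rw [h1]
  rw [← Finset.mul_sum, Fintype.sum_prod_type, ← mul_assoc]
  congr 1
  push_cast
  rw [mul_inv, mul_inv, mul_inv]
  ring

omit [NeZero lam] in
theorem expect_basesOf_coincidences (hA : A.Nonempty) (u : Finset (Fin m)) :
    ∫ ω, (coincidences (fun i (k : Fin m) => randomizedArray O ω.1 i k.castSucc) u u.card : ℝ)
        ∂(colLaw t lam m A) =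
      𝔼 b ∈ basesOf t lam m A,
        (coincidences (fun i (k : Fin m) => O i (b.2.1 k.castSucc)) u u.card : ℝ) := by
  have := isProbabilityMeasure_colLaw (t := t) (lam := lam) hA
  simp_rw [coincidences_randomizedArray]
  rw [integral_colLaw hA]
  · refine Finset.expect_congr rfl fun b _ => ?_
    simp only [integral_const, probReal_univ, one_smul]
    exact Finset.expect_const (Finset.univ_nonempty (α := Fin m → ColPerms t lam))
      (coincidences (fun i (k : Fin m) => O i (b.2.1 k.castSucc)) u u.card : ℝ)
  · obtain ⟨C, hC⟩ := (Set.finite_range fun ω : SolhPerms t lam m => |(coincidences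
      (fun i (k : Fin m) => O i (ω.col k.castSucc)) u u.card : ℝ)|).bddAbove
    refine integrable_of_abs_le (measurable_of_forall_solhPerms fun ω => ?_) C
      fun ω => hC ⟨ω.1, rfl⟩
    exact (measurable_const : Measurable fun _ : Fin t → Fin (t * lam) → Fin m → ℝ =>
      (coincidences (fun i (k : Fin m) => O i (ω.col k.castSucc)) u u.card : ℝ))

omit [NeZero lam] in
theorem integral_coincidences_singleton (κ : Equiv.Perm (Fin (m + 1))) (u : Finset (Fin m)) :
    ∫ ω, (coincidences (fun i (k : Fin m) => randomizedArray O ω.1 i k.castSucc) u u.card : ℝ)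
        ∂(colLaw t lam m {κ}) = coincidences (fun i (k : Fin m) => O i (κ k.castSucc)) u u.card := by
  have hne : ({κ} : Finset (Equiv.Perm (Fin (m + 1)))).Nonempty := Finset.singleton_nonempty κ
  rw [expect_basesOf_coincidences hne, Finset.expect_congr rfl fun b hb => ?_,
    Finset.expect_const (basesOf_nonempty hne)]
  have h : b.2.1 = κ := by simpa [basesOf] using hb
  rw [h]

/-- Subtracting the common conditional mean from the second moment and averaging over the admissible
slice bases gives the main term. The error per base is a constant times `N * lam / t`, and the
factor `N⁻²` makes it `O(lam / (t N))`. -/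
theorem variance_batchAvg_linear (ht : 1 < t) (hO : IsOrthogonalArray 2 lam O) (c : ι → ℝ)
    (hJ : ∀ s k, (J s k).OrdConnected) (hA : A.Nonempty) :
    |variance (batchAvg O J fun w => ∑ s, w s * c s) (colLaw t lam m A) -
        (((t * lam * t : ℕ) : ℝ) ^ 2)⁻¹ *
          ∑ u ∈ Finset.univ.filter (fun u : Finset (Fin m) => 3 ≤ u.card),
            (∫ ω, (coincidences
              (fun i (k : Fin m) => randomizedArray O ω.1 i k.castSucc) u u.card : ℝ)
              ∂(colLaw t lam m A)) * stepVar c J u| ≤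
      (∑ s, |c s|) ^ 2 * (2 ^ m * (2 * (m : ℝ) ^ 2 + 12 * m + 8)) *
        (lam / t * ((t * lam * t : ℕ) : ℝ)⁻¹) := by
  have := isProbabilityMeasure_colLaw (t := t) (lam := lam) hA
  have ht0 : 0 < t := by omega
  have hlam := Nat.pos_of_neZero lam
  have hNpos : (0 : ℝ) < ((t * lam * t : ℕ) : ℝ) := by
    have : 0 < t * lam * t := by positivity
    exact_mod_cast this
  have hne := basesOf_nonempty (t := t) (lam := lam) hA
  set N : ℝ := ((t * lam * t : ℕ) : ℝ) with hN
  have hmeas : Measurable (stepFn c J) := measurable_stepFn c hJ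
  have hSm : Measurable fun ω : SolhSpace t lam m => ∑ p : Fin t × Fin (t * lam),
      stepFn c J (solhDesign O ω p.1 p.2) := Finset.measurable_fun_sum _ fun p _ =>
    measurable_of_forall_solhPerms fun ω => hmeas.comp (measurable_solhDesign O ω p.1 p.2)
  have hpm : ∀ p : Fin t × Fin (t * lam), Integrable (fun ω : SolhSpace t lam m =>
      stepFn c J (solhDesign O ω p.1 p.2)) (colLaw t lam m A) := fun p =>
    integrable_of_abs_le (measurable_of_forall_solhPerms fun ω =>
      hmeas.comp (measurable_solhDesign O ω p.1 p.2)) _ fun ω => abs_stepFn_le c J _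
  have hSb : ∃ C, ∀ ω : SolhSpace t lam m, |∑ p : Fin t × Fin (t * lam),
      stepFn c J (solhDesign O ω p.1 p.2)| ≤ C :=
    ⟨_, fun ω => (Finset.abs_sum_le_sum_abs _ _).trans
      (Finset.sum_le_sum fun p _ => abs_stepFn_le c J _)⟩
  obtain ⟨C, hC⟩ := hSb
  have hmean : ∫ ω, ∑ p : Fin t × Fin (t * lam), stepFn c J (solhDesign O ω p.1 p.2)
      ∂(colLaw t lam m A) = N * stepMean c J := by
    rw [integral_finsetSum _ fun p _ => hpm p]
    have h1 : ∀ p : Fin t × Fin (t * lam), ∫ ω, stepFn c J (solhDesign O ω p.1 p.2)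
        ∂(colLaw t lam m A) = stepMean c J := by
      intro p
      rw [integral_colLaw hA (hpm p)]
      simp_rw [expect_integral_stepFn O _ c ht0 hJ p]
      exact Finset.expect_const hne _
    simp_rw [h1]
    rw [Finset.sum_const, Finset.card_univ, Fintype.card_prod, Fintype.card_fin, Fintype.card_fin,
      nsmul_eq_mul, hN, mul_comm t (t * lam)]
  have hsq : ∫ ω, (∑ p : Fin t × Fin (t * lam), stepFn c J (solhDesign O ω p.1 p.2)) ^ 2
      ∂(colLaw t lam m A) = 𝔼 b ∈ basesOf t lam m A, ∑ s, ∑ s', c s * c s' *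
        ∑ p, ∑ q, ∏ k, colMean (keyAt O b k) (ind (J s k)) (ind (J s' k)) p q := by
    rw [integral_colLaw hA]
    · exact Finset.expect_congr rfl fun b _ => expect_integral_sum_stepFn_sq O b c hJ
    · refine integrable_of_abs_le (hSm.pow_const 2) (C ^ 2) fun ω => ?_
      rw [abs_pow]
      exact pow_le_pow_left₀ (abs_nonneg _) (hC ω) 2
  have hvar : variance (batchAvg O J fun w => ∑ s, w s * c s) (colLaw t lam m A) =
      (N ^ 2)⁻¹ * (𝔼 b ∈ basesOf t lam m A, ((∑ s, ∑ s', c s * c s' *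
        ∑ p, ∑ q, ∏ k, colMean (keyAt O b k) (ind (J s k)) (ind (J s' k)) p q) -
          (N * stepMean c J) ^ 2)) := by
    have h1 : (batchAvg O J fun w => ∑ s, w s * c s) = fun ω : SolhSpace t lam m =>
        N⁻¹ * ∑ p : Fin t × Fin (t * lam), stepFn c J (solhDesign O ω p.1 p.2) :=
      funext fun ω => batchAvg_linear c ω
    rw [h1, variance_const_mul, variance_eq_sub (MemLp.of_bound hSm.aestronglyMeasurable C
      (ae_of_all _ hC)), hmean, Finset.expect_sub_distrib, Finset.expect_const hne, ← hsq, inv_pow]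
    rfl
  rw [hvar, ← mul_sub, abs_mul, abs_of_nonneg (by positivity)]
  simp_rw [expect_basesOf_coincidences hA, Finset.expect_mul]
  rw [← Finset.expect_sum_comm, ← Finset.expect_sub_distrib]
  have hle := (Finset.abs_expect_le (basesOf t lam m A) _).trans
    (Finset.expect_le_expect fun b _ => abs_sum_colMean_sub_le b ht hO c hJ)
  rw [Finset.expect_const hne] at hle
  refine (mul_le_mul_of_nonneg_left hle (by positivity)).trans_eq ?_
  rw [← hN]
  field_simp

end Estimator

/-! ### Replacing the optimal value by its linearization. -/

section Comparison

variable {t lam m : ℕ} [NeZero lam] {O : Fin (t * (t * lam)) → Fin (m + 1) → Fin t}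
  {A : Finset (Equiv.Perm (Fin (m + 1)))} {ι : Type*} [Fintype ι] {J : ι → Fin m → Set ℝ}

open Classical in
/-- The number of scenarios whose cell frequency in batch `r` is far from its mean, averaged over
the batches. -/
noncomputable def tailAvg (O : Fin (t * (t * lam)) → Fin (m + 1) → Fin t)
    (J : ι → Fin m → Set ℝ) (δ : ℝ) (ω : SolhPerms t lam m) : ℝ :=
  (t : ℝ)⁻¹ * ∑ r, ∑ s, if m * δ < |cellFreq O (J s) r ω - ∏ k, ((∑ ℓ, cellInd t (J s k) ℓ) / t)|
    then (1 : ℝ) else 0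

theorem integral_tailAvg_le (ht : 0 < t) (hO : IsOrthogonalArray 2 lam O) (hA : A.Nonempty)
    {δ : ℝ} (hδ : 0 < δ) :
    Integrable (fun ω => tailAvg O J δ ω.1) (colLaw t lam m A) ∧
    ∫ ω, tailAvg O J δ ω.1 ∂(colLaw t lam m A) ≤
      Fintype.card ι * (m * (2 * Real.exp (-(t * δ ^ 2 / 2)))) := by
  classical
  have := isProbabilityMeasure_colLaw (t := t) (lam := lam) hA
  have ht' : (0 : ℝ) < t := by exact_mod_cast ht
  have hint : Integrable (fun ω => tailAvg O J δ ω.1) (colLaw t lam m A) := by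
    obtain ⟨C, hC⟩ := (Set.finite_range fun ω : SolhPerms t lam m => |tailAvg O J δ ω|).bddAbove
    refine integrable_of_abs_le (measurable_of_forall_solhPerms fun ω => ?_) C
      fun ω => hC ⟨ω.1, rfl⟩
    exact (measurable_const : Measurable fun _ : Fin t → Fin (t * lam) → Fin m → ℝ =>
      tailAvg O J δ ω)
  refine ⟨hint, ?_⟩
  rw [integral_colLaw hA hint]
  refine Finset.expect_le (basesOf_nonempty hA) fun b _ => ?_
  simp only [integral_const, probReal_univ, one_smul]
  unfold tailAvg
  rw [← Finset.mul_expect, Finset.expect_sum_comm, inv_mul_le_iff₀ ht']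
  refine (Finset.sum_le_card_nsmul _ _
    (Fintype.card ι * (m * (2 * Real.exp (-(t * δ ^ 2 / 2))))) fun r _ => ?_).trans_eq ?_
  · rw [Finset.expect_sum_comm]
    refine (Finset.sum_le_card_nsmul _ _ (m * (2 * Real.exp (-(t * δ ^ 2 / 2))))
      fun s _ => ?_).trans_eq ?_
    · exact expect_tail_cellFreq_le ht hO (J s) r b hδ
    · rw [Finset.card_univ, nsmul_eq_mul]
  · rw [Finset.card_univ, Fintype.card_fin, nsmul_eq_mul]

/-- Two discretization errors of `2 m / t` are added to the random deviation: one for the sampled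
points, one for the probabilities. -/
theorem abs_boxFreq_sub_prod_mass_le (ht : 0 < t) (hO : IsOrthogonalArray 2 lam O)
    {J : Fin m → Set ℝ} (hJ : ∀ k, (J k).OrdConnected) (r : Fin t) (ω : SolhSpace t lam m)
    (hγ : ∀ r i k, ω.2 r i k ∈ Set.Ico (0 : ℝ) 1) :
    |boxFreq O J r ω - ∏ k, mass (J k)| ≤
      |cellFreq O J r ω.1 - ∏ k, ((∑ ℓ, cellInd t (J k) ℓ) / t)| + 4 * m / t := by
  have ht' : (0 : ℝ) < t := by exact_mod_cast ht
  have h1 := abs_boxFreq_sub_cellFreq_le ht hO hJ r ω hγ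
  have h2 : |∏ k, ((∑ ℓ, cellInd t (J k) ℓ) / t) - ∏ k, mass (J k)| ≤ 2 * m / t := by
    refine (abs_prod_sub_prod_le Finset.univ _ _ (fun k => ?_) fun k => ?_).trans
      ((Finset.sum_le_card_nsmul Finset.univ _ ((2 : ℝ) / t) fun k _ =>
        abs_mean_cellInd_sub_mass_le ht (hJ k)).trans_eq ?_)
    · have h0 : (0 : ℝ) ≤ ∑ ℓ, cellInd t (J k) ℓ :=
        Finset.sum_nonneg fun ℓ _ => (cellInd_mem_Icc t (J k) ℓ).1
      rw [abs_of_nonneg (by positivity), div_le_one ht']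
      refine (Finset.sum_le_card_nsmul _ _ 1 fun ℓ _ => (cellInd_mem_Icc t (J k) ℓ).2).trans_eq ?_
      simp
    · rw [abs_of_nonneg (mass_mem_Icc _).1]
      exact (mass_mem_Icc _).2
    · rw [Finset.card_univ, Fintype.card_fin, nsmul_eq_mul]
      ring
  have h3 : (4 : ℝ) * m / t = 2 * m / t + 2 * m / t := by ring
  rw [h3]
  rw [abs_le] at h1 h2
  have h4 := le_abs_self (cellFreq O J r ω.1 - ∏ k, ((∑ ℓ, cellInd t (J k) ℓ) / t))
  have h5 := neg_abs_le (cellFreq O J r ω.1 - ∏ k, ((∑ ℓ, cellInd t (J k) ℓ) / t))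
  rw [abs_le]
  constructor <;> linarith [h1.1, h1.2, h2.1, h2.2]

/-- A function of the box frequencies that is linear near the probabilities is close in mean to its
linearization. -/
theorem integral_abs_batchAvg_sub_le (ht : 0 < t) (hO : IsOrthogonalArray 2 lam O)
    (hA : A.Nonempty) (hJ : ∀ s k, (J s k).OrdConnected) {Φ : (ι → ℝ) → ℝ} {c : ι → ℝ} {B δ : ℝ}
    (hΦB : ∀ w : ι → ℝ, (∀ s, w s ∈ Set.Icc (0 : ℝ) 1) → |Φ w| ≤ B)
    (hcB : ∀ w : ι → ℝ, (∀ s, w s ∈ Set.Icc (0 : ℝ) 1) → |∑ s, w s * c s| ≤ B)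
    (hδ : 0 < δ)
    (hΦ : ∀ w : ι → ℝ, (∀ s, 0 ≤ w s) → (∀ s, |w s - ∏ k, mass (J s k)| ≤ m * δ + 4 * m / t) →
      Φ w = ∑ s, w s * c s) :
    ∫ ω, |batchAvg O J Φ ω - batchAvg O J (fun w => ∑ s, w s * c s) ω| ∂(colLaw t lam m A) ≤
      2 * B * (Fintype.card ι * (m * (2 * Real.exp (-(t * δ ^ 2 / 2))))) := by
  classical
  have hB : 0 ≤ B := (abs_nonneg _).trans (hΦB 0 fun s => by simp)
  obtain ⟨hint, hle⟩ := integral_tailAvg_le (J := J) ht hO hA hδ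
  refine (integral_mono_of_nonneg (ae_of_all _ fun ω => abs_nonneg _) (hint.const_mul (2 * B))
    ?_).trans ?_
  · filter_upwards [ae_colLaw_mem_Ico] with ω hω
    unfold batchAvg tailAvg
    rw [← mul_sub, ← Finset.sum_sub_distrib, abs_mul, abs_of_nonneg (by positivity), mul_left_comm]
    refine mul_le_mul_of_nonneg_left ?_ (by positivity)
    rw [Finset.mul_sum]
    refine (Finset.abs_sum_le_sum_abs _ _).trans (Finset.sum_le_sum fun r _ => ?_)
    have hnn : ∀ s, (0 : ℝ) ≤ if m * δ < |cellFreq O (J s) r ω.1 -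
        ∏ k, ((∑ ℓ, cellInd t (J s k) ℓ) / t)| then (1 : ℝ) else 0 := fun s => by
      split_ifs <;> simp
    -- In a batch with a deviating frequency the crude bound `2 * B` is charged to the tail count,
    -- which is at least one; in every other batch the function and its linearization coincide.
    by_cases hbad : ∃ s, m * δ < |cellFreq O (J s) r ω.1 - ∏ k, ((∑ ℓ, cellInd t (J s k) ℓ) / t)|
    · obtain ⟨s, hs⟩ := hbad
      have h1 := Finset.single_le_sum (fun s _ => hnn s) (Finset.mem_univ s)
      rw [if_pos hs] at h1
      have h2 := hΦB _ fun s => boxFreq_mem_Icc (O := O) (J s) r ω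
      have h3 := hcB _ fun s => boxFreq_mem_Icc (O := O) (J s) r ω
      refine (abs_sub _ _).trans ?_
      nlinarith
    · push Not at hbad
      rw [hΦ _ (fun s => (boxFreq_mem_Icc (J s) r ω).1) fun s =>
        (abs_boxFreq_sub_prod_mass_le ht hO (hJ s) r ω hω).trans (by linarith [hbad s]), sub_self,
        abs_zero]
      exact mul_nonneg (by positivity) (Finset.sum_nonneg fun s _ => hnn s)
  · rw [integral_const_mul]
    exact mul_le_mul_of_nonneg_left hle (by positivity)

end Comparison

/-! ### Choice of thresholds. -/

section Asymptotics

variable {m : ℕ} {ι : Type*} [Fintype ι] {J : ι → Fin m → Set ℝ}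

theorem exists_forall_pow_three_mul_exp_le (K : ℝ) {a ε : ℝ} (ha : 0 < a) (hε : 0 < ε) :
    ∃ t₁ : ℕ, ∀ t : ℕ, t₁ ≤ t → K * ((t : ℝ) ^ 3 * Real.exp (-(a * t))) ≤ ε := by
  have h1 := (Real.tendsto_pow_mul_exp_neg_atTop_nhds_zero 3).comp
    ((tendsto_natCast_atTop_atTop (R := ℝ)).const_mul_atTop ha)
  have h2 := h1.const_mul (K * (a ^ 3)⁻¹)
  rw [mul_zero] at h2
  obtain ⟨t₁, ht₁⟩ := Filter.eventually_atTop.mp (h2.eventually (ge_mem_nhds hε))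
  refine ⟨t₁, fun t ht => le_trans (le_of_eq ?_) (ht₁ t ht)⟩
  simp only [Function.comp]
  field_simp

/-- Asymptotic variance of the average over the batches of a function of the scenario frequencies
that is linear near the scenario probabilities. -/
theorem exists_variance_batchAvg_le (hJ : ∀ s k, (J s k).OrdConnected) {Φ : (ι → ℝ) → ℝ}
    (hΦm : Measurable Φ) {c : ι → ℝ} {B δ : ℝ}
    (hΦB : ∀ w : ι → ℝ, (∀ s, w s ∈ Set.Icc (0 : ℝ) 1) → |Φ w| ≤ B)
    (hcB : ∀ w : ι → ℝ, (∀ s, w s ∈ Set.Icc (0 : ℝ) 1) → |∑ s, w s * c s| ≤ B) (hδ : 0 < δ)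
    (hΦ : ∀ w : ι → ℝ, (∀ s, 0 ≤ w s) → (∀ s, |w s - ∏ k, mass (J s k)| ≤ δ) →
      Φ w = ∑ s, w s * c s) {ε : ℝ} (hε : 0 < ε) :
    ∃ t₀ : ℕ, ∀ (t lam : ℕ) [NeZero lam], t₀ * lam ≤ t →
      ∀ O : Fin (t * (t * lam)) → Fin (m + 1) → Fin t, IsOrthogonalArray 2 lam O →
        ∀ A : Finset (Equiv.Perm (Fin (m + 1))), A.Nonempty →
          |variance (batchAvg O J Φ) (colLaw t lam m A) -
            (((t * lam * t : ℕ) : ℝ) ^ 2)⁻¹ *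
              ∑ u ∈ Finset.univ.filter (fun u : Finset (Fin m) => 3 ≤ u.card),
                (∫ ω, (coincidences
                  (fun i (k : Fin m) => randomizedArray O ω.1 i k.castSucc) u u.card : ℝ)
                  ∂(colLaw t lam m A)) * stepVar c J u| ≤
            ε * (((t * lam * t : ℕ) : ℝ))⁻¹ := by
  set K : ℝ := (∑ s, |c s|) ^ 2 * (2 ^ m * (2 * (m : ℝ) ^ 2 + 12 * m + 8)) with hK
  set L : ℝ := 4 * B * (2 * B * (Fintype.card ι * (m * 2))) with hL
  have hB : 0 ≤ B := (abs_nonneg _).trans (hΦB 0 fun s => by simp)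
  have hm1 : (0 : ℝ) < m + 1 := by positivity
  -- Three thresholds: `t₁` for the exponential tail, `t₂` for the term of order `lam / t`, `t₃` to
  -- make the discretization error at most `δ/2`. The radius `δ / (2 (m + 1))` leaves the other
  -- `δ/2` to the fluctuations; `m + 1` avoids dividing by zero.
  obtain ⟨t₁, ht₁⟩ := exists_forall_pow_three_mul_exp_le L
    (a := (δ / (2 * (m + 1))) ^ 2 / 2) (by positivity) (half_pos hε)
  obtain ⟨t₂, ht₂⟩ := exists_nat_ge (2 * K / ε)
  obtain ⟨t₃, ht₃⟩ := exists_nat_ge (8 * m / δ)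
  refine ⟨t₁ + t₂ + t₃ + 2, fun t lam _ htl O hO A hA => ?_⟩
  have hlam := Nat.pos_of_neZero lam
  have hprob := isProbabilityMeasure_colLaw (t := t) (lam := lam) hA
  have htge : t₁ + t₂ + t₃ + 2 ≤ t := le_trans (Nat.le_mul_of_pos_right _ hlam) htl
  have ht : 1 < t := by omega
  have ht0 : (0 : ℝ) < t := by exact_mod_cast (by omega : 0 < t)
  have hlam0 : (0 : ℝ) < lam := by exact_mod_cast hlam
  have hlamt : lam ≤ t := le_trans (Nat.le_mul_of_pos_left _ (by omega)) htl
  have hN : ((t * lam * t : ℕ) : ℝ) = t * lam * t := by push_cast; ring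
  have hNpos : (0 : ℝ) < ((t * lam * t : ℕ) : ℝ) := by rw [hN]; positivity
  have hlin := variance_batchAvg_linear ht hO c hJ hA
  rw [← hK] at hlin
  have hδt : (m : ℝ) * (δ / (2 * (m + 1))) + 4 * m / t ≤ δ := by
    have h1 : (m : ℝ) * (δ / (2 * (m + 1))) ≤ δ / 2 := by
      rw [mul_div_assoc', div_le_div_iff₀ (by positivity) two_pos]
      nlinarith
    have h2 : (4 : ℝ) * m / t ≤ δ / 2 := by
      have h3 : 8 * m / δ ≤ t := ht₃.trans (by exact_mod_cast (by omega : t₃ ≤ t))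
      rw [div_le_iff₀ hδ] at h3
      rw [div_le_div_iff₀ ht0 two_pos]
      linarith
    linarith
  have hdist := integral_abs_batchAvg_sub_le (O := O) (by omega) hO hA hJ hΦB hcB
    (δ := δ / (2 * (m + 1))) (by positivity) fun w hw0 hw => hΦ w hw0 fun s => (hw s).trans hδt
  have hcm : Measurable fun w : ι → ℝ => ∑ s, w s * c s := by fun_prop
  have hvar := abs_variance_sub_variance_le (P := colLaw t lam m A)
    (measurable_batchAvg (O := O) hJ hΦm) (measurable_batchAvg (O := O) hJ hcm) (B := B)
    (fun ω => abs_inv_mul_sum_le (by omega) fun r => hΦB _ fun s => boxFreq_mem_Icc (J s) r ω)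
    (fun ω => abs_inv_mul_sum_le (by omega) fun r => hcB _ fun s => boxFreq_mem_Icc (J s) r ω)
  have h1 : K * (lam / t * ((t * lam * t : ℕ) : ℝ)⁻¹) ≤ ε / 2 * ((t * lam * t : ℕ) : ℝ)⁻¹ := by
    rw [← mul_assoc]
    refine mul_le_mul_of_nonneg_right ?_ (inv_nonneg.mpr hNpos.le)
    have h2 : 2 * K / ε * lam ≤ t := by
      refine (mul_le_mul_of_nonneg_right ht₂ hlam0.le).trans ?_
      exact_mod_cast (Nat.mul_le_mul_right lam (by omega)).trans htl
    rw [div_mul_eq_mul_div, div_le_iff₀ hε] at h2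
    rw [mul_div_assoc', div_le_iff₀ ht0]
    linarith
  have h2 : 4 * B * (2 * B * (Fintype.card ι *
      (m * (2 * Real.exp (-(t * (δ / (2 * (m + 1))) ^ 2 / 2)))))) ≤
      ε / 2 * ((t * lam * t : ℕ) : ℝ)⁻¹ := by
    rw [le_mul_inv_iff₀ hNpos]
    refine le_trans ?_ (ht₁ t (by omega))
    -- As `lam ≤ t`, the exponential decay in `t` beats the factor `N`.
    have h3 : ((t * lam * t : ℕ) : ℝ) ≤ (t : ℝ) ^ 3 := by
      rw [hN, pow_succ, sq]
      have : (lam : ℝ) ≤ t := by exact_mod_cast hlamt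
      gcongr
    have h4 : -((t : ℝ) * (δ / (2 * (m + 1))) ^ 2 / 2) =
        -((δ / (2 * (m + 1))) ^ 2 / 2 * t) := by ring
    rw [h4]
    calc _ = L * (((t * lam * t : ℕ) : ℝ) * Real.exp (-((δ / (2 * (m + 1))) ^ 2 / 2 * t))) := by
          rw [hL]; ring
      _ ≤ _ := by gcongr
  have h3 := (hvar.trans (mul_le_mul_of_nonneg_left hdist (by positivity))).trans h2
  refine (abs_sub_le _ (variance (batchAvg O J fun w => ∑ s, w s * c s) (colLaw t lam m A))
    _).trans ?_
  linarith [hlin.trans h1]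

end Asymptotics

/-! ### The optimal value as a function of the scenario frequencies, and the theorem. -/

namespace TwoStageLP

variable {m p e a b : ℕ} (S : TwoStageLP m p e a b) {ν : Fin m → Measure ℝ}
  [∀ k, IsProbabilityMeasure (ν k)] (hν : ∀ k, (ν k).support.Finite)

theorem saaValue_eq_iInf {t lam : ℕ} [NeZero lam] (O : Fin (t * (t * lam)) → Fin (m + 1) → Fin t)
    (ω : SolhSpace t lam m) (hγ : ∀ r i k, ω.2 r i k ∈ Set.Ico (0 : ℝ) 1) (r : Fin t) :
    S.saaValue ν (solhDesign O ω r) =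
      ⨅ x : S.X, ∑ s : scenarios hν, boxFreq O (scenarioBox hν s) r ω * S.G x s := by
  unfold saaValue
  congr 1
  ext x
  unfold boxFreq
  simp_rw [comp_quantileMap_eq_stepFn hν (S.G x) fun k => solhDesign_mem_Ioc ω hγ r _ k, stepFn]
  rw [Finset.sum_comm, Finset.mul_sum]
  refine Finset.sum_congr rfl fun s _ => ?_
  rw [mul_assoc, Finset.sum_mul]
  congr 1
  exact Finset.sum_congr rfl fun i _ => mul_comm _ _

/-- The optimal value of the program with scenario weights `w` as a minimum of linear functions. -/
theorem exists_scenario_value (hX : IsCompact S.X)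
    (hG : ∀ x ∈ S.X, ∫⁻ z, (S.costE x (quantileMap ν z)).abs ^ 2 ∂(uniformCube m) < ⊤)
    {xs : Fin p → ℝ} (hS : S.optimalSet ν = {xs}) :
    ∃ (Φ : (scenarios hν → ℝ) → ℝ) (B δ : ℝ), Measurable Φ ∧
      (∀ w : scenarios hν → ℝ, (∀ s, 0 ≤ w s) → ⨅ x : S.X, ∑ s : scenarios hν, w s * S.G x s = Φ w) ∧
      (∀ w : scenarios hν → ℝ, (∀ s, w s ∈ Set.Icc (0 : ℝ) 1) → |Φ w| ≤ B) ∧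
      (∀ w : scenarios hν → ℝ, (∀ s, w s ∈ Set.Icc (0 : ℝ) 1) → |∑ s : scenarios hν, w s * S.G xs s| ≤ B) ∧ 0 < δ ∧
      ∀ w : scenarios hν → ℝ, (∀ s, 0 ≤ w s) → (∀ s, |w s - ∏ k, mass (scenarioBox hν s k)| ≤ δ) →
        Φ w = ∑ s : scenarios hν, w s * S.G xs s := by
  have hxs : xs ∈ S.X := by
    have h : xs ∈ S.optimalSet ν := by rw [hS]; rfl
    exact h.1
  obtain ⟨δ, hδ, hopt⟩ := S.exists_stable_optimum hν hX hG hS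
  obtain ⟨V, hne, hV⟩ := S.exists_iInf_eq_inf' hX (fun s : scenarios hν => s.1)
    (fun x hx s => S.costE_ne_top_ne_bot hν (hG x hx) s) hxs
  have hlin : ∀ (v : Fin p → ℝ) (w : scenarios hν → ℝ), (∀ s, w s ∈ Set.Icc (0 : ℝ) 1) →
      |∑ s : scenarios hν, w s * S.G v s| ≤ ∑ s : scenarios hν, |S.G v s| := fun v w hw =>
    (Finset.abs_sum_le_sum_abs _ _).trans (Finset.sum_le_sum fun s _ => by
      rw [abs_mul, abs_of_nonneg (hw s).1]
      exact mul_le_of_le_one_left (abs_nonneg _) (hw s).2)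
  -- The finite minimum is used as `Φ` since it is visibly continuous. It agrees with the infimum
  -- over `S.X` only for nonnegative weights, and frequencies are nonnegative. The bound `B` covers
  -- all of `V` and `xs`.
  refine ⟨fun w => V.inf' hne fun v => ∑ s : scenarios hν, w s * S.G v s,
    (∑ v ∈ V, ∑ s : scenarios hν, |S.G v s|) + ∑ s : scenarios hν, |S.G xs s|, δ, ?_, hV, ?_, ?_,
    hδ, ?_⟩
  · exact (Continuous.finset_inf'_apply hne fun v _ => by fun_prop).measurable
  · intro w hw
    obtain ⟨v, hv, h⟩ := V.exists_mem_eq_inf' hne fun v => ∑ s : scenarios hν, w s * S.G v s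
    simp only [h]
    refine (hlin v w hw).trans (le_add_of_le_of_nonneg ?_ (by positivity))
    exact Finset.single_le_sum (f := fun v => ∑ s : scenarios hν, |S.G v s|)
      (fun v _ => by positivity) hv
  · intro w hw
    exact (hlin xs w hw).trans (le_add_of_nonneg_left (by positivity))
  · intro w hw0 hw
    have : Nonempty S.X := ⟨⟨xs, hxs⟩⟩
    simp only [← hV w hw0]
    refine le_antisymm (ciInf_le (f := fun x : S.X => ∑ s : scenarios hν, w s * S.G x s)
      ⟨∑ s : scenarios hν, w s * S.G xs s, ?_⟩ ⟨xs, hxs⟩) (le_ciInf fun x => hopt w hw0 hw x x.2)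
    rintro _ ⟨x, rfl⟩
    exact hopt w hw0 hw x x.2

end TwoStageLP

theorem mainTheorem5 {m p e a b : ℕ} (S : TwoStageLP m p e a b)
    (hX : IsCompact S.X)
    (ν : Fin m → Measure ℝ) [∀ k, IsProbabilityMeasure (ν k)]
    (hν : ∀ k, (ν k).support.Finite)
    (hG : ∀ x ∈ S.X, ∫⁻ z, (S.costE x (quantileMap ν z)).abs ^ 2 ∂(uniformCube m) < ⊤)
    (xs : Fin p → ℝ) (hS : S.optimalSet ν = {xs}) :
    ∀ ε : ℝ, 0 < ε → ∃ t₀ : ℕ, ∀ (t lam : ℕ) [NeZero lam], t₀ * lam ≤ t →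
      ∀ O : Fin (t * (t * lam)) → Fin (m + 1) → Fin t, IsOrthogonalArray 2 lam O →
        MemLp (fun ω => S.lowerBound ν (solhDesign O ω)) 2 (solhLaw t lam m) ∧
        (∀ κ : Equiv.Perm (Fin (m + 1)),
          |variance (fun ω => S.lowerBound ν (solhDesign O ω))
                (cond (solhLaw t lam m) {ω | ω.1.col = κ}) -
              (((t * lam * t : ℕ) : ℝ) ^ 2)⁻¹ *
                ∑ u ∈ Finset.univ.filter (fun u : Finset (Fin m) => 3 ≤ u.card),
                  (coincidences (fun i (k : Fin m) => O i (κ k.castSucc)) u u.card : ℝ) *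
                    variance (anova (fun z => S.G xs (quantileMap ν z)) u) (uniformCube m)| ≤
            ε * (((t * lam * t : ℕ) : ℝ))⁻¹) ∧
        |variance (fun ω => S.lowerBound ν (solhDesign O ω)) (solhLaw t lam m) -
            (((t * lam * t : ℕ) : ℝ) ^ 2)⁻¹ *
              ∑ u ∈ Finset.univ.filter (fun u : Finset (Fin m) => 3 ≤ u.card),
                (∫ ω, (coincidences
                    (fun i (k : Fin m) => randomizedArray O ω.1 i k.castSucc) u u.card : ℝ)
                    ∂(solhLaw t lam m)) *
                  variance (anova (fun z => S.G xs (quantileMap ν z)) u) (uniformCube m)| ≤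
          ε * (((t * lam * t : ℕ) : ℝ))⁻¹ := by
  intro ε hε
  obtain ⟨Φ, B, δ, hΦm, hval, hΦB, hcB, hδ, hΦ⟩ := S.exists_scenario_value hν hX hG hS
  have hJ := ordConnected_scenarioBox hν
  obtain ⟨t₀, ht₀⟩ := exists_variance_batchAvg_le hJ hΦm hΦB hcB hδ hΦ hε
  have hanova : ∀ u ∈ Finset.univ.filter (fun u : Finset (Fin m) => 3 ≤ u.card),
      variance (anova (fun z => S.G xs (quantileMap ν z)) u) (uniformCube m) =
        stepVar (fun s : scenarios hν => S.G xs s) (scenarioBox hν) u := fun u hu =>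
    variance_anova _ hJ (fun z hz => comp_quantileMap_eq_stepFn hν (S.G xs) hz)
      (Finset.card_pos.mp (by have := (Finset.mem_filter.mp hu).2; omega))
  -- The increment forces `t > 0`, which the bound for square integrability needs.
  refine ⟨t₀ + 1, fun t lam _ htl O hO => ?_⟩
  have hlam := Nat.pos_of_neZero lam
  have htl' : t₀ * lam ≤ t := le_trans (Nat.mul_le_mul_right lam (Nat.le_succ t₀)) htl
  have ht : 0 < t := lt_of_lt_of_le (by positivity) htl
  -- Only almost sure equality holds, since the jitters lie in `[0,1)`, and hence the design points
  -- in the cube, only almost surely.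
  have hae : ∀ A : Finset (Equiv.Perm (Fin (m + 1))),
      (fun ω => S.lowerBound ν (solhDesign O ω)) =ᵐ[colLaw t lam m A]
        batchAvg O (scenarioBox hν) Φ := by
    intro A
    filter_upwards [ae_colLaw_mem_Ico] with ω hω
    unfold TwoStageLP.lowerBound batchAvg
    congr 1
    refine Finset.sum_congr rfl fun r _ => ?_
    rw [S.saaValue_eq_iInf hν O ω hω r]
    exact hval _ fun s => (boxFreq_mem_Icc _ r ω).1
  have huniv : (Finset.univ : Finset (Equiv.Perm (Fin (m + 1)))).Nonempty := Finset.univ_nonempty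
  refine ⟨?_, fun κ => ?_, ?_⟩
  · rw [solhLaw_eq_colLaw]
    have := isProbabilityMeasure_colLaw (t := t) (lam := lam) huniv
    exact (MemLp.of_bound (measurable_batchAvg hJ hΦm).aestronglyMeasurable B (ae_of_all _ fun ω =>
      abs_inv_mul_sum_le ht fun r => hΦB _ fun s => boxFreq_mem_Icc _ r ω)).ae_eq (hae _).symm
  · have h := ht₀ t lam htl' O hO {κ} (Finset.singleton_nonempty κ)
    rw [cond_solhLaw, variance_congr (hae {κ})]
    refine le_trans (le_of_eq ?_) h
    congr 3
    refine Finset.sum_congr rfl fun u hu => ?_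
    rw [hanova u hu, integral_coincidences_singleton]
  · have h := ht₀ t lam htl' O hO Finset.univ huniv
    rw [solhLaw_eq_colLaw, variance_congr (hae Finset.univ)]
    refine le_trans (le_of_eq ?_) h
    congr 3
    exact Finset.sum_congr rfl fun u hu => by rw [hanova u hu]
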